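/- **Setting.** Let $M,N,J_m,I_m\ge 0$ be integers ($m\in[M]=\{1,\dots,M\}$), $\mathcal X\subseteq\mathbb R^N$, $\widetilde{\mathcal Z}_m\subseteq\mathbb R^{J_m}$, $f_0:\mathbb R^N\to\mathbb R\cup\{+\infty\}$, $g_m:\mathbb R^N\times\mathbb R^{J_m}\to\mathbb R\cup\{\pm\infty\}$, $h_{m,i}:\mathbb R^{J_m}\to\mathbb R\cup\{+\infty\}$ ($i\in[I_m]$). Put $\mathcal Z_m=\widetilde{\mathcal Z}_m\cap\bigcap_{i}\{z: h_{m,i}(z)\le 0\}$, $f_m(x)=\sup_{z\in\mathcal Z_m}g_m(x,z)$, $h_m=(h_{m,1},\dots,h_{m,I_m})$, and consider the robust problem $$\min\ f_0(x)\quad\text{s.t. } x\in\mathcal X,\ f_m(x)\le 0\ \ \forall m\in[M].\tag{R}$$ A point $x\in\mathcal X$ is an $\varepsilon$-approximate optimal solution if $f_0(x)-f_0(x^\star)\le\varepsilon$ for an optimal solution $x^\star$ and $\max\{f_m(x),0\}\le\varepsilon$ for all $m$. Norms are Euclidean, $\mathrm{Proj}$ is the Euclidean projection, $[s]_+=\max\{s,0\}$,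 and $\partial$ is the convex subdifferential, $\partial f(x)=\{\xi: f(y)\ge f(x)+\langle\xi,y-x\rangle\ \forall y\}$, with $y$ ranging over the whole space. **Assumption A.** (i) $\mathcal X$ and all $\widetilde{\mathcal Z}_m$ are non-empty, compact and convex. (ii) $f_0$ is convex and finite on $\mathcal X$; $g_m(\cdot,z)$ is convex on $\mathbb R^N$ for $z\in\widetilde{\mathcal Z}_m$, $g_m(x,\cdot)$ is concave on $\mathbb R^{J_m}$ for $x\in\mathcal X$, and $g_m$ is finite on $\mathcal X\times\widetilde{\mathcal Z}_m$; each $h_{m,i}$ is convex and finite on $\widetilde{\mathcal Z}_m$. (iii) There is $\bar x\in\mathcal X$ with $\sup_{z\in\widetilde{\mathcal Z}_m}g_m(\bar x,z)<0$ for all $m$, and for each $m$ there is $\bar z_m\in\widetilde{\mathcal Z}_m$ with $h_{m,i}(\bar z_m)<0$ for all $i$. (iv) (R) has an optimal solution. **Assumption B.** The sets $\partial f_0(x)$, $\partial_x g_m(x,z)$, $\partial_z(-g_m)(x,z)$, $\partial h_{m,i}(z)$ are non-empty for all $x\in\mathcal X$, $z\in\widetilde{\mathcal Z}_m$, $m$,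 $i$, and their elements are bounded in norm by constants $D_0,D_m,E_m,F_m$ respectively, uniformly in $x$, $z$, $i$. **Assumption C.** $f_0$, $g_m$, $h_{m,i}$ are finite and differentiable on open sets containing $\mathcal X$, $\mathcal X\times\widetilde{\mathcal Z}_m$, $\widetilde{\mathcal Z}_m$ respectively, and there are constants $D_0',D_m',E_{m,1}',E_{m,2}',F_m'>0$ such that for all $m$, $i$, $x,x'\in\mathcal X$ and $z,z'\in\widetilde{\mathcal Z}_m$: $\|\nabla f_0(x)-\nabla f_0(x')\|\le D_0'\|x-x'\|$, $\|\nabla_xg_m(x,z)-\nabla_xg_m(x',z)\|\le D_m'\|x-x'\|$, $\|\nabla_zg_m(x,z)-\nabla_zg_m(x',z')\|\le E_{m,1}'\|x-x'\|+E_{m,2}'\|z-z'\|$, $\|\nabla h_{m,i}(z)-\nabla h_{m,i}(z')\|\le F_m'\|z-z'\|$. **Algorithm (extended ProM$^3$).** Fix any $\bar z_m$ as in A(iii) and any $G_m<0$ with $g_m(x,\bar z_m)\ge G_m$ for all $x\in\mathcal X$. Let $a_m=G_m/\max_i h_{m,i}(\bar z_m)$ (irrelevant if $I_m=0$), $\mathcal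 M=\prod_m[0,a_m]^{I_m}$, $\tilde g_m(x,\mu_m,z)=g_m(x,z)-\mu_m^\top h_m(z)$. Parameters: integers $K,T\ge1$ and reals $\alpha,\beta,\theta,\nu,\gamma,\delta>0$. Start from $x^0\in\mathcal X$, $\mu^0\in\mathcal M$, $\lambda^0=0$. For $k=0,\dots,K-1$: * for each $m$ take any $z_m^k\in\widetilde{\mathcal Z}_m$ with $\sup_{w\in\widetilde{\mathcal Z}_m}\tilde g_m(x^k,\mu_m^k,w)\le\tilde g_m(x^k,\mu_m^k,z_m^k)+\theta$ and set $\lambda_m^{k+1}=[\lambda_m^k+\beta(2\tilde g_m(x^k,\mu_m^k,z_m^k)-\tilde g_m(x^{k-1},\mu_m^{k-1},z_m^{k-1}))]_+$, where index $-1$ means index $0$; * from any $x_0\in\mathcal X$, $\mu_0\in\mathcal M$, $z_0\in\prod_m\widetilde{\mathcal Z}_m$, run for $t=0,\dots,T-1$ (index $-1$ again meaning $0$): take any $\zeta_{t,m}\in\partial_z(-g_m)(x_t,z_{t,m})$, $\eta_{t,m,i}\in\partial h_{m,i}(z_{t,m})$, $$z_{t+1,m}=\mathrm{Proj}_{\widetilde{\mathcal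 Z}_m}\Big(z_{t,m}-\delta\lambda_m^{k+1}\big(2\zeta_{t,m}-\zeta_{t-1,m}+\textstyle\sum_i(2\mu_{t,m,i}\eta_{t,m,i}-\mu_{t-1,m,i}\eta_{t-1,m,i})\big)\Big),$$ take any $\xi_{t,0}\in\partial f_0(x_t)$, $\xi_{t,m}\in\partial_xg_m(x_t,z_{t+1,m})$, put $\xi_t=\xi_{t,0}+\sum_m\lambda_m^{k+1}\xi_{t,m}$ and $$x_{t+1}=\mathrm{Proj}_{\mathcal X}\Big(\tfrac{\alpha\gamma}{\alpha+\gamma}\big(\tfrac1\alpha x^k+\tfrac1\gamma x_t-\xi_t\big)\Big),\quad \mu_{t+1,m}=\mathrm{Proj}_{[0,a_m]^{I_m}}\Big(\tfrac{\alpha\gamma}{\alpha+\gamma}\big(\tfrac1\alpha\mu_m^k+\tfrac1\gamma\mu_{t,m}+\lambda_m^{k+1}h_m(z_{t+1,m})\big)\Big);$$ set $(x^{k+1},\mu^{k+1},\tilde z^{k+1})=\frac1T\sum_{t=1}^T(x_t,\mu_t,z_t)$. Output $\bar x^K=\frac1K\sum_{k=1}^Kx^k$. The number of oracle calls counts every subgradient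 computation, every projection and every approximate maximization. **Theorem.** Let Assumption A hold, and let $r=3$ under Assumption B and $r=2$ under Assumption C. Then there is a constant $C>0$ such that for every $\varepsilon>0$ the parameters can be chosen so that the number of oracle calls is at most $C\max\{1,\varepsilon^{-r}\}$ and, for every starting point $(x^0,\mu^0)\in\mathcal X\times\mathcal M$, the algorithm can be run, and in every run: $(x^{k+1},\mu^{k+1},\tilde z^{k+1})$ is, for each $k<K$, a strong $\nu$-approximate saddle point of $$F(x,\mu;z)=f_0(x)+\sum_m\lambda_m^{k+1}\tilde g_m(x,\mu_m,z_m)+\tfrac1{2\alpha}\|x-x^k\|^2+\tfrac1{2\alpha}\|\mu-\mu^k\|^2,$$ that is, $F(x^{k+1},\mu^{k+1};z)\le F(x,\mu;\tilde z^{k+1})-\tfrac1{2\alpha}(\|x-x^{k+1}\|^2+\|\mu-\mu^{k+1}\|^2)+\nu$ for all $x\in\mathcal X$, $\mu\in\mathcal M$, $z\in\prod_m\widetilde{\mathcal Z}_m$; and $\bar x^K$ is an $\varepsilon$-approximate optimal solution of (R). In short, the oracle complexity of extended ProM$^3$ is $O(\varepsilon^{-3})$ under A and B, and $O(\varepsilon^{-2})$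 under A and C. -/

import Mathlib

namespace RobustOpt

/-- `ℝⁿ` with the Euclidean norm. -/
abbrev Vec (n : ℕ) : Type := EuclideanSpace ℝ (Fin n)

/-- Convexity of an extended-real-valued function on the whole space: its epigraph is convex. -/
def IsConvexFn {n : ℕ} (f : Vec n → EReal) : Prop :=
  Convex ℝ {p : Vec n × ℝ | f p.1 ≤ (p.2 : EReal)}

/-- The subdifferential of an extended-real-valued function: all `ξ` with
`f x + ⟪ξ, y - x⟫ ≤ f y` for every `y` of the whole space. -/
def subdiff {n : ℕ} (f : Vec n → EReal) (x : Vec n) : Set (Vec n) :=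
  {ξ | ∀ y : Vec n, f x + ((inner ℝ ξ (y - x) : ℝ) : EReal) ≤ f y}

/-- The value is a real number. -/
def IsFinite (r : EReal) : Prop := r ≠ ⊥ ∧ r ≠ ⊤

/-- `p` is the Euclidean projection of `y` onto `S`. -/
def IsProj {n : ℕ} (S : Set (Vec n)) (y p : Vec n) : Prop :=
  p ∈ S ∧ ∀ q ∈ S, ‖y - p‖ ≤ ‖y - q‖

/-- Differentiability on a set that need not be open: the function is real-valued and
differentiable on some open set containing it. -/
def DiffOnNhd {E : Type*} [NormedAddCommGroup E] [NormedSpace ℝ E]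
    (f : E → EReal) (S : Set E) : Prop :=
  ∃ U : Set E, IsOpen U ∧ S ⊆ U ∧ (∀ p ∈ U, IsFinite (f p)) ∧
    DifferentiableOn ℝ (fun p => (f p).toReal) U

/-- The gradient of (the real-valued part of) an extended-real-valued function. -/
noncomputable def grad {n : ℕ} (f : Vec n → EReal) (x : Vec n) : Vec n :=
  gradient (fun y => (f y).toReal) x

/-- Data of a robust optimization problem with `M` uncertain constraints in dimension `N`;
the `m`-th uncertainty set lives in dimension `J m`, and it is cut out of `Zt m` by the `I m`
inequalities `h m i ≤ 0`. -/
structure Problem (M N : ℕ) (J I : Fin M → ℕ) where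
  f0 : Vec N → EReal
  g : (m : Fin M) → Vec N → Vec (J m) → EReal
  h : (m : Fin M) → Fin (I m) → Vec (J m) → EReal
  X : Set (Vec N)
  Zt : (m : Fin M) → Set (Vec (J m))

namespace Problem

variable {M N : ℕ} {J I : Fin M → ℕ} (P : Problem M N J I)

/-- The uncertainty set `Z̃ₘ ∩ ⋂ᵢ {h_{m,i} ≤ 0}`. -/
def Z (m : Fin M) : Set (Vec (J m)) := P.Zt m ∩ ⋂ i, {z | P.h m i z ≤ 0}

/-- The worst-case constraint function `fₘ(x) = sup {gₘ(x, z) | z ∈ Zₘ}`. -/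
noncomputable def worst (m : Fin M) (x : Vec N) : EReal := ⨆ z ∈ P.Z m, P.g m x z

/-- Feasibility for the robust problem. -/
def IsFeasible (x : Vec N) : Prop := x ∈ P.X ∧ ∀ m, P.worst m x ≤ 0

/-- Optimality for the robust problem. -/
def IsOptimal (x : Vec N) : Prop :=
  P.IsFeasible x ∧ ∀ y, P.IsFeasible y → P.f0 x ≤ P.f0 y

/-- `ε`-approximate optimal solutions of the robust problem:
`f₀(x) - f₀(x⋆) ≤ ε` and `[fₘ(x)]₊ ≤ ε` for every `m`. -/
def IsApproxOptimal (ε : ℝ) (x : Vec N) : Prop :=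
  x ∈ P.X ∧ (∀ xs, P.IsOptimal xs → P.f0 x ≤ P.f0 xs + (ε : EReal)) ∧
    ∀ m, max (P.worst m x) 0 ≤ (ε : EReal)

/-- A family of Slater points for the uncertainty sets. -/
def IsSlaterFamily (zbar : (m : Fin M) → Vec (J m)) : Prop :=
  ∀ m, zbar m ∈ P.Zt m ∧ ∀ i, P.h m i (zbar m) < 0

/-- Convexity, compactness, Slater points, existence of an optimal solution. -/
structure Regular : Prop where
  X_nonempty : P.X.Nonempty
  X_compact : IsCompact P.X
  X_convex : Convex ℝ P.X
  Zt_nonempty : ∀ m, (P.Zt m).Nonempty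
  Zt_compact : ∀ m, IsCompact (P.Zt m)
  Zt_convex : ∀ m, Convex ℝ (P.Zt m)
  f0_ne_bot : ∀ x, P.f0 x ≠ ⊥
  f0_convex : IsConvexFn P.f0
  f0_finite : ∀ x ∈ P.X, IsFinite (P.f0 x)
  g_convex : ∀ m, ∀ z ∈ P.Zt m, IsConvexFn (fun x => P.g m x z)
  g_concave : ∀ m, ∀ x ∈ P.X, IsConvexFn (fun z => -P.g m x z)
  g_finite : ∀ m, ∀ x ∈ P.X, ∀ z ∈ P.Zt m, IsFinite (P.g m x z)
  h_ne_bot : ∀ m i z, P.h m i z ≠ ⊥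
  h_convex : ∀ m i, IsConvexFn (P.h m i)
  h_finite : ∀ m i, ∀ z ∈ P.Zt m, IsFinite (P.h m i z)
  slater_x : ∃ xbar ∈ P.X, ∀ m, (⨆ z ∈ P.Zt m, P.g m xbar z) < 0
  slater_z : ∃ zbar, P.IsSlaterFamily zbar
  exists_optimal : ∃ xs, P.IsOptimal xs

/-- Non-empty and uniformly bounded subdifferentials. -/
structure BoundedSubgradients : Prop where
  f0_nonempty : ∀ x ∈ P.X, (subdiff P.f0 x).Nonempty
  gx_nonempty : ∀ m, ∀ x ∈ P.X, ∀ z ∈ P.Zt m, (subdiff (fun y => P.g m y z) x).Nonempty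
  gz_nonempty : ∀ m, ∀ x ∈ P.X, ∀ z ∈ P.Zt m, (subdiff (fun w => -P.g m x w) z).Nonempty
  h_nonempty : ∀ m i, ∀ z ∈ P.Zt m, (subdiff (P.h m i) z).Nonempty
  f0_bounded : ∃ D0 > (0 : ℝ), ∀ x ∈ P.X, ∀ ξ ∈ subdiff P.f0 x, ‖ξ‖ ≤ D0
  gx_bounded : ∀ m, ∃ D > (0 : ℝ), ∀ x ∈ P.X, ∀ z ∈ P.Zt m,
    ∀ ξ ∈ subdiff (fun y => P.g m y z) x, ‖ξ‖ ≤ D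
  gz_bounded : ∀ m, ∃ E > (0 : ℝ), ∀ x ∈ P.X, ∀ z ∈ P.Zt m,
    ∀ ζ ∈ subdiff (fun w => -P.g m x w) z, ‖ζ‖ ≤ E
  h_bounded : ∀ m, ∃ F > (0 : ℝ), ∀ i, ∀ z ∈ P.Zt m, ∀ η ∈ subdiff (P.h m i) z, ‖η‖ ≤ F

/-- Differentiability with Lipschitz continuous gradients. -/
structure LipschitzGradients : Prop where
  f0_diff : DiffOnNhd P.f0 P.X
  g_diff : ∀ m, DiffOnNhd (fun p : Vec N × Vec (J m) => P.g m p.1 p.2) (P.X ×ˢ P.Zt m)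
  h_diff : ∀ m i, DiffOnNhd (P.h m i) (P.Zt m)
  f0_lip : ∃ D0 > (0 : ℝ), ∀ x ∈ P.X, ∀ x' ∈ P.X,
    ‖grad P.f0 x - grad P.f0 x'‖ ≤ D0 * ‖x - x'‖
  gx_lip : ∀ m, ∃ D > (0 : ℝ), ∀ x ∈ P.X, ∀ x' ∈ P.X, ∀ z ∈ P.Zt m,
    ‖grad (fun y => P.g m y z) x - grad (fun y => P.g m y z) x'‖ ≤ D * ‖x - x'‖
  gz_lip : ∀ m, ∃ E1 > (0 : ℝ), ∃ E2 > (0 : ℝ),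
    ∀ x ∈ P.X, ∀ x' ∈ P.X, ∀ z ∈ P.Zt m, ∀ z' ∈ P.Zt m,
      ‖grad (P.g m x) z - grad (P.g m x') z'‖ ≤ E1 * ‖x - x'‖ + E2 * ‖z - z'‖
  h_lip : ∀ m, ∃ F > (0 : ℝ), ∀ i, ∀ z ∈ P.Zt m, ∀ z' ∈ P.Zt m,
    ‖grad (P.h m i) z - grad (P.h m i) z'‖ ≤ F * ‖z - z'‖

/-- `G m < 0` is a lower bound of `gₘ(·, z̄ₘ)` on `X`. -/
def IsLowerBound (zbar : (m : Fin M) → Vec (J m)) (G : Fin M → ℝ) : Prop :=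
  ∀ m, G m < 0 ∧ ∀ x ∈ P.X, (G m : EReal) ≤ P.g m x (zbar m)

/-- The bound `aₘ = Gₘ / maxᵢ h_{m,i}(z̄ₘ)` on the multipliers. If `I m = 0` there are no
multipliers for `m` and the value is irrelevant. -/
noncomputable def multBound (zbar : (m : Fin M) → Vec (J m)) (G : Fin M → ℝ) (m : Fin M) : ℝ :=
  G m / ⨆ i, (P.h m i (zbar m)).toReal

end Problem

/-- The box `[0, c]ⁿ`. -/
def box (n : ℕ) (c : ℝ) : Set (Vec n) := {μ | ∀ i, 0 ≤ μ i ∧ μ i ≤ c}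

/-- Input parameters of the extended algorithm. -/
structure Params where
  K : ℕ
  T : ℕ
  α : ℝ
  β : ℝ
  θ : ℝ
  ν : ℝ
  γ : ℝ
  δ : ℝ
  one_le_K : 1 ≤ K
  one_le_T : 1 ≤ T
  α_pos : 0 < α
  β_pos : 0 < β
  θ_pos : 0 < θ
  ν_pos : 0 < ν
  γ_pos : 0 < γ
  δ_pos : 0 < δ

namespace Problem

variable {M N : ℕ} {J I : Fin M → ℕ} (P : Problem M N J I)

/-- The vector `hₘ(z)`. -/
noncomputable def hvec (m : Fin M) (z : Vec (J m)) : Vec (I m) :=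
  WithLp.toLp 2 (fun i => (P.h m i z).toReal)

/-- The penalized constraint function `g̃ₘ(x, μₘ, z) = gₘ(x, z) - μₘᵀ hₘ(z)`. -/
noncomputable def gpen (m : Fin M) (x : Vec N) (μ : Vec (I m)) (z : Vec (J m)) : ℝ :=
  (P.g m x z).toReal - ∑ i, μ i * (P.h m i z).toReal

/-- Objective of the inner saddle-point problem with multipliers `lam` and prox-centre
`(xc, μc)`. -/
noncomputable def innerObj (α : ℝ) (xc : Vec N) (μc : (m : Fin M) → Vec (I m))
    (lam : Fin M → ℝ) (x : Vec N) (μ : (m : Fin M) → Vec (I m))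
    (z : (m : Fin M) → Vec (J m)) : ℝ :=
  (P.f0 x).toReal + ∑ m, lam m * P.gpen m x (μ m) (z m)
    + 1 / (2 * α) * ‖x - xc‖ ^ 2 + 1 / (2 * α) * ∑ m, ‖μ m - μc m‖ ^ 2

/-- `((xs, μs), zs)` is a strong `ν`-approximate saddle point of the inner saddle-point problem,
whose objective is `1/α`-strongly convex in `(x, μ)`. -/
def IsStrongSaddle (a : Fin M → ℝ) (α ν : ℝ) (xc : Vec N) (μc : (m : Fin M) → Vec (I m))
    (lam : Fin M → ℝ) (xs : Vec N) (μs : (m : Fin M) → Vec (I m))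
    (zs : (m : Fin M) → Vec (J m)) : Prop :=
  xs ∈ P.X ∧ (∀ m, μs m ∈ box (I m) (a m)) ∧ (∀ m, zs m ∈ P.Zt m) ∧
    ∀ x ∈ P.X, ∀ μ : (m : Fin M) → Vec (I m), (∀ m, μ m ∈ box (I m) (a m)) →
      ∀ z : (m : Fin M) → Vec (J m), (∀ m, z m ∈ P.Zt m) →
        P.innerObj α xc μc lam xs μs z ≤ P.innerObj α xc μc lam x μ zs
          - 1 / α / 2 * (‖x - xs‖ ^ 2 + ∑ m, ‖μ m - μs m‖ ^ 2) + ν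

end Problem

/-- Everything that is computed during one call of the inner algorithm; index `t`. -/
structure InnerTrace (M N : ℕ) (J I : Fin M → ℕ) where
  x : ℕ → Vec N
  μ : ℕ → (m : Fin M) → Vec (I m)
  z : ℕ → (m : Fin M) → Vec (J m)
  ζ : ℕ → (m : Fin M) → Vec (J m)
  η : ℕ → (m : Fin M) → Fin (I m) → Vec (J m)
  ξ0 : ℕ → Vec N
  ξ : ℕ → Fin M → Vec N

namespace InnerTrace

variable {M N : ℕ} {J I : Fin M → ℕ} (R : InnerTrace M N J I)

/-- The trace is a run of the extended inner algorithm with prox-centre `(xc, μc)` and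
multipliers `lam`, from some starting point. The natural-number index `t - 1` is `0` for `t = 0`,
which is the convention `ζ₋₁ = ζ₀`, `η₋₁ = η₀`, `μ₋₁ = μ₀` for the first iteration. -/
structure IsRun (P : Problem M N J I) (a : Fin M → ℝ) (p : Params) (xc : Vec N)
    (μc : (m : Fin M) → Vec (I m)) (lam : Fin M → ℝ) : Prop where
  x_init : R.x 0 ∈ P.X
  μ_init : ∀ m, R.μ 0 m ∈ box (I m) (a m)
  z_init : ∀ m, R.z 0 m ∈ P.Zt m
  ζ_mem : ∀ t < p.T, ∀ m, R.ζ t m ∈ subdiff (fun w => -P.g m (R.x t) w) (R.z t m)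
  η_mem : ∀ t < p.T, ∀ m i, R.η t m i ∈ subdiff (P.h m i) (R.z t m)
  z_step : ∀ t < p.T, ∀ m, IsProj (P.Zt m)
    (R.z t m - (p.δ * lam m) • ((2 : ℝ) • R.ζ t m - R.ζ (t - 1) m
      + ∑ i, ((2 * R.μ t m i) • R.η t m i - R.μ (t - 1) m i • R.η (t - 1) m i)))
    (R.z (t + 1) m)
  ξ0_mem : ∀ t < p.T, R.ξ0 t ∈ subdiff P.f0 (R.x t)
  ξ_mem : ∀ t < p.T, ∀ m, R.ξ t m ∈ subdiff (fun y => P.g m y (R.z (t + 1) m)) (R.x t)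
  x_step : ∀ t < p.T, IsProj P.X
    ((p.α * p.γ / (p.α + p.γ)) • ((1 / p.α) • xc + (1 / p.γ) • R.x t
      - (R.ξ0 t + ∑ m, lam m • R.ξ t m)))
    (R.x (t + 1))
  μ_step : ∀ t < p.T, ∀ m, IsProj (box (I m) (a m))
    ((p.α * p.γ / (p.α + p.γ)) • ((1 / p.α) • μc m + (1 / p.γ) • R.μ t m
      + lam m • P.hvec m (R.z (t + 1) m)))
    (R.μ (t + 1) m)

/-- The outputs: averages of the iterates `1, …, T`. -/
noncomputable def xout (T : ℕ) : Vec N := (1 / (T : ℝ)) • ∑ t ∈ Finset.Icc 1 T, R.x t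

noncomputable def μout (T : ℕ) (m : Fin M) : Vec (I m) :=
  (1 / (T : ℝ)) • ∑ t ∈ Finset.Icc 1 T, R.μ t m

noncomputable def zout (T : ℕ) (m : Fin M) : Vec (J m) :=
  (1 / (T : ℝ)) • ∑ t ∈ Finset.Icc 1 T, R.z t m

end InnerTrace

/-- Everything that is computed during the extended algorithm; index `k`. `z k m` is the
approximate maximizer of the multiplier update, `inner k` the call of the inner algorithm. -/
structure Trace (M N : ℕ) (J I : Fin M → ℕ) where
  x : ℕ → Vec N
  μ : ℕ → (m : Fin M) → Vec (I m)
  lam : ℕ → Fin M → ℝ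
  z : ℕ → (m : Fin M) → Vec (J m)
  inner : ℕ → InnerTrace M N J I

namespace Trace

variable {M N : ℕ} {J I : Fin M → ℕ} (R : Trace M N J I)

/-- The trace is a run of the extended algorithm from `(x0, μ0)`: the outer algorithm, whose
`(x, μ)`-update is the output of the inner algorithm after `T` iterations. The natural-number
index `k - 1` is `0` for `k = 0`, which is the convention for the first iteration. That the
outputs of the inner algorithm are strong approximate saddle points is not required here. -/
structure IsRun (P : Problem M N J I) (a : Fin M → ℝ) (p : Params) (x0 : Vec N)
    (μ0 : (m : Fin M) → Vec (I m)) : Prop where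
  x_init : R.x 0 = x0
  μ_init : R.μ 0 = μ0
  lam_init : R.lam 0 = 0
  z_mem : ∀ k < p.K, ∀ m, R.z k m ∈ P.Zt m
  z_approx : ∀ k < p.K, ∀ m, ∀ w ∈ P.Zt m,
    P.gpen m (R.x k) (R.μ k m) w ≤ P.gpen m (R.x k) (R.μ k m) (R.z k m) + p.θ
  lam_step : ∀ k < p.K, ∀ m, R.lam (k + 1) m =
    max (R.lam k m + p.β * (2 * P.gpen m (R.x k) (R.μ k m) (R.z k m)
      - P.gpen m (R.x (k - 1)) (R.μ (k - 1) m) (R.z (k - 1) m))) 0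
  inner_run : ∀ k < p.K, (R.inner k).IsRun P a p (R.x k) (R.μ k) (R.lam (k + 1))
  x_step : ∀ k < p.K, R.x (k + 1) = (R.inner k).xout p.T
  μ_step : ∀ k < p.K, R.μ (k + 1) = (R.inner k).μout p.T

/-- The output: the average of the outer iterates `1, …, K`. -/
noncomputable def output (K : ℕ) : Vec N := (1 / (K : ℝ)) • ∑ k ∈ Finset.Icc 1 K, R.x k

end Trace

namespace Params

/-- Oracle calls in one inner iteration: a subgradient of `f₀`; for each `m` a subgradient of
`gₘ(·, z)` and one of `-gₘ(x, ·)`; for each `(m, i)` a subgradient of `h_{m,i}`; the projection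
onto `X`; for each `m` the projections onto `Z̃ₘ` and onto `[0, aₘ]^{Iₘ}`. -/
def innerIterCalls (M : ℕ) (I : Fin M → ℕ) : ℕ :=
  (1 + M + M + ∑ m, I m) + (1 + M + M)

/-- Oracle calls of the whole algorithm: in each of the `K` outer iterations, the `M`
approximate maximizations of the multiplier update (one call each) and `T` inner iterations. -/
def calls (p : Params) (M : ℕ) (I : Fin M → ℕ) : ℕ :=
  ∑ _k ∈ Finset.range p.K, (M + ∑ _t ∈ Finset.range p.T, innerIterCalls M I)

end Params

/-- The oracle complexity of the extended algorithm with multiplier bounds `a` for reaching an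
`ε`-approximate optimal solution is `O(ε⁻ʳ)`: there is a constant `C` such that for every `ε > 0`
the parameters can be chosen with at most `C max(1, ε⁻ʳ)` oracle calls so that, from every
starting point, the algorithm can be run, and in every run (whatever the subgradients, the
approximate maximizers and the starting points of the inner calls are) each inner call returns a
strong `ν`-approximate saddle point and the output is `ε`-approximately optimal. -/
def HasOracleComplexity {M N : ℕ} {J I : Fin M → ℕ} (P : Problem M N J I) (a : Fin M → ℝ)
    (r : ℕ) : Prop :=
  ∃ C : ℝ, 0 < C ∧ ∀ ε : ℝ, 0 < ε → ∃ p : Params,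
    (p.calls M I : ℝ) ≤ C * max 1 ((1 / ε) ^ r) ∧
    ∀ x0 ∈ P.X, ∀ μ0 : (m : Fin M) → Vec (I m), (∀ m, μ0 m ∈ box (I m) (a m)) →
      (∃ R : Trace M N J I, R.IsRun P a p x0 μ0) ∧
      ∀ R : Trace M N J I, R.IsRun P a p x0 μ0 →
        (∀ k < p.K, P.IsStrongSaddle a p.α p.ν (R.x k) (R.μ k) (R.lam (k + 1))
          ((R.inner k).xout p.T) ((R.inner k).μout p.T) ((R.inner k).zout p.T)) ∧
        P.IsApproxOptimal ε (R.output p.K)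

end RobustOpt

/-!
The worst case of a constraint over `Zₘ` is removed by duality: with multipliers `μₘ` for
`hₘ ≤ 0`, the constraint `fₘ(x) ≤ 0` is implied by `sup {g̃ₘ(x, μₘ, z) | z ∈ Z̃ₘ} ≤ 0`, and by the
Slater point `z̄ₘ` it is equivalent to the existence of such a `μₘ` in `[0, aₘ]^{Iₘ}`. The resulting
convex problem in `(x, μ)` has a Lagrange saddle point because of the Slater point `x̄`.

The outer algorithm is extrapolated dual ascent with proximal primal steps on the Lagrangian. The
extrapolation leaves an error of second order in the primal step, which the proximal terms absorb
once `β` is small, so the Lagrangian gap accumulated over any number of iterations stays below a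
constant: averaging makes the output `O(1/K)`-optimal. The same estimate, at the saddle point,
bounds the next multiplier as long as all earlier inner problems were solved, so by induction the
multipliers lie in a fixed interval `[0, Λ]`.

The inner algorithm is an extrapolated projected subgradient method. If the subgradients vary by at
most `A + L · distance`, a Lyapunov function absorbs the Lipschitz part at a fixed step size and the
part `A` costs an error proportional to the step size. For accuracy `1/K` this takes `O(K)` steps
of fixed size if `A = 0`, as for Lipschitz gradients, and `O(K²)` steps of size `O(1/K)` in
general. With `K` of order `1/ε`, the total is `O(ε⁻²)` and `O(ε⁻³)` oracle calls.
-/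

open Filter Topology

namespace RobustOpt

section Alternative

variable {E κ ι : Type*} {S : Set E}

/-- The vectors that strictly dominate the value `(F o s)ₒ` of some `s ∈ S`: the convex open set
that is separated from the origin in the theorem of the alternative. -/
def strictUpperImage (F : κ → E → ℝ) (S : Set E) : Set (κ → ℝ) :=
  {u | ∃ s ∈ S, ∀ o, F o s < u o}

theorem isOpen_strictUpperImage [Finite κ] (F : κ → E → ℝ) (S : Set E) :
    IsOpen (strictUpperImage F S) := by
  have h_union : strictUpperImage F S = ⋃ s ∈ S, Set.univ.pi fun o => Set.Ioi (F o s) := by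
    ext u
    simp [strictUpperImage]
  rw [h_union]
  exact isOpen_biUnion fun s _ => isOpen_set_pi Set.finite_univ fun o _ => isOpen_Ioi

variable [AddCommGroup E] [Module ℝ E]

theorem convex_strictUpperImage {F : κ → E → ℝ} (hS : Convex ℝ S)
    (hF : ∀ o, ConvexOn ℝ S (F o)) : Convex ℝ (strictUpperImage F S) := by
  rw [convex_iff_forall_pos]
  rintro u ⟨s, hs, hsu⟩ v ⟨t, ht, htv⟩ a b ha hb hab
  refine ⟨a • s + b • t, hS hs ht ha.le hb.le hab, fun o => ?_⟩
  calc F o (a • s + b • t) ≤ a * F o s + b * F o t := (hF o).2 hs ht ha.le hb.le hab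
    _ < a * u o + b * v o :=
      add_lt_add (mul_lt_mul_of_pos_left (hsu o) ha) (mul_lt_mul_of_pos_left (htv o) hb)

theorem exists_nonneg_sum_mul_nonneg [Fintype κ] {F : κ → E → ℝ} (hS : Convex ℝ S)
    (hne : S.Nonempty) (hF : ∀ o, ConvexOn ℝ S (F o)) (h : ∀ s ∈ S, ∃ o, 0 ≤ F o s) :
    ∃ y : κ → ℝ, (∀ o, 0 ≤ y o) ∧ y ≠ 0 ∧ ∀ s ∈ S, 0 ≤ ∑ o, y o * F o s := by
  classical
  have h_zero : (0 : κ → ℝ) ∉ strictUpperImage F S := fun ⟨s, hs, hlt⟩ =>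
    let ⟨o, ho⟩ := h s hs
    (hlt o).not_ge ho
  obtain ⟨φ, hφ⟩ := geometric_hahn_banach_point_open (convex_strictUpperImage hS hF)
    (isOpen_strictUpperImage F S) h_zero
  rw [map_zero] at hφ
  obtain ⟨s₀, hs₀⟩ := hne
  set e : κ → κ → ℝ := fun o j => if o = j then 1 else 0 with he
  have hφ_sum (u : κ → ℝ) : φ u = ∑ o, φ (e o) * u o := by
    simpa [mul_comm] using LinearMap.pi_apply_eq_sum_univ (φ : (κ → ℝ) →ₗ[ℝ] ℝ) u
  have hφ_pos {t : ℝ} (ht : 0 ≤ t) (o : κ) : 0 < φ (fun j => F j s₀ + 1) + t * φ (e o) := by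
    rw [← smul_eq_mul, ← map_smul, ← map_add]
    refine hφ _ ⟨s₀, hs₀, fun j => ?_⟩
    have : 0 ≤ t * e o j := mul_nonneg ht (by simp only [he]; split_ifs <;> norm_num)
    simpa using by linarith
  refine ⟨fun o => φ (e o), fun o => ?_, fun h_eq => ?_, fun s hs => ?_⟩
  · by_contra! h_neg
    have hφ₀ : 0 < φ (fun j => F j s₀ + 1) := by simpa using hφ_pos le_rfl o
    have := hφ_pos (div_nonneg hφ₀.le (neg_nonneg.2 h_neg.le)) o
    rw [div_neg, neg_mul, div_mul_cancel₀ _ h_neg.ne] at this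
    linarith
  · have := hφ (fun o => F o s₀ + 1) ⟨s₀, hs₀, fun o => lt_add_one _⟩
    rw [hφ_sum] at this
    exact this.ne' (Finset.sum_eq_zero fun o _ => mul_eq_zero_of_left (congrFun h_eq o) _)
  · have h_cont : Continuous fun ε : ℝ => φ fun o => F o s + ε := by fun_prop
    have h_lim := (h_cont.tendsto' 0 _ rfl).mono_left (nhdsWithin_le_nhds (s := Set.Ioi 0))
    rw [← hφ_sum fun o => F o s]
    simpa using ge_of_tendsto h_lim (eventually_mem_nhdsWithin.mono fun ε hε =>
      (hφ _ ⟨s, hs, fun o => lt_add_of_pos_right _ hε⟩).le)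

theorem exists_lagrange_multiplier [Fintype ι] {f : E → ℝ} {c : ι → E → ℝ}
    (hf : ConvexOn ℝ S f) (hc : ∀ i, ConvexOn ℝ S (c i)) {s₀ : E} (hs₀ : s₀ ∈ S)
    (hslater : ∀ i, c i s₀ < 0) {v : ℝ} (hv : ∀ s ∈ S, (∀ i, c i s ≤ 0) → v ≤ f s) :
    ∃ l : ι → ℝ, (∀ i, 0 ≤ l i) ∧ ∀ s ∈ S, v ≤ f s + ∑ i, l i * c i s := by
  let F : Option ι → E → ℝ := fun o => o.elim (fun s => f s - v) c
  have hF : ∀ o, ConvexOn ℝ S (F o)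
    | none => hf.sub (concaveOn_const v hf.1)
    | some i => hc i
  have h_alt (s : E) (hs : s ∈ S) : ∃ o, 0 ≤ F o s := by
    by_contra! h_neg
    exact (h_neg none).not_ge (sub_nonneg.2 (hv s hs fun i => (h_neg (some i)).le))
  obtain ⟨y, hy, hy_ne, h_sum⟩ := exists_nonneg_sum_mul_nonneg hf.1 ⟨s₀, hs₀⟩ hF h_alt
  replace h_sum (s : E) (hs : s ∈ S) :
      0 ≤ y none * (f s - v) + ∑ i, y (some i) * c i s :=
    (h_sum s hs).trans_eq (Fintype.sum_option _)
  -- If the objective had weight zero, the Slater point would contradict `h_sum`.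
  have hy_pos : 0 < y none := by
    refine (hy none).lt_of_ne' fun h_none => hy_ne (funext fun o => ?_)
    have h_terms : ∀ i ∈ Finset.univ, y (some i) * c i s₀ ≤ 0 := fun i _ =>
      mul_nonpos_of_nonneg_of_nonpos (hy _) (hslater i).le
    have h_zero : ∑ i, y (some i) * c i s₀ = 0 :=
      (Finset.sum_nonpos h_terms).antisymm (by simpa [h_none] using h_sum s₀ hs₀)
    cases o with
    | none => exact h_none
    | some i => simpa [(hslater i).ne] using
        (Finset.sum_eq_zero_iff_of_nonpos h_terms).1 h_zero i (Finset.mem_univ i)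
  refine ⟨fun i => y (some i) / y none, fun i => div_nonneg (hy _) hy_pos.le, fun s hs => ?_⟩
  have h_scaled : y none * (f s - v + ∑ i, y (some i) / y none * c i s)
      = y none * (f s - v) + ∑ i, y (some i) * c i s := by
    rw [mul_add, Finset.mul_sum]
    congr 1
    exact Finset.sum_congr rfl fun i _ => by field_simp
  have := nonneg_of_mul_nonneg_right (h_scaled ▸ h_sum s hs) hy_pos
  linarith

end Alternative

section Projection

variable {n : ℕ} {S : Set (Vec n)} {c p q v y : Vec n}

theorem exists_isProj (hS : IsCompact S) (hne : S.Nonempty) (y : Vec n) : ∃ p, IsProj S y p :=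
  let ⟨p, hp, h_min⟩ := hS.exists_isMinOn hne (f := fun q => ‖y - q‖) (by fun_prop)
  ⟨p, hp, fun _ hq => h_min hq⟩

theorem IsProj.inner_le_zero (h : IsProj S y p) (hS : Convex ℝ S) (hq : q ∈ S) :
    inner ℝ (y - p) (q - p) ≤ 0 := by
  have : Nonempty S := ⟨⟨p, h.1⟩⟩
  have h_lower : BddBelow (Set.range fun w : S => ‖y - w‖) :=
    ⟨0, Set.forall_mem_range.2 fun _ => norm_nonneg _⟩
  refine (norm_eq_iInf_iff_real_inner_le_zero hS h.1).1 (le_antisymm ?_ ?_) q hq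
  · exact le_ciInf fun w => h.2 w w.2
  · exact ciInf_le h_lower ⟨p, h.1⟩

theorem inner_sub_sub_eq {V : Type*} [NormedAddCommGroup V] [InnerProductSpace ℝ V]
    (c p q : V) : inner ℝ (c - p) (q - p) = (‖p - c‖ ^ 2 + ‖q - p‖ ^ 2 - ‖q - c‖ ^ 2) / 2 := by
  rw [← sub_sub_sub_cancel_right q c p, norm_sub_sq_real (q - p) (c - p), real_inner_comm,
    norm_sub_rev p c]
  ring

theorem IsProj.step_le {δ : ℝ} (h : IsProj S (y - δ • v) p) (hS : Convex ℝ S) (hδ : 0 < δ)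
    (hq : q ∈ S) :
    inner ℝ v (p - q) ≤ (‖q - y‖ ^ 2 - ‖q - p‖ ^ 2 - ‖p - y‖ ^ 2) / (2 * δ) := by
  have h_proj := h.inner_le_zero hS hq
  rw [sub_right_comm, inner_sub_left, real_inner_smul_left, inner_sub_sub_eq,
    ← neg_sub p q, inner_neg_right, norm_neg] at h_proj
  rw [norm_sub_rev q p, le_div_iff₀ (by positivity)]
  linarith

theorem IsProj.prox_step_le {α γ : ℝ}
    (h : IsProj S ((α * γ / (α + γ)) • ((1 / α) • c + (1 / γ) • y - v)) p) (hS : Convex ℝ S)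
    (hα : 0 < α) (hγ : 0 < γ) (hq : q ∈ S) :
    inner ℝ v (p - q) + 1 / (2 * α) * ‖p - c‖ ^ 2 - 1 / (2 * α) * ‖q - c‖ ^ 2
        + 1 / (2 * α) * ‖q - p‖ ^ 2
      ≤ (‖q - y‖ ^ 2 - ‖q - p‖ ^ 2 - ‖p - y‖ ^ 2) / (2 * γ) := by
  have h_factor : (α * γ / (α + γ)) • ((1 / α) • c + (1 / γ) • y - v) - p
      = (α * γ / (α + γ)) • ((1 / α) • (c - p) + (1 / γ) • (y - p) - v) := by
    match_scalars <;> field_simp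
    ring
  have h_proj := h.inner_le_zero hS hq
  rw [h_factor, real_inner_smul_left] at h_proj
  have h_opt := nonpos_of_mul_nonpos_right h_proj (by positivity)
  rw [inner_sub_left, inner_add_left, real_inner_smul_left, real_inner_smul_left,
    inner_sub_sub_eq, inner_sub_sub_eq, ← neg_sub p q, inner_neg_right, norm_neg] at h_opt
  rw [norm_sub_rev q p]
  have h_split : ‖p - c‖ ^ 2 / (2 * α) - ‖q - c‖ ^ 2 / (2 * α) + ‖p - q‖ ^ 2 / (2 * α)
      - (‖q - y‖ ^ 2 - ‖p - q‖ ^ 2 - ‖p - y‖ ^ 2) / (2 * γ)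
      = 1 / α * ((‖p - c‖ ^ 2 + ‖p - q‖ ^ 2 - ‖q - c‖ ^ 2) / 2)
        + 1 / γ * ((‖p - y‖ ^ 2 + ‖p - q‖ ^ 2 - ‖q - y‖ ^ 2) / 2) := by
    field_simp
    ring
  simp only [one_div_mul_eq_div]
  linarith

end Projection

section Box

variable {n : ℕ} {c : ℝ}

theorem toLp_image_Icc_eq_box :
    WithLp.toLp 2 '' Set.Icc (0 : Fin n → ℝ) (fun _ => c) = box n c := by
  ext μ
  refine ⟨?_, fun hμ => ⟨fun i => μ i, ⟨fun i => (hμ i).1, fun i => (hμ i).2⟩, rfl⟩⟩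
  rintro ⟨u, hu, rfl⟩ i
  exact ⟨hu.1 i, hu.2 i⟩

theorem isCompact_box : IsCompact (box n c) :=
  toLp_image_Icc_eq_box ▸ isCompact_Icc.image (PiLp.continuous_toLp 2 _)

theorem convex_box : Convex ℝ (box n c) :=
  toLp_image_Icc_eq_box ▸
    (convex_Icc _ _).linear_image (WithLp.linearEquiv 2 ℝ (Fin n → ℝ)).symm.toLinearMap

theorem zero_mem_box (hc : 0 ≤ c) : (0 : Vec n) ∈ box n c := fun _ => ⟨le_rfl, hc⟩

end Box

section ExtendedReal

variable {n : ℕ} {f : Vec n → EReal} {x y ξ : Vec n}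

theorem IsFinite.coe_toReal {r : EReal} (h : IsFinite r) : ((r.toReal : ℝ) : EReal) = r :=
  EReal.coe_toReal h.2 h.1

theorem IsFinite.neg {r : EReal} (h : IsFinite r) : IsFinite (-r) := by
  simpa [IsFinite, and_comm] using h

theorem IsFinite.toReal_le_iff {r : EReal} (h : IsFinite r) {u : ℝ} :
    r.toReal ≤ u ↔ r ≤ (u : EReal) := by
  rw [← EReal.coe_le_coe_iff, h.coe_toReal]

theorem IsConvexFn.le_combination (hf : IsConvexFn f) {u v a b : ℝ} (hx : f x ≤ (u : EReal))
    (hy : f y ≤ (v : EReal)) (ha : 0 ≤ a) (hb : 0 ≤ b) (hab : a + b = 1) :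
    f (a • x + b • y) ≤ ((a * u + b * v : ℝ) : EReal) :=
  hf (x := (x, u)) hx (y := (y, v)) hy ha hb hab

theorem IsConvexFn.convexOn (hf : IsConvexFn f) {S : Set (Vec n)} (hS : Convex ℝ S)
    (hfin : ∀ x ∈ S, IsFinite (f x)) : ConvexOn ℝ S fun x => (f x).toReal :=
  ⟨hS, fun _ hx _ hy _ _ ha hb hab => (hfin _ (hS hx hy ha hb hab)).toReal_le_iff.2
    (hf.le_combination (hfin _ hx).coe_toReal.ge (hfin _ hy).coe_toReal.ge ha hb hab)⟩

theorem toReal_add_inner_le (hξ : ξ ∈ subdiff f x) (hx : IsFinite (f x)) (hy : IsFinite (f y)) :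
    (f x).toReal + inner ℝ ξ (y - x) ≤ (f y).toReal := by
  rw [← EReal.coe_le_coe_iff, EReal.coe_add, hx.coe_toReal, hy.coe_toReal]
  exact hξ y

theorem norm_le_of_mem_subdiff {r B : ℝ} (hξ : ξ ∈ subdiff f x) (hr : 0 < r)
    (h : ∀ y, dist y x ≤ r → IsFinite (f y) ∧ |(f y).toReal| ≤ B) : ‖ξ‖ ≤ 2 * B / r := by
  obtain ⟨hx_fin, hx_le⟩ := h x (by simpa using hr.le)
  rcases eq_or_ne ξ 0 with rfl | hne
  · rw [norm_zero]
    have := (abs_nonneg _).trans hx_le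
    positivity
  have h_norm : 0 < ‖ξ‖ := norm_pos_iff.2 hne
  have h_dist : dist (x + (r / ‖ξ‖) • ξ) x ≤ r := by
    rw [dist_self_add_left, norm_smul, Real.norm_of_nonneg (by positivity),
      div_mul_cancel₀ _ h_norm.ne']
  obtain ⟨hy_fin, hy_le⟩ := h _ h_dist
  have h_subgrad := toReal_add_inner_le hξ hx_fin hy_fin
  rw [add_sub_cancel_left, inner_smul_right, real_inner_self_eq_norm_sq, sq, ← mul_assoc,
    div_mul_cancel₀ _ h_norm.ne'] at h_subgrad
  rw [le_div_iff₀ hr]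
  linarith [neg_le_of_abs_le hx_le, le_of_abs_le hy_le]

end ExtendedReal

section Gradient

variable {n : ℕ} {f : Vec n → EReal} {x y ξ : Vec n}

theorem IsConvexFn.toReal_add_inner_grad_le (hf : IsConvexFn f)
    (hfin : ∀ᶠ y in 𝓝 x, IsFinite (f y)) (hd : DifferentiableAt ℝ (fun y => (f y).toReal) x)
    {r : ℝ} (hr : f y ≤ (r : EReal)) : (f x).toReal + inner ℝ (grad f x) (y - x) ≤ r := by
  have h_slope := (hd.hasGradientAt.hasFDerivAt.hasLineDerivAt (y - x)).tendsto_slope_zero_right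
  have h_line : Tendsto (fun s : ℝ => x + s • (y - x)) (𝓝[>] 0) (𝓝 x) :=
    (Continuous.tendsto' (by fun_prop) 0 x (by simp)).mono_left nhdsWithin_le_nhds
  have h_le : ∀ᶠ s : ℝ in 𝓝[>] 0,
      s⁻¹ • ((f (x + s • (y - x))).toReal - (f x).toReal) ≤ r - (f x).toReal := by
    filter_upwards [h_line.eventually hfin, Ioo_mem_nhdsGT one_pos] with s hs ⟨hs0, hs1⟩
    have h_seg := hf.le_combination hfin.self_of_nhds.coe_toReal.ge hr (sub_nonneg.2 hs1.le)
      hs0.le (sub_add_cancel 1 s)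
    rw [show (1 - s) • x + s • y = x + s • (y - x) by module, ← hs.toReal_le_iff] at h_seg
    rw [smul_eq_mul, inv_mul_le_iff₀ hs0]
    linarith
  have := le_of_tendsto h_slope h_le
  rw [InnerProductSpace.toDual_apply_apply] at this
  exact le_sub_iff_add_le'.1 this

theorem grad_mem_subdiff (hf : IsConvexFn f) (hfin : ∀ᶠ y in 𝓝 x, IsFinite (f y))
    (hd : DifferentiableAt ℝ (fun y => (f y).toReal) x) : grad f x ∈ subdiff f x := fun y => by
  rw [← hfin.self_of_nhds.coe_toReal, ← EReal.coe_add]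
  exact EReal.le_of_forall_lt_iff_le.1 fun r hr =>
    EReal.coe_le_coe_iff.2 (hf.toReal_add_inner_grad_le hfin hd hr.le)

theorem eq_grad_of_mem_subdiff (hfin : ∀ᶠ y in 𝓝 x, IsFinite (f y))
    (hd : DifferentiableAt ℝ (fun y => (f y).toReal) x) (hξ : ξ ∈ subdiff f x) :
    ξ = grad f x := by
  have h_min : IsLocalMin (fun y => (f y).toReal - inner ℝ ξ y) x := by
    filter_upwards [hfin] with y hy
    have := toReal_add_inner_le hξ hfin.self_of_nhds hy
    rw [inner_sub_right] at this
    linarith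
  have h_deriv := hd.hasGradientAt.hasFDerivAt.sub
    (InnerProductSpace.toDual ℝ (Vec n) ξ).hasFDerivAt
  exact ((InnerProductSpace.toDual ℝ (Vec n)).injective
    (sub_eq_zero.1 (h_min.hasFDerivAt_eq_zero h_deriv))).symm

theorem grad_neg (f : Vec n → EReal) (x : Vec n) : grad (fun y => -f y) x = -grad f x := by
  simp only [grad, gradient, EReal.toReal_neg_eq, fderiv_fun_neg, map_neg]

theorem DiffOnNhd.subdiff_eq {S : Set (Vec n)} (h : DiffOnNhd f S) (hf : IsConvexFn f)
    (hx : x ∈ S) : subdiff f x = {grad f x} := by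
  obtain ⟨U, hU, hSU, hfin, hd⟩ := h
  have hxU := hU.mem_nhds (hSU hx)
  have h_ev : ∀ᶠ y in 𝓝 x, IsFinite (f y) := mem_of_superset hxU hfin
  have h_diff := hd.differentiableAt hxU
  exact Set.eq_singleton_iff_unique_mem.2
    ⟨grad_mem_subdiff hf h_ev h_diff, fun _ => eq_grad_of_mem_subdiff h_ev h_diff⟩

end Gradient

section DiffOnNhd

variable {E F : Type*} [NormedAddCommGroup E] [NormedSpace ℝ E] {S : Set E}

theorem DiffOnNhd.neg {f : E → EReal} (h : DiffOnNhd f S) : DiffOnNhd (fun x => -f x) S := by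
  obtain ⟨U, hU, hSU, hfin, hd⟩ := h
  exact ⟨U, hU, hSU, fun p hp => (hfin p hp).neg,
    by simpa only [EReal.toReal_neg_eq] using hd.fun_neg⟩

theorem DiffOnNhd.exists_bound_near [ProperSpace E] {f : E → EReal} (h : DiffOnNhd f S)
    (hS : IsCompact S) : ∃ r > (0 : ℝ), ∃ B : ℝ, ∀ p ∈ S, ∀ q, dist q p ≤ r →
      IsFinite (f q) ∧ |(f q).toReal| ≤ B := by
  obtain ⟨U, hU, hSU, hfin, hd⟩ := h
  obtain ⟨r, hr, h_sub⟩ := hS.exists_cthickening_subset_open hU hSU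
  obtain ⟨B, hB⟩ := hS.cthickening.exists_bound_of_continuousOn (hd.continuousOn.mono h_sub)
  refine ⟨r, hr, B, fun p hp q hq => ?_⟩
  have hq' : q ∈ Metric.cthickening r S := Metric.mem_cthickening_of_dist_le q p r S hp hq
  exact ⟨hfin q (h_sub hq'), hB q hq'⟩

variable [NormedAddCommGroup F] [NormedSpace ℝ F] {f : E × F → EReal} {T : Set F}

theorem DiffOnNhd.prod_left (h : DiffOnNhd f (S ×ˢ T)) {z : F} (hz : z ∈ T) :
    DiffOnNhd (fun x => f (x, z)) S := by
  obtain ⟨U, hU, hSU, hfin, hd⟩ := h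
  exact ⟨(fun x => (x, z)) ⁻¹' U, hU.preimage (by fun_prop), fun x hx => hSU ⟨hx, hz⟩,
    fun p hp => hfin _ hp, hd.comp (f := fun x => (x, z)) (by fun_prop) fun _ hx => hx⟩

theorem DiffOnNhd.prod_right (h : DiffOnNhd f (S ×ˢ T)) {x : E} (hx : x ∈ S) :
    DiffOnNhd (fun z => f (x, z)) T := by
  obtain ⟨U, hU, hSU, hfin, hd⟩ := h
  exact ⟨(fun z => (x, z)) ⁻¹' U, hU.preimage (by fun_prop), fun z hz => hSU ⟨hx, hz⟩,
    fun p hp => hfin _ hp, hd.comp (f := fun z => (x, z)) (by fun_prop) fun _ hz => hz⟩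

end DiffOnNhd

section SubgradientVariation

theorem exists_nonneg_forall_le {ι : Type*} [Finite ι] (c : ι → ℝ) :
    ∃ B, 0 ≤ B ∧ ∀ i, c i ≤ B := by
  obtain ⟨B, hB⟩ := (Set.finite_range c).bddAbove
  exact ⟨max B 0, le_max_right _ _, fun i => (hB ⟨i, rfl⟩).trans (le_max_left _ _)⟩

theorem DiffOnNhd.exists_norm_subgradient_le {E : Type*} [NormedAddCommGroup E]
    [NormedSpace ℝ E] [ProperSpace E] {f : E → EReal} {S : Set E} (h : DiffOnNhd f S)
    (hS : IsCompact S) : ∃ D > (0 : ℝ), ∀ {n : ℕ} {j : Vec n → E}, Isometry j →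
      ∀ {x ξ : Vec n}, j x ∈ S → ξ ∈ subdiff (fun y => f (j y)) x → ‖ξ‖ ≤ D := by
  obtain ⟨r, hr, B, hB⟩ := h.exists_bound_near hS
  refine ⟨max (2 * B / r) 1, by positivity, fun {_ _} hj {_ _} hx hξ => ?_⟩
  exact (norm_le_of_mem_subdiff hξ hr fun y hy =>
    hB _ hx _ (by rwa [hj.dist_eq])).trans (le_max_left _ _)

variable {M N : ℕ} {J I : Fin M → ℕ} {P : Problem M N J I}

/-- The variation of subgradients over the feasible sets is at most `A` plus `L` times the
distance of the base points. Bounded subgradients give `L = 0`, Lipschitz gradients `A = 0`, so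
both cases can be analysed together. -/
structure Problem.VariationLE (P : Problem M N J I) (A L : ℝ) : Prop where
  A_nonneg : 0 ≤ A
  L_nonneg : 0 ≤ L
  f0 : ∀ x ∈ P.X, ∀ x' ∈ P.X, ∀ ξ ∈ subdiff P.f0 x, ∀ ξ' ∈ subdiff P.f0 x',
    ‖ξ - ξ'‖ ≤ A + L * ‖x - x'‖
  gx : ∀ m, ∀ x ∈ P.X, ∀ x' ∈ P.X, ∀ z ∈ P.Zt m, ∀ ξ ∈ subdiff (fun y => P.g m y z) x,
    ∀ ξ' ∈ subdiff (fun y => P.g m y z) x', ‖ξ - ξ'‖ ≤ A + L * ‖x - x'‖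
  gz : ∀ m, ∀ x ∈ P.X, ∀ x' ∈ P.X, ∀ z ∈ P.Zt m, ∀ z' ∈ P.Zt m,
    ∀ ζ ∈ subdiff (fun w => -P.g m x w) z, ∀ ζ' ∈ subdiff (fun w => -P.g m x' w) z',
      ‖ζ - ζ'‖ ≤ A + L * (‖x - x'‖ + ‖z - z'‖)
  h : ∀ m i, ∀ z ∈ P.Zt m, ∀ z' ∈ P.Zt m, ∀ η ∈ subdiff (P.h m i) z,
    ∀ η' ∈ subdiff (P.h m i) z', ‖η - η'‖ ≤ A + L * ‖z - z'‖

theorem Problem.BoundedSubgradients.exists_variationLE (h : P.BoundedSubgradients) :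
    ∃ A, P.VariationLE A 0 := by
  obtain ⟨D, hD, hf⟩ := h.f0_bounded
  choose Dx _ hgx using h.gx_bounded
  choose Dz _ hgz using h.gz_bounded
  choose Dh _ hh using h.h_bounded
  obtain ⟨Bx, hBx, hDx⟩ := exists_nonneg_forall_le Dx
  obtain ⟨Bz, hBz, hDz⟩ := exists_nonneg_forall_le Dz
  obtain ⟨Bh, hBh, hDh⟩ := exists_nonneg_forall_le Dh
  have norm_sub_le_of_bound {n : ℕ} {u v : Vec n} {B d : ℝ} (hu : ‖u‖ ≤ B) (hv : ‖v‖ ≤ B)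
      (hB : B ≤ D + Bx + Bz + Bh) : ‖u - v‖ ≤ 2 * (D + Bx + Bz + Bh) + 0 * d := by
    linarith [norm_sub_le_of_le hu hv]
  refine ⟨2 * (D + Bx + Bz + Bh), by positivity, le_rfl, fun x hx x' hx' ξ hξ ξ' hξ' => ?_,
    fun m x hx x' hx' z hz ξ hξ ξ' hξ' => ?_, fun m x hx x' hx' z hz z' hz' ζ hζ ζ' hζ' => ?_,
    fun m i z hz z' hz' η hη η' hη' => ?_⟩
  · exact norm_sub_le_of_bound (hf x hx ξ hξ) (hf x' hx' ξ' hξ') (by linarith)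
  · exact norm_sub_le_of_bound (hgx m x hx z hz ξ hξ) (hgx m x' hx' z hz ξ' hξ')
      (by linarith [hDx m])
  · exact norm_sub_le_of_bound (hgz m x hx z hz ζ hζ) (hgz m x' hx' z' hz' ζ' hζ')
      (by linarith [hDz m])
  · exact norm_sub_le_of_bound (hh m i z hz η hη) (hh m i z' hz' η' hη') (by linarith [hDh m])

namespace Problem.LipschitzGradients

theorem subdiff_f0 (h : P.LipschitzGradients) (hP : P.Regular) {x : Vec N} (hx : x ∈ P.X) :
    subdiff P.f0 x = {grad P.f0 x} :=
  h.f0_diff.subdiff_eq hP.f0_convex hx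

theorem subdiff_gx (h : P.LipschitzGradients) (hP : P.Regular) {m : Fin M} {x : Vec N}
    {z : Vec (J m)} (hx : x ∈ P.X) (hz : z ∈ P.Zt m) :
    subdiff (fun y => P.g m y z) x = {grad (fun y => P.g m y z) x} :=
  ((h.g_diff m).prod_left hz).subdiff_eq (hP.g_convex m z hz) hx

theorem subdiff_gz (h : P.LipschitzGradients) (hP : P.Regular) {m : Fin M} {x : Vec N}
    {z : Vec (J m)} (hx : x ∈ P.X) (hz : z ∈ P.Zt m) :
    subdiff (fun w => -P.g m x w) z = {-grad (P.g m x) z} := by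
  rw [((h.g_diff m).prod_right hx).neg.subdiff_eq (hP.g_concave m x hx) hz, ← grad_neg]

theorem subdiff_h (h : P.LipschitzGradients) (hP : P.Regular) {m : Fin M} {z : Vec (J m)}
    (hz : z ∈ P.Zt m) (i : Fin (I m)) : subdiff (P.h m i) z = {grad (P.h m i) z} :=
  (h.h_diff m i).subdiff_eq (hP.h_convex m i) hz

theorem boundedSubgradients (h : P.LipschitzGradients) (hP : P.Regular) :
    P.BoundedSubgradients where
  f0_nonempty x hx := h.subdiff_f0 hP hx ▸ Set.singleton_nonempty _
  gx_nonempty m x hx z hz := h.subdiff_gx hP hx hz ▸ Set.singleton_nonempty _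
  gz_nonempty m x hx z hz := h.subdiff_gz hP hx hz ▸ Set.singleton_nonempty _
  h_nonempty m i z hz := h.subdiff_h hP hz i ▸ Set.singleton_nonempty _
  f0_bounded := by
    obtain ⟨D, hD, h_le⟩ := h.f0_diff.exists_norm_subgradient_le hP.X_compact
    exact ⟨D, hD, fun x hx ξ hξ => h_le isometry_id hx hξ⟩
  gx_bounded m := by
    obtain ⟨D, hD, h_le⟩ :=
      (h.g_diff m).exists_norm_subgradient_le (hP.X_compact.prod (hP.Zt_compact m))
    exact ⟨D, hD, fun x hx z hz ξ hξ => h_le (j := fun y => (y, z))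
      (Isometry.of_dist_eq fun y y' => by simp [Prod.dist_eq]) ⟨hx, hz⟩ hξ⟩
  gz_bounded m := by
    obtain ⟨D, hD, h_le⟩ :=
      (h.g_diff m).neg.exists_norm_subgradient_le (hP.X_compact.prod (hP.Zt_compact m))
    exact ⟨D, hD, fun x hx z hz ζ hζ => h_le (j := fun w => (x, w))
      (Isometry.of_dist_eq fun w w' => by simp [Prod.dist_eq]) ⟨hx, hz⟩ hζ⟩
  h_bounded m := by
    choose D _ h_le using fun i => (h.h_diff m i).exists_norm_subgradient_le (hP.Zt_compact m)
    obtain ⟨B, hB, hDB⟩ := exists_nonneg_forall_le D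
    exact ⟨B + 1, by positivity, fun i z hz η hη =>
      (h_le i isometry_id hz hη).trans (by linarith [hDB i])⟩

theorem exists_variationLE (h : P.LipschitzGradients) (hP : P.Regular) :
    ∃ L, P.VariationLE 0 L := by
  obtain ⟨L₀, hL₀, hf⟩ := h.f0_lip
  choose Lx _ hgx using h.gx_lip
  choose Lz _ Lz' _ hgz using h.gz_lip
  choose Lh _ hh using h.h_lip
  obtain ⟨Bx, hBx, hLx⟩ := exists_nonneg_forall_le Lx
  obtain ⟨Bz, hBz, hLz⟩ := exists_nonneg_forall_le Lz
  obtain ⟨Bz', hBz', hLz'⟩ := exists_nonneg_forall_le Lz'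
  obtain ⟨Bh, hBh, hLh⟩ := exists_nonneg_forall_le Lh
  have le_of_bound {b B d : ℝ} (h_le : b ≤ B * d) (hd : 0 ≤ d)
      (hB : B ≤ L₀ + Bx + Bz + Bz' + Bh) : b ≤ 0 + (L₀ + Bx + Bz + Bz' + Bh) * d := by
    rw [zero_add]
    exact h_le.trans (by gcongr)
  refine ⟨L₀ + Bx + Bz + Bz' + Bh, le_rfl, by positivity, fun x hx x' hx' => ?_,
    fun m x hx x' hx' z hz => ?_, fun m x hx x' hx' z hz z' hz' => ?_,
    fun m i z hz z' hz' => ?_⟩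
  · simp only [h.subdiff_f0 hP hx, h.subdiff_f0 hP hx', Set.mem_singleton_iff, forall_eq]
    exact le_of_bound (hf x hx x' hx') (norm_nonneg _) (by linarith)
  · simp only [h.subdiff_gx hP hx hz, h.subdiff_gx hP hx' hz, Set.mem_singleton_iff, forall_eq]
    exact le_of_bound (hgx m x hx x' hx' z hz) (norm_nonneg _) (by linarith [hLx m])
  · simp only [h.subdiff_gz hP hx hz, h.subdiff_gz hP hx' hz', Set.mem_singleton_iff, forall_eq]
    rw [neg_sub_neg, norm_sub_rev]
    refine le_of_bound (B := Bz + Bz') ((hgz m x hx x' hx' z hz z' hz').trans ?_)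
      (by positivity) (by linarith)
    rw [mul_add]
    gcongr
    · linarith [hLz m]
    · linarith [hLz' m]
  · simp only [h.subdiff_h hP hz, h.subdiff_h hP hz', Set.mem_singleton_iff, forall_eq]
    exact le_of_bound (hh m i z hz z' hz') (norm_nonneg _) (by linarith [hLh m])

end Problem.LipschitzGradients

theorem sub_le_of_mem_subdiff {n : ℕ} {f : Vec n → EReal} {u u' x ξ ξ' : Vec n} {e : ℝ}
    (hu : IsFinite (f u)) (hu' : IsFinite (f u')) (hx : IsFinite (f x)) (hξ : ξ ∈ subdiff f u)
    (hξ' : ξ' ∈ subdiff f u') (he : ‖ξ' - ξ‖ ≤ e) :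
    (f u').toReal - (f x).toReal ≤ inner ℝ ξ (u' - x) + e * ‖u' - u‖ := by
  have h_x := toReal_add_inner_le hξ hu hx
  have h_u := toReal_add_inner_le hξ' hu' hu
  have h_var : inner ℝ (ξ' - ξ) (u' - u) ≤ e * ‖u' - u‖ :=
    (real_inner_le_norm _ _).trans (mul_le_mul_of_nonneg_right he (norm_nonneg _))
  simp only [inner_sub_left, inner_sub_right] at h_x h_u h_var ⊢
  linarith

end SubgradientVariation

section PenalizedConstraint

variable {M N : ℕ} {J I : Fin M → ℕ} {P : Problem M N J I}

/-- Subgradients at `z` of `-gₘ(x, ·) + ∑ᵢ μᵢ hₘᵢ` that are sums of subgradients, as the inner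
algorithm computes them. -/
def Problem.penSubdiff (P : Problem M N J I) (m : Fin M) (x : Vec N) (μ : Vec (I m))
    (z : Vec (J m)) : Set (Vec (J m)) :=
  {σ | ∃ ζ ∈ subdiff (fun w => -P.g m x w) z, ∃ η : Fin (I m) → Vec (J m),
    (∀ i, η i ∈ subdiff (P.h m i) z) ∧ σ = ζ + ∑ i, μ i • η i}

theorem Problem.BoundedSubgradients.penSubdiff_nonempty (hS : P.BoundedSubgradients) {m : Fin M}
    {x : Vec N} (hx : x ∈ P.X) (μ : Vec (I m)) {z : Vec (J m)} (hz : z ∈ P.Zt m) :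
    (P.penSubdiff m x μ z).Nonempty := by
  obtain ⟨ζ, hζ⟩ := hS.gz_nonempty m x hx z hz
  choose η hη using fun i => hS.h_nonempty m i z hz
  exact ⟨_, ζ, hζ, η, hη, rfl⟩

theorem Problem.Regular.gpen_le (hP : P.Regular) {m : Fin M} {x : Vec N} (hx : x ∈ P.X)
    {μ : Vec (I m)} (hμ : ∀ i, 0 ≤ μ i) {z z' : Vec (J m)} (hz : z ∈ P.Zt m)
    (hz' : z' ∈ P.Zt m) {σ : Vec (J m)} (hσ : σ ∈ P.penSubdiff m x μ z) :
    P.gpen m x μ z' ≤ P.gpen m x μ z + inner ℝ σ (z - z') := by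
  obtain ⟨ζ, hζ, η, hη, rfl⟩ := hσ
  have h_g := toReal_add_inner_le hζ (hP.g_finite m x hx z hz).neg (hP.g_finite m x hx z' hz').neg
  have h_h : ∑ i, μ i * (P.h m i z).toReal + ∑ i, μ i * inner ℝ (η i) (z' - z)
      ≤ ∑ i, μ i * (P.h m i z').toReal := by
    simp only [← Finset.sum_add_distrib, ← mul_add]
    exact Finset.sum_le_sum fun i _ => mul_le_mul_of_nonneg_left
      (toReal_add_inner_le (hη i) (hP.h_finite m i z hz) (hP.h_finite m i z' hz')) (hμ i)
  rw [← neg_sub z' z, inner_neg_right, inner_add_left, sum_inner]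
  simp only [real_inner_smul_left, EReal.toReal_neg_eq, Problem.gpen] at h_g ⊢
  linarith

/-- The analogue of `Problem.VariationLE` for the subgradients of the penalized constraint
functions, uniformly over the multipliers in the boxes `[0, aₘ]^{Iₘ}`. -/
structure Problem.PenVariationLE (P : Problem M N J I) (a : Fin M → ℝ) (A L : ℝ) : Prop where
  A_nonneg : 0 ≤ A
  L_nonneg : 0 ≤ L
  norm_sub_le : ∀ m, ∀ x ∈ P.X, ∀ x' ∈ P.X, ∀ μ ∈ box (I m) (a m), ∀ μ' : Vec (I m),
    ∀ z ∈ P.Zt m, ∀ z' ∈ P.Zt m, ∀ σ ∈ P.penSubdiff m x μ z, ∀ σ' ∈ P.penSubdiff m x' μ' z',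
      ‖σ - σ'‖ ≤ A + L * (‖x - x'‖ + ‖μ - μ'‖ + ‖z - z'‖)

theorem Problem.VariationLE.norm_sum_smul_sub_le {A L F c : ℝ} (hV : P.VariationLE A L)
    {m : Fin M} {z z' : Vec (J m)} (hz : z ∈ P.Zt m) (hz' : z' ∈ P.Zt m)
    (hF : ∀ i, ∀ η ∈ subdiff (P.h m i) z', ‖η‖ ≤ F) {μ μ' : Vec (I m)} (hμ : μ ∈ box (I m) c)
    {η η' : Fin (I m) → Vec (J m)} (hη : ∀ i, η i ∈ subdiff (P.h m i) z)
    (hη' : ∀ i, η' i ∈ subdiff (P.h m i) z') :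
    ‖∑ i, μ i • η i - ∑ i, μ' i • η' i‖
      ≤ I m * (c * (A + L * ‖z - z'‖) + ‖μ - μ'‖ * F) := by
  have h_term (i : Fin (I m)) :
      ‖μ i • η i - μ' i • η' i‖ ≤ c * (A + L * ‖z - z'‖) + ‖μ - μ'‖ * F := by
    rw [show μ i • η i - μ' i • η' i = μ i • (η i - η' i) + (μ i - μ' i) • η' i by module]
    refine norm_add_le_of_le ?_ ?_
    · rw [norm_smul, Real.norm_of_nonneg (hμ i).1]
      exact mul_le_mul (hμ i).2 (hV.h m i z hz z' hz' _ (hη i) _ (hη' i))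
        (norm_nonneg _) ((hμ i).1.trans (hμ i).2)
    · rw [norm_smul]
      exact mul_le_mul (PiLp.norm_apply_le (μ - μ') i) (hF i _ (hη' i)) (norm_nonneg _)
        (norm_nonneg _)
  rw [← Finset.sum_sub_distrib]
  refine (norm_sum_le_of_le _ fun i _ => h_term i).trans_eq ?_
  rw [Finset.sum_const, Finset.card_univ, Fintype.card_fin, nsmul_eq_mul]

theorem Problem.VariationLE.exists_penVariationLE {A L : ℝ} (hV : P.VariationLE A L)
    (hS : P.BoundedSubgradients) (a : Fin M → ℝ) :
    ∃ A₁ L₁, P.PenVariationLE a A₁ L₁ ∧ (A = 0 → A₁ = 0) := by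
  choose F _ hF_le using hS.h_bounded
  obtain ⟨B, hB, hB_le⟩ := exists_nonneg_forall_le fun m => I m * a m
  obtain ⟨B', hB', hB'_le⟩ := exists_nonneg_forall_le fun m => I m * F m
  have hA := hV.A_nonneg
  have hL := hV.L_nonneg
  refine ⟨(1 + B) * A, (1 + B) * L + B', ⟨by positivity, by positivity, ?_⟩,
    fun h => by rw [h, mul_zero]⟩
  rintro m x hx x' hx' μ hμ μ' z hz z' hz' _ ⟨ζ, hζ, η, hη, rfl⟩ _ ⟨ζ', hζ', η', hη', rfl⟩
  have h_g := hV.gz m x hx x' hx' z hz z' hz' ζ hζ ζ' hζ'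
  have h_h := hV.norm_sum_smul_sub_le (μ' := μ') hz hz' (fun i => hF_le m i z' hz') hμ hη hη'
  have h_box : I m * a m * (A + L * ‖z - z'‖) ≤ B * (A + L * ‖z - z'‖) := by
    gcongr
    exact hB_le m
  have h_bound : I m * F m * ‖μ - μ'‖ ≤ B' * ‖μ - μ'‖ := by
    gcongr
    exact hB'_le m
  have h_rest : 0 ≤ B * L * (‖x - x'‖ + ‖μ - μ'‖) + L * ‖μ - μ'‖
      + B' * (‖x - x'‖ + ‖z - z'‖) := by positivity
  calc ‖ζ + ∑ i, μ i • η i - (ζ' + ∑ i, μ' i • η' i)‖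
      = ‖(ζ - ζ') + (∑ i, μ i • η i - ∑ i, μ' i • η' i)‖ := by rw [add_sub_add_comm]
    _ ≤ (A + L * (‖x - x'‖ + ‖z - z'‖))
        + I m * (a m * (A + L * ‖z - z'‖) + ‖μ - μ'‖ * F m) := norm_add_le_of_le h_g h_h
    _ ≤ (1 + B) * A + ((1 + B) * L + B') * (‖x - x'‖ + ‖μ - μ'‖ + ‖z - z'‖) := by linarith

end PenalizedConstraint

section InnerAlgorithm

theorem mul_le_sq_div_add_sq {γ : ℝ} (hγ : 0 < γ) (b q : ℝ) :
    b * q ≤ q ^ 2 / (8 * γ) + 2 * γ * b ^ 2 := by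
  rw [div_add' _ _ _ (by positivity), le_div_iff₀ (by positivity)]
  linarith [sq_nonneg (q - 4 * γ * b)]

theorem mul_sq_le_sq_div {γ c : ℝ} (hγ : 0 < γ) (hc : γ * c ≤ 1 / 8) (q : ℝ) :
    c * q ^ 2 ≤ q ^ 2 / (8 * γ) := by
  rw [le_div_iff₀ (by positivity)]
  linarith [mul_le_mul_of_nonneg_right hc (sq_nonneg q)]

theorem IsProj.extrapolated_step_le {n : ℕ} {S : Set (Vec n)} {σ₀ σ₁ y p q : Vec n} {δ l : ℝ}
    (h : IsProj S (y - δ • (l • ((2 : ℝ) • σ₁ - σ₀))) p) (hS : Convex ℝ S) (hδ : 0 < δ)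
    (hq : q ∈ S) (σ₂ : Vec n) :
    l * inner ℝ σ₂ (p - q) ≤ (‖q - y‖ ^ 2 - ‖q - p‖ ^ 2 - ‖p - y‖ ^ 2) / (2 * δ)
      + l * inner ℝ (σ₂ - σ₁) (p - q) - l * inner ℝ (σ₁ - σ₀) (y - q)
      - l * inner ℝ (σ₁ - σ₀) (p - y) := by
  have h_step := h.step_le hS hδ hq
  have h_split : inner ℝ (l • ((2 : ℝ) • σ₁ - σ₀)) (p - q)
      = l * inner ℝ σ₂ (p - q) - l * inner ℝ (σ₂ - σ₁) (p - q) + l * inner ℝ (σ₁ - σ₀) (y - q)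
        + l * inner ℝ (σ₁ - σ₀) (p - y) := by
    simp only [real_inner_smul_left, inner_sub_left, inner_sub_right]
    ring
  linarith

variable {M N : ℕ} {J I : Fin M → ℕ} {P : Problem M N J I}

/-- Step sizes of the inner algorithm so small, compared with multipliers up to `Λ` and the
Lipschitz parts `L`, `L₁` of the variation of the subgradients, that the terms of second order
are absorbed by the proximal terms. -/
structure Params.SmallSteps (p : Params) (M : ℕ) (Λ L L₁ : ℝ) : Prop where
  γ_eq_δ : p.γ = p.δ
  dual_le : p.γ * (Λ * L₁) ≤ 1 / 8
  primal_le : p.γ * (M * (Λ * L₁) + (1 + M * Λ) * L) ≤ 1 / 8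

namespace InnerTrace

/-- `σ` collects the subgradients of the penalized constraint functions along a run, so that a
`z`-step is a projected step along `2 σₜ - σₜ₋₁`. The run itself computes no subgradients for the
last iterate `t = T`; there any one may be chosen. -/
structure IsSubgradientSeq (Q : InnerTrace M N J I) (P : Problem M N J I) (p : Params)
    (lam : Fin M → ℝ) (σ : ℕ → (m : Fin M) → Vec (J m)) : Prop where
  mem : ∀ t ≤ p.T, ∀ m, σ t m ∈ P.penSubdiff m (Q.x t) (Q.μ t m) (Q.z t m)
  z_step : ∀ t < p.T, ∀ m, IsProj (P.Zt m)
    (Q.z t m - p.δ • (lam m • ((2 : ℝ) • σ t m - σ (t - 1) m))) (Q.z (t + 1) m)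

/-- Length of the step into iterate `t`, seen by the `m`-th constraint. -/
noncomputable def stepLen (Q : InnerTrace M N J I) (t : ℕ) (m : Fin M) : ℝ :=
  ‖Q.x t - Q.x (t - 1)‖ + ‖Q.μ t m - Q.μ (t - 1) m‖ + ‖Q.z t m - Q.z (t - 1) m‖

/-- Squared Euclidean length of the step into iterate `t`, seen by the `m`-th constraint. -/
noncomputable def stepSq (Q : InnerTrace M N J I) (t : ℕ) (m : Fin M) : ℝ :=
  ‖Q.x t - Q.x (t - 1)‖ ^ 2 + ‖Q.μ t m - Q.μ (t - 1) m‖ ^ 2 + ‖Q.z t m - Q.z (t - 1) m‖ ^ 2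

theorem stepLen_mul_le (Q : InnerTrace M N J I) (t : ℕ) (m : Fin M) (b : ℝ) :
    Q.stepLen t m * b ≤ Q.stepSq t m + b ^ 2 := by
  unfold stepLen stepSq
  nlinarith [sq_nonneg (‖Q.x t - Q.x (t - 1)‖ - b / 2),
    sq_nonneg (‖Q.μ t m - Q.μ (t - 1) m‖ - b / 2), sq_nonneg (‖Q.z t m - Q.z (t - 1) m‖ - b / 2)]

/-- The share of the `m`-th constraint in the Lyapunov function of the inner algorithm, relative
to the comparison point `(μ, z)`: the distance to it, corrected by the extrapolation error that
the next `z`-step will compensate and by a multiple `c` of the last squared step. -/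
noncomputable def constraintPotential (Q : InnerTrace M N J I) (γ c l : ℝ)
    (σ : ℕ → (m : Fin M) → Vec (J m)) (m : Fin M) (μ : Vec (I m)) (z : Vec (J m)) (t : ℕ) : ℝ :=
  (‖μ - Q.μ t m‖ ^ 2 + ‖z - Q.z t m‖ ^ 2) / (2 * γ)
    - l * inner ℝ (σ t m - σ (t - 1) m) (Q.z t m - z) + c * Q.stepSq t m

/-- The Lyapunov function of the inner algorithm, relative to the comparison point
`(x, μ, z)`. -/
noncomputable def potential (Q : InnerTrace M N J I) (γ c : ℝ) (lam : Fin M → ℝ)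
    (σ : ℕ → (m : Fin M) → Vec (J m)) (x : Vec N) (μ : (m : Fin M) → Vec (I m))
    (z : (m : Fin M) → Vec (J m)) (t : ℕ) : ℝ :=
  ‖x - Q.x t‖ ^ 2 / (2 * γ) + ∑ m, Q.constraintPotential γ c (lam m) σ m (μ m) (z m) t

end InnerTrace

/-- The gap of `(x', μ', z')` in the strong saddle-point inequality for the comparison point
`(x, μ, z)`; a strong `ν`-approximate saddle point is one whose gaps are all at most `ν`. -/
noncomputable def Problem.saddleGap (P : Problem M N J I) (α : ℝ) (xc : Vec N)
    (μc : (m : Fin M) → Vec (I m)) (lam : Fin M → ℝ) (x : Vec N) (μ : (m : Fin M) → Vec (I m))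
    (z : (m : Fin M) → Vec (J m)) (x' : Vec N) (μ' : (m : Fin M) → Vec (I m))
    (z' : (m : Fin M) → Vec (J m)) : ℝ :=
  P.innerObj α xc μc lam x' μ' z - P.innerObj α xc μc lam x μ z'
    + 1 / (2 * α) * (‖x' - x‖ ^ 2 + ∑ m, ‖μ' m - μ m‖ ^ 2)

namespace InnerTrace

variable {Q : InnerTrace M N J I} {a : Fin M → ℝ} {p : Params} {xc : Vec N}
  {μc : (m : Fin M) → Vec (I m)} {lam : Fin M → ℝ} {σ : ℕ → (m : Fin M) → Vec (J m)}
  {A L A₁ L₁ Λ : ℝ}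

theorem IsRun.x_mem (h : Q.IsRun P a p xc μc lam) {t : ℕ} (ht : t ≤ p.T) : Q.x t ∈ P.X := by
  cases t with
  | zero => exact h.x_init
  | succ t => exact (h.x_step t ht).1

theorem IsRun.μ_mem (h : Q.IsRun P a p xc μc lam) {t : ℕ} (ht : t ≤ p.T) (m : Fin M) :
    Q.μ t m ∈ box (I m) (a m) := by
  cases t with
  | zero => exact h.μ_init m
  | succ t => exact (h.μ_step t ht m).1

theorem IsRun.z_mem (h : Q.IsRun P a p xc μc lam) {t : ℕ} (ht : t ≤ p.T) (m : Fin M) :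
    Q.z t m ∈ P.Zt m := by
  cases t with
  | zero => exact h.z_init m
  | succ t => exact (h.z_step t ht m).1

theorem IsRun.exists_isSubgradientSeq (h : Q.IsRun P a p xc μc lam)
    (hS : P.BoundedSubgradients) : ∃ σ, Q.IsSubgradientSeq P p lam σ := by
  have exists_subgradient (t : ℕ) (m : Fin M) : ∃ σ : Vec (J m),
      (t ≤ p.T → σ ∈ P.penSubdiff m (Q.x t) (Q.μ t m) (Q.z t m)) ∧
      (t < p.T → σ = Q.ζ t m + ∑ i, Q.μ t m i • Q.η t m i) := by
    rcases lt_trichotomy t p.T with ht | ht | ht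
    · exact ⟨_, fun _ => ⟨_, h.ζ_mem t ht m, Q.η t m, h.η_mem t ht m, rfl⟩, fun _ => rfl⟩
    · obtain ⟨σ, hσ⟩ := hS.penSubdiff_nonempty (h.x_mem ht.le) (Q.μ t m) (h.z_mem ht.le m)
      exact ⟨σ, fun _ => hσ, fun h => absurd h ht.not_lt⟩
    · exact ⟨0, fun h => absurd h ht.not_ge, fun h => absurd h ht.not_gt⟩
  choose σ h_mem h_eq using exists_subgradient
  refine ⟨σ, fun t ht m => h_mem t m ht, fun t ht m => ?_⟩
  rw [smul_smul, h_eq t m ht, h_eq (t - 1) m (by omega)]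
  convert h.z_step t ht m using 3
  rw [Finset.sum_sub_distrib, smul_add, Finset.smul_sum]
  simp only [smul_smul]
  abel

theorem IsRun.norm_subgradient_sub_le (h : Q.IsRun P a p xc μc lam)
    (hW : P.PenVariationLE a A₁ L₁) (hσ : Q.IsSubgradientSeq P p lam σ) {t : ℕ} (ht : t ≤ p.T)
    (m : Fin M) : ‖σ t m - σ (t - 1) m‖ ≤ A₁ + L₁ * Q.stepLen t m := by
  have ht' : t - 1 ≤ p.T := (Nat.sub_le t 1).trans ht
  exact hW.norm_sub_le m _ (h.x_mem ht) _ (h.x_mem ht') _ (h.μ_mem ht m) _ _ (h.z_mem ht m) _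
    (h.z_mem ht' m) _ (hσ.mem t ht m) _ (hσ.mem _ ht' m)

theorem IsRun.mul_abs_inner_le (h : Q.IsRun P a p xc μc lam) (hW : P.PenVariationLE a A₁ L₁)
    (hlam : ∀ m, lam m ∈ Set.Icc 0 Λ) (hσ : Q.IsSubgradientSeq P p lam σ) {t : ℕ} (ht : t ≤ p.T)
    (m : Fin M) {v : Vec (J m)} {b : ℝ} (hv : ‖v‖ ≤ b) :
    lam m * |inner ℝ (σ t m - σ (t - 1) m) v|
      ≤ Λ * A₁ * b + Λ * L₁ * (Q.stepSq t m + b ^ 2) := by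
  have hΛ : 0 ≤ Λ := (hlam m).1.trans (hlam m).2
  have h_diff := h.norm_subgradient_sub_le hW hσ ht m
  calc lam m * |inner ℝ (σ t m - σ (t - 1) m) v|
      ≤ Λ * ((A₁ + L₁ * Q.stepLen t m) * b) :=
        mul_le_mul (hlam m).2 ((abs_real_inner_le_norm _ _).trans
          (mul_le_mul h_diff hv (norm_nonneg v) ((norm_nonneg _).trans h_diff)))
          (abs_nonneg _) hΛ
    _ = Λ * A₁ * b + Λ * L₁ * (Q.stepLen t m * b) := by ring
    _ ≤ Λ * A₁ * b + Λ * L₁ * (Q.stepSq t m + b ^ 2) := by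
        have := mul_nonneg hΛ hW.L_nonneg
        gcongr
        exact Q.stepLen_mul_le t m b

theorem IsRun.x_step_le (h : Q.IsRun P a p xc μc lam) (hP : P.Regular)
    (hS : P.BoundedSubgradients) (hV : P.VariationLE A L) (hlam : ∀ m, lam m ∈ Set.Icc 0 Λ)
    {t : ℕ} (ht : t < p.T) {x : Vec N} (hx : x ∈ P.X) :
    (P.f0 (Q.x (t + 1))).toReal - (P.f0 x).toReal
      + ∑ m, lam m * (P.gpen m (Q.x (t + 1)) (Q.μ (t + 1) m) (Q.z (t + 1) m)
        - P.gpen m x (Q.μ (t + 1) m) (Q.z (t + 1) m))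
      + 1 / (2 * p.α) * (‖Q.x (t + 1) - xc‖ ^ 2 - ‖x - xc‖ ^ 2 + ‖x - Q.x (t + 1)‖ ^ 2)
    ≤ (‖x - Q.x t‖ ^ 2 - ‖x - Q.x (t + 1)‖ ^ 2 - ‖Q.x (t + 1) - Q.x t‖ ^ 2) / (2 * p.γ)
      + (1 + M * Λ) * ((A + L * ‖Q.x (t + 1) - Q.x t‖) * ‖Q.x (t + 1) - Q.x t‖) := by
  have hxt := h.x_mem ht.le
  have hxt' := h.x_mem (t := t + 1) ht
  have hz := fun m => h.z_mem (t := t + 1) ht m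
  set e := (A + L * ‖Q.x (t + 1) - Q.x t‖) * ‖Q.x (t + 1) - Q.x t‖
  have he : 0 ≤ e := mul_nonneg
    (add_nonneg hV.A_nonneg (mul_nonneg hV.L_nonneg (norm_nonneg _))) (norm_nonneg _)
  have h_f0 : (P.f0 (Q.x (t + 1))).toReal - (P.f0 x).toReal
      ≤ inner ℝ (Q.ξ0 t) (Q.x (t + 1) - x) + e := by
    obtain ⟨ξ', hξ'⟩ := hS.f0_nonempty _ hxt'
    exact sub_le_of_mem_subdiff (hP.f0_finite _ hxt) (hP.f0_finite _ hxt') (hP.f0_finite _ hx)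
      (h.ξ0_mem t ht) hξ' (hV.f0 _ hxt' _ hxt _ hξ' _ (h.ξ0_mem t ht))
  have h_gpen (m : Fin M) : lam m * (P.gpen m (Q.x (t + 1)) (Q.μ (t + 1) m) (Q.z (t + 1) m)
        - P.gpen m x (Q.μ (t + 1) m) (Q.z (t + 1) m))
      ≤ lam m * inner ℝ (Q.ξ t m) (Q.x (t + 1) - x) + Λ * e := by
    obtain ⟨ξ', hξ'⟩ := hS.gx_nonempty m _ hxt' _ (hz m)
    have h_g := sub_le_of_mem_subdiff (f := fun y => P.g m y (Q.z (t + 1) m))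
      (hP.g_finite m _ hxt _ (hz m)) (hP.g_finite m _ hxt' _ (hz m)) (hP.g_finite m _ hx _ (hz m))
      (h.ξ_mem t ht m) hξ' (hV.gx m _ hxt' _ hxt _ (hz m) _ hξ' _ (h.ξ_mem t ht m))
    rw [Problem.gpen, Problem.gpen, sub_sub_sub_cancel_right]
    linarith [mul_le_mul_of_nonneg_left h_g (hlam m).1, mul_le_mul_of_nonneg_right (hlam m).2 he]
  have h_sum := Finset.sum_le_sum fun m (_ : m ∈ Finset.univ) => h_gpen m
  have h_prox := (h.x_step t ht).prox_step_le hP.X_convex p.α_pos p.γ_pos hx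
  simp only [inner_add_left, sum_inner, real_inner_smul_left] at h_prox
  simp only [Finset.sum_add_distrib, Finset.sum_const, Finset.card_univ, Fintype.card_fin,
    nsmul_eq_mul] at h_sum
  linarith

theorem IsRun.μ_step_le (h : Q.IsRun P a p xc μc lam) {t : ℕ} (ht : t < p.T) (m : Fin M)
    (x : Vec N) {μ : Vec (I m)} (hμ : μ ∈ box (I m) (a m)) :
    lam m * (P.gpen m x (Q.μ (t + 1) m) (Q.z (t + 1) m) - P.gpen m x μ (Q.z (t + 1) m))
      + 1 / (2 * p.α) * (‖Q.μ (t + 1) m - μc m‖ ^ 2 - ‖μ - μc m‖ ^ 2 + ‖μ - Q.μ (t + 1) m‖ ^ 2)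
    ≤ (‖μ - Q.μ t m‖ ^ 2 - ‖μ - Q.μ (t + 1) m‖ ^ 2 - ‖Q.μ (t + 1) m - Q.μ t m‖ ^ 2)
        / (2 * p.γ) := by
  have h_prox := IsProj.prox_step_le (v := -(lam m • P.hvec m (Q.z (t + 1) m)))
    (by rw [sub_neg_eq_add]; exact h.μ_step t ht m) convex_box p.α_pos p.γ_pos hμ
  have h_inner : inner ℝ (-(lam m • P.hvec m (Q.z (t + 1) m))) (Q.μ (t + 1) m - μ)
      = lam m * (P.gpen m x (Q.μ (t + 1) m) (Q.z (t + 1) m)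
        - P.gpen m x μ (Q.z (t + 1) m)) := by
    rw [inner_neg_left, real_inner_smul_left, inner_sub_right]
    simp only [Problem.gpen, Problem.hvec, PiLp.inner_apply, conj_trivial, RCLike.inner_apply]
    ring
  rw [h_inner] at h_prox
  linarith

theorem IsRun.z_step_le (h : Q.IsRun P a p xc μc lam) (hP : P.Regular)
    (hW : P.PenVariationLE a A₁ L₁) (hlam : ∀ m, lam m ∈ Set.Icc 0 Λ)
    (hσ : Q.IsSubgradientSeq P p lam σ) {t : ℕ} (ht : t < p.T) {m : Fin M} {z : Vec (J m)}
    (hz : z ∈ P.Zt m) :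
    lam m * (P.gpen m (Q.x (t + 1)) (Q.μ (t + 1) m) z
        - P.gpen m (Q.x (t + 1)) (Q.μ (t + 1) m) (Q.z (t + 1) m))
    ≤ (‖z - Q.z t m‖ ^ 2 - ‖z - Q.z (t + 1) m‖ ^ 2 - ‖Q.z (t + 1) m - Q.z t m‖ ^ 2) / (2 * p.δ)
      + lam m * inner ℝ (σ (t + 1) m - σ t m) (Q.z (t + 1) m - z)
      - lam m * inner ℝ (σ t m - σ (t - 1) m) (Q.z t m - z)
      + (Λ * A₁ * ‖Q.z (t + 1) m - Q.z t m‖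
        + Λ * L₁ * (Q.stepSq t m + ‖Q.z (t + 1) m - Q.z t m‖ ^ 2)) := by
  have h_concave := hP.gpen_le (h.x_mem (t := t + 1) ht)
    (fun i => (h.μ_mem (t := t + 1) ht m i).1) (h.z_mem (t := t + 1) ht m) hz
    (hσ.mem (t + 1) ht m)
  have h_step := (hσ.z_step t ht m).extrapolated_step_le (hP.Zt_convex m) p.δ_pos hz (σ (t + 1) m)
  have h_error := h.mul_abs_inner_le hW hlam hσ ht.le m
    (le_refl ‖Q.z (t + 1) m - Q.z t m‖)
  have h_abs := mul_le_mul_of_nonneg_left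
    (neg_le_abs (inner ℝ (σ t m - σ (t - 1) m) (Q.z (t + 1) m - Q.z t m))) (hlam m).1
  linarith [mul_le_mul_of_nonneg_left (sub_le_iff_le_add'.2 h_concave) (hlam m).1]

theorem IsRun.constraintPotential_step_le (h : Q.IsRun P a p xc μc lam) (hP : P.Regular)
    (hW : P.PenVariationLE a A₁ L₁) (hlam : ∀ m, lam m ∈ Set.Icc 0 Λ)
    (hp : p.SmallSteps M Λ L L₁) (hσ : Q.IsSubgradientSeq P p lam σ) {t : ℕ} (ht : t < p.T)
    {m : Fin M} (x : Vec N) {μ : Vec (I m)} (hμ : μ ∈ box (I m) (a m)) {z : Vec (J m)}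
    (hz : z ∈ P.Zt m) :
    lam m * (P.gpen m x (Q.μ (t + 1) m) (Q.z (t + 1) m) - P.gpen m x μ (Q.z (t + 1) m))
      + lam m * (P.gpen m (Q.x (t + 1)) (Q.μ (t + 1) m) z
        - P.gpen m (Q.x (t + 1)) (Q.μ (t + 1) m) (Q.z (t + 1) m))
      + 1 / (2 * p.α) * (‖Q.μ (t + 1) m - μc m‖ ^ 2 - ‖μ - μc m‖ ^ 2 + ‖μ - Q.μ (t + 1) m‖ ^ 2)
    ≤ Q.constraintPotential p.γ (Λ * L₁) (lam m) σ m μ z t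
      - Q.constraintPotential p.γ (Λ * L₁) (lam m) σ m μ z (t + 1)
      + (2 * p.γ * (Λ * A₁) ^ 2 + Λ * L₁ * ‖Q.x (t + 1) - Q.x t‖ ^ 2) := by
  have h_μ := h.μ_step_le ht m x hμ
  have h_z := h.z_step_le hP hW hlam hσ ht hz
  have h_young := mul_le_sq_div_add_sq p.γ_pos (Λ * A₁) ‖Q.z (t + 1) m - Q.z t m‖
  have h_absorb_z := mul_sq_le_sq_div p.γ_pos hp.dual_le ‖Q.z (t + 1) m - Q.z t m‖
  have h_absorb_μ := mul_sq_le_sq_div p.γ_pos hp.dual_le ‖Q.μ (t + 1) m - Q.μ t m‖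
  have h_eighth (u : ℝ) : u / (2 * p.γ) = 4 * (u / (8 * p.γ)) := by ring
  have h_nonneg (u : ℝ) : 0 ≤ u ^ 2 / (8 * p.γ) := by have := p.γ_pos; positivity
  rw [← hp.γ_eq_δ] at h_z
  simp only [constraintPotential, stepSq, Nat.add_sub_cancel, add_div, sub_div, h_eighth]
    at h_μ h_z ⊢
  linarith [h_nonneg ‖Q.z (t + 1) m - Q.z t m‖, h_nonneg ‖Q.μ (t + 1) m - Q.μ t m‖]

end InnerTrace
end InnerAlgorithm

section Average

theorem sum_Icc_one_eq_sum_range {E : Type*} [AddCommMonoid E] (f : ℕ → E) (T : ℕ) :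
    ∑ t ∈ Finset.Icc 1 T, f t = ∑ t ∈ Finset.range T, f (t + 1) := by
  rw [Finset.range_eq_Ico, Finset.sum_Ico_add' f 0 T 1]
  rfl

variable {E : Type*} [AddCommGroup E] [Module ℝ E] {S : Set E} {T : ℕ} {u : ℕ → E}

theorem sum_Icc_one_div_eq_one (hT : 1 ≤ T) : ∑ _t ∈ Finset.Icc 1 T, 1 / (T : ℝ) = 1 := by
  simp [(Nat.cast_pos (α := ℝ).2 hT).ne']

theorem average_mem_of_convex (hS : Convex ℝ S) (hT : 1 ≤ T)
    (hu : ∀ t ∈ Finset.Icc 1 T, u t ∈ S) : (1 / (T : ℝ)) • ∑ t ∈ Finset.Icc 1 T, u t ∈ S := by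
  rw [Finset.smul_sum]
  exact hS.sum_mem (fun _ _ => by positivity) (sum_Icc_one_div_eq_one hT) hu

theorem map_average_le_of_convexOn {f : E → ℝ} (hf : ConvexOn ℝ S f) (hT : 1 ≤ T)
    (hu : ∀ t ∈ Finset.Icc 1 T, u t ∈ S) :
    f ((1 / (T : ℝ)) • ∑ t ∈ Finset.Icc 1 T, u t)
      ≤ 1 / (T : ℝ) * ∑ t ∈ Finset.Icc 1 T, f (u t) := by
  rw [Finset.smul_sum, Finset.mul_sum]
  exact hf.map_sum_le (fun _ _ => by positivity) (sum_Icc_one_div_eq_one hT) hu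

theorem convexOn_finset_sum {ι : Type*} (s : Finset ι) {f : ι → E → ℝ} (hS : Convex ℝ S)
    (hf : ∀ i ∈ s, ConvexOn ℝ S (f i)) : ConvexOn ℝ S fun x => ∑ i ∈ s, f i x := by
  rw [← Finset.sum_fn]
  exact Finset.sum_induction f (ConvexOn ℝ S) (fun _ _ h h' => h.add h') (convexOn_const 0 hS) hf

theorem convexOn_norm_sub_sq {V : Type*} [NormedAddCommGroup V] [NormedSpace ℝ V] (c : V) :
    ConvexOn ℝ Set.univ fun x : V => ‖x - c‖ ^ 2 := by
  have h := (convexOn_dist c (convex_univ (𝕜 := ℝ) (E := V))).pow (fun _ _ => dist_nonneg) 2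
  simpa only [dist_eq_norm] using! h

end Average

section SaddleGap

variable {M N : ℕ} {J I : Fin M → ℕ} {P : Problem M N J I}

theorem Problem.Regular.convexOn_gpen (hP : P.Regular) {m : Fin M} {z : Vec (J m)}
    (hz : z ∈ P.Zt m) :
    ConvexOn ℝ (P.X ×ˢ (Set.univ : Set (Vec (I m)))) fun w => P.gpen m w.1 w.2 z := by
  have h_g := (hP.g_convex m z hz).convexOn hP.X_convex fun x hx => hP.g_finite m x hx z hz
  refine ⟨hP.X_convex.prod convex_univ, fun w hw w' hw' s t hs ht hst => ?_⟩
  have h_combination := h_g.2 hw.1 hw'.1 hs ht hst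
  simp only [smul_eq_mul] at h_combination
  simp only [Problem.gpen, Prod.fst_add, Prod.smul_fst, Prod.snd_add, Prod.smul_snd,
    PiLp.add_apply, PiLp.smul_apply, smul_eq_mul, add_mul, Finset.sum_add_distrib, mul_sub,
    Finset.mul_sum, mul_assoc]
  linarith

theorem Problem.Regular.concaveOn_gpen (hP : P.Regular) {m : Fin M} {x : Vec N} (hx : x ∈ P.X)
    {μ : Vec (I m)} (hμ : ∀ i, 0 ≤ μ i) : ConcaveOn ℝ (P.Zt m) (P.gpen m x μ) := by
  have h_g := (hP.g_concave m x hx).convexOn (hP.Zt_convex m)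
    fun z hz => (hP.g_finite m x hx z hz).neg
  have h_h : ConvexOn ℝ (P.Zt m) fun z => ∑ i, μ i * (P.h m i z).toReal :=
    convexOn_finset_sum _ (hP.Zt_convex m) fun i _ =>
      ((hP.h_convex m i).convexOn (hP.Zt_convex m) fun z hz => hP.h_finite m i z hz).smul (hμ i)
  simp only [EReal.toReal_neg_eq] at h_g
  rw [← neg_convexOn_iff]
  refine (h_g.add h_h).congr fun z _ => ?_
  simp only [Problem.gpen, Pi.neg_apply, Pi.add_apply]
  ring

theorem Problem.Regular.convexOn_innerObj (hP : P.Regular) {α : ℝ} (hα : 0 < α) (xc : Vec N)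
    (μc : (m : Fin M) → Vec (I m)) {lam : Fin M → ℝ} (hlam : ∀ m, 0 ≤ lam m)
    {z : (m : Fin M) → Vec (J m)} (hz : ∀ m, z m ∈ P.Zt m) :
    ConvexOn ℝ (P.X ×ˢ (Set.univ : Set ((m : Fin M) → Vec (I m))))
      fun w => P.innerObj α xc μc lam w.1 w.2 z := by
  set S := P.X ×ˢ (Set.univ : Set ((m : Fin M) → Vec (I m)))
  have hS : Convex ℝ S := hP.X_convex.prod convex_univ
  let projX := LinearMap.fst ℝ (Vec N) ((m : Fin M) → Vec (I m))
  let projμ (m : Fin M) := (LinearMap.proj (R := ℝ) (φ := fun m => Vec (I m)) m).comp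
    (LinearMap.snd ℝ (Vec N) ((m : Fin M) → Vec (I m)))
  have h_f0 : ConvexOn ℝ S fun w => (P.f0 w.1).toReal :=
    ((hP.f0_convex.convexOn hP.X_convex hP.f0_finite).comp_linearMap projX).subset
      (fun _ hw => hw.1) hS
  have h_gpen : ConvexOn ℝ S fun w => ∑ m, lam m * P.gpen m w.1 (w.2 m) (z m) :=
    convexOn_finset_sum _ hS fun m _ =>
      (((hP.convexOn_gpen (hz m)).comp_linearMap (projX.prod (projμ m))).subset
        (fun _ hw => ⟨hw.1, trivial⟩) hS).smul (hlam m)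
  have h_x : ConvexOn ℝ S fun w => ‖w.1 - xc‖ ^ 2 :=
    ((convexOn_norm_sub_sq xc).comp_linearMap projX).subset (fun _ _ => trivial) hS
  have h_μ : ConvexOn ℝ S fun w => ∑ m, ‖w.2 m - μc m‖ ^ 2 :=
    convexOn_finset_sum _ hS fun m _ =>
      ((convexOn_norm_sub_sq (μc m)).comp_linearMap (projμ m)).subset (fun _ _ => trivial) hS
  have hα' : 0 ≤ 1 / (2 * α) := by positivity
  exact ((h_f0.add h_gpen).add (h_x.smul hα')).add (h_μ.smul hα')

theorem Problem.Regular.concaveOn_innerObj (hP : P.Regular) (α : ℝ) (xc : Vec N)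
    (μc : (m : Fin M) → Vec (I m)) {lam : Fin M → ℝ} (hlam : ∀ m, 0 ≤ lam m) {x : Vec N}
    (hx : x ∈ P.X) {μ : (m : Fin M) → Vec (I m)} (hμ : ∀ m i, 0 ≤ μ m i) :
    ConcaveOn ℝ (Set.univ.pi P.Zt) (P.innerObj α xc μc lam x μ) := by
  have hS : Convex ℝ (Set.univ.pi P.Zt) := convex_pi fun m _ => hP.Zt_convex m
  have h_gpen : ConvexOn ℝ (Set.univ.pi P.Zt)
      fun z => ∑ m, lam m * -P.gpen m x (μ m) (z m) :=
    convexOn_finset_sum _ hS fun m _ =>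
      (((hP.concaveOn_gpen hx (hμ m)).neg.comp_linearMap
        (LinearMap.proj (R := ℝ) (φ := fun m => Vec (J m)) m)).subset
          (fun _ (hz : _ ∈ Set.univ.pi P.Zt) => hz m trivial) hS).smul (hlam m)
  rw [← neg_convexOn_iff]
  refine (h_gpen.add_const (-((P.f0 x).toReal + 1 / (2 * α) * ‖x - xc‖ ^ 2
    + 1 / (2 * α) * ∑ m, ‖μ m - μc m‖ ^ 2))).congr fun z _ => ?_
  simp only [Problem.innerObj, Pi.neg_apply, mul_neg, Finset.sum_neg_distrib, Pi.add_apply]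
  ring

theorem Problem.Regular.convexOn_saddleGap (hP : P.Regular) {α : ℝ} (hα : 0 < α) (xc : Vec N)
    (μc : (m : Fin M) → Vec (I m)) {lam : Fin M → ℝ} (hlam : ∀ m, 0 ≤ lam m) {x : Vec N}
    (hx : x ∈ P.X) {μ : (m : Fin M) → Vec (I m)} (hμ : ∀ m i, 0 ≤ μ m i)
    {z : (m : Fin M) → Vec (J m)} (hz : ∀ m, z m ∈ P.Zt m) :
    ConvexOn ℝ ((P.X ×ˢ (Set.univ : Set ((m : Fin M) → Vec (I m)))) ×ˢ Set.univ.pi P.Zt)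
      fun w => P.saddleGap α xc μc lam x μ z w.1.1 w.1.2 w.2 := by
  set Z := (m : Fin M) → Vec (J m)
  set W := Vec N × ((m : Fin M) → Vec (I m))
  set SW : Set W := P.X ×ˢ (Set.univ : Set ((m : Fin M) → Vec (I m)))
  have h_W := hP.convexOn_innerObj hα xc μc hlam hz
  have h_Z := (hP.concaveOn_innerObj α xc μc hlam hx hμ).neg
  have hS : Convex ℝ (SW ×ˢ Set.univ.pi P.Zt) := h_W.1.prod h_Z.1
  have h_x : ConvexOn ℝ SW fun w => ‖w.1 - x‖ ^ 2 :=
    ((convexOn_norm_sub_sq x).comp_linearMap (LinearMap.fst ℝ (Vec N) _)).subset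
      (fun _ _ => trivial) h_W.1
  have h_μ : ConvexOn ℝ SW fun w => ∑ m, ‖w.2 m - μ m‖ ^ 2 :=
    convexOn_finset_sum _ h_W.1 fun m _ => ((convexOn_norm_sub_sq (μ m)).comp_linearMap
      ((LinearMap.proj (R := ℝ) (φ := fun m => Vec (I m)) m).comp
        (LinearMap.snd ℝ (Vec N) _))).subset (fun _ _ => trivial) h_W.1
  have h_prox := (h_x.add h_μ).smul (show 0 ≤ 1 / (2 * α) by positivity)
  have h_fst := ((h_W.add h_prox).comp_linearMap (LinearMap.fst ℝ W Z)).subset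
    (fun _ hw => hw.1) hS
  have h_snd := (h_Z.comp_linearMap (LinearMap.snd ℝ W Z)).subset (fun _ hw => hw.2) hS
  refine (h_fst.add h_snd).congr fun w _ => ?_
  simp only [Problem.saddleGap, Pi.add_apply, Function.comp_apply, Pi.neg_apply,
    LinearMap.fst_apply, LinearMap.snd_apply, smul_eq_mul]
  ring

variable {Q : InnerTrace M N J I} {a : Fin M → ℝ} {p : Params} {xc : Vec N}
  {μc : (m : Fin M) → Vec (I m)} {lam : Fin M → ℝ}

namespace InnerTrace

theorem IsRun.xout_mem (h : Q.IsRun P a p xc μc lam) (hP : P.Regular) : Q.xout p.T ∈ P.X :=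
  average_mem_of_convex hP.X_convex p.one_le_T fun _ ht => h.x_mem (Finset.mem_Icc.1 ht).2

theorem IsRun.μout_mem (h : Q.IsRun P a p xc μc lam) (m : Fin M) :
    Q.μout p.T m ∈ box (I m) (a m) :=
  average_mem_of_convex convex_box p.one_le_T fun _ ht => h.μ_mem (Finset.mem_Icc.1 ht).2 m

theorem IsRun.zout_mem (h : Q.IsRun P a p xc μc lam) (hP : P.Regular) (m : Fin M) :
    Q.zout p.T m ∈ P.Zt m :=
  average_mem_of_convex (hP.Zt_convex m) p.one_le_T fun _ ht => h.z_mem (Finset.mem_Icc.1 ht).2 m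

theorem IsRun.isStrongSaddle_of_sum_saddleGap_le (h : Q.IsRun P a p xc μc lam) (hP : P.Regular)
    (hlam : ∀ m, 0 ≤ lam m) {ν : ℝ}
    (hν : ∀ x ∈ P.X, ∀ μ : (m : Fin M) → Vec (I m), (∀ m, μ m ∈ box (I m) (a m)) →
      ∀ z : (m : Fin M) → Vec (J m), (∀ m, z m ∈ P.Zt m) →
      ∑ t ∈ Finset.range p.T, P.saddleGap p.α xc μc lam x μ z (Q.x (t + 1)) (Q.μ (t + 1))
        (Q.z (t + 1)) ≤ p.T * ν) :
    P.IsStrongSaddle a p.α ν xc μc lam (Q.xout p.T) (Q.μout p.T) (Q.zout p.T) := by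
  refine ⟨h.xout_mem hP, h.μout_mem, h.zout_mem hP, fun x hx μ hμ z hz => ?_⟩
  have hT : (0 : ℝ) < p.T := Nat.cast_pos.2 p.one_le_T
  have h_jensen := map_average_le_of_convexOn
    (hP.convexOn_saddleGap p.α_pos xc μc hlam hx (fun m i => (hμ m i).1) hz) p.one_le_T
    (u := fun t => ((Q.x t, Q.μ t), Q.z t)) fun t ht =>
      have ht := (Finset.mem_Icc.1 ht).2
      ⟨⟨h.x_mem ht, trivial⟩, fun m _ => h.z_mem ht m⟩
  have h_average : (1 / (p.T : ℝ)) • ∑ t ∈ Finset.Icc 1 p.T, ((Q.x t, Q.μ t), Q.z t)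
      = ((Q.xout p.T, Q.μout p.T), Q.zout p.T) := by
    ext m <;> simp [xout, μout, zout, Prod.fst_sum, Prod.snd_sum, Finset.sum_apply]
  rw [h_average, sum_Icc_one_eq_sum_range] at h_jensen
  have h_gap : P.saddleGap p.α xc μc lam x μ z (Q.xout p.T) (Q.μout p.T) (Q.zout p.T) ≤ ν :=
    h_jensen.trans (by rw [one_div_mul_eq_div, div_le_iff₀' hT]; exact hν x hx μ hμ z hz)
  rw [Problem.saddleGap, norm_sub_rev] at h_gap
  simp only [norm_sub_rev (Q.μout p.T _)] at h_gap
  rw [div_div, mul_comm p.α]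
  linarith

end InnerTrace
end SaddleGap

section InnerConvergence

theorem exists_nonneg_norm_sub_le {V : Type*} [NormedAddCommGroup V] {S : Set V}
    (hS : IsCompact S) : ∃ R, 0 ≤ R ∧ ∀ x ∈ S, ∀ x' ∈ S, ‖x - x'‖ ≤ R :=
  ⟨Metric.diam S, Metric.diam_nonneg, fun x hx x' hx' => by
    rw [← dist_eq_norm]
    exact Metric.dist_le_diam_of_mem hS.isBounded hx hx'⟩

variable {M N : ℕ} {J I : Fin M → ℕ} {P : Problem M N J I} {Q : InnerTrace M N J I}
  {a : Fin M → ℝ} {p : Params} {xc : Vec N} {μc : (m : Fin M) → Vec (I m)} {lam : Fin M → ℝ}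
  {σ : ℕ → (m : Fin M) → Vec (J m)} {A L A₁ L₁ Λ R : ℝ}

/-- The domain, the uncertainty sets and the multiplier boxes have diameter at most `R`. -/
structure Problem.DiameterLE (P : Problem M N J I) (a : Fin M → ℝ) (R : ℝ) : Prop where
  nonneg : 0 ≤ R
  x_le : ∀ x ∈ P.X, ∀ x' ∈ P.X, ‖x - x'‖ ≤ R
  μ_le : ∀ m, ∀ μ ∈ box (I m) (a m), ∀ μ' ∈ box (I m) (a m), ‖μ - μ'‖ ≤ R
  z_le : ∀ m, ∀ z ∈ P.Zt m, ∀ z' ∈ P.Zt m, ‖z - z'‖ ≤ R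

theorem Problem.Regular.exists_diameterLE (hP : P.Regular) (a : Fin M → ℝ) :
    ∃ R, P.DiameterLE a R := by
  obtain ⟨Rx, hRx, h_x⟩ := exists_nonneg_norm_sub_le hP.X_compact
  choose rμ _ h_μ using fun m => exists_nonneg_norm_sub_le (isCompact_box (n := I m) (c := a m))
  choose rz _ h_z using fun m => exists_nonneg_norm_sub_le (hP.Zt_compact m)
  obtain ⟨Rμ, hRμ, h_rμ⟩ := exists_nonneg_forall_le rμ
  obtain ⟨Rz, hRz, h_rz⟩ := exists_nonneg_forall_le rz
  refine ⟨Rx + Rμ + Rz, by positivity, fun x hx x' hx' => ?_, fun m μ hμ μ' hμ' => ?_,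
    fun m z hz z' hz' => ?_⟩
  · linarith [h_x x hx x' hx']
  · linarith [h_μ m μ hμ μ' hμ', h_rμ m]
  · linarith [h_z m z hz z' hz', h_rz m]

namespace InnerTrace

theorem IsRun.saddleGap_le (h : Q.IsRun P a p xc μc lam) (hP : P.Regular)
    (hS : P.BoundedSubgradients) (hV : P.VariationLE A L) (hW : P.PenVariationLE a A₁ L₁)
    (hlam : ∀ m, lam m ∈ Set.Icc 0 Λ) (hp : p.SmallSteps M Λ L L₁)
    (hσ : Q.IsSubgradientSeq P p lam σ) {t : ℕ} (ht : t < p.T) {x : Vec N} (hx : x ∈ P.X)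
    {μ : (m : Fin M) → Vec (I m)} (hμ : ∀ m, μ m ∈ box (I m) (a m))
    {z : (m : Fin M) → Vec (J m)} (hz : ∀ m, z m ∈ P.Zt m) :
    P.saddleGap p.α xc μc lam x μ z (Q.x (t + 1)) (Q.μ (t + 1)) (Q.z (t + 1))
    ≤ Q.potential p.γ (Λ * L₁) lam σ x μ z t - Q.potential p.γ (Λ * L₁) lam σ x μ z (t + 1)
      + p.γ * (2 * M * (Λ * A₁) ^ 2 + 2 * ((1 + M * Λ) * A) ^ 2) := by
  have h_x := h.x_step_le hP hS hV hlam ht hx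
  have h_constraints := Finset.sum_le_sum fun m (_ : m ∈ Finset.univ) =>
    h.constraintPotential_step_le hP hW hlam hp hσ ht x (hμ m) (hz m)
  have h_young := mul_le_sq_div_add_sq p.γ_pos ((1 + M * Λ) * A) ‖Q.x (t + 1) - Q.x t‖
  have h_absorb := mul_sq_le_sq_div p.γ_pos hp.primal_le ‖Q.x (t + 1) - Q.x t‖
  have h_eighth (u : ℝ) : u / (2 * p.γ) = 4 * (u / (8 * p.γ)) := by ring
  have h_nonneg : 0 ≤ ‖Q.x (t + 1) - Q.x t‖ ^ 2 / (8 * p.γ) := by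
    have := p.γ_pos
    positivity
  simp only [Finset.sum_sub_distrib, Finset.sum_add_distrib, Finset.sum_const, Finset.card_univ,
    Fintype.card_fin, nsmul_eq_mul, mul_sub, ← Finset.mul_sum, mul_add] at h_constraints
  simp only [Finset.sum_sub_distrib, mul_sub, sub_div, h_eighth] at h_x
  simp only [Problem.saddleGap, Problem.innerObj, potential, h_eighth, norm_sub_rev _ x,
    norm_sub_rev _ (μ _)]
  linarith

theorem IsRun.potential_zero_le (h : Q.IsRun P a p xc μc lam) (hR : P.DiameterLE a R) (c : ℝ)
    {x : Vec N} (hx : x ∈ P.X) {μ : (m : Fin M) → Vec (I m)} (hμ : ∀ m, μ m ∈ box (I m) (a m))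
    {z : (m : Fin M) → Vec (J m)} (hz : ∀ m, z m ∈ P.Zt m) :
    Q.potential p.γ c lam σ x μ z 0 ≤ (1 + 2 * M) * R ^ 2 / (2 * p.γ) := by
  have hγ := p.γ_pos
  have h_x : ‖x - Q.x 0‖ ^ 2 / (2 * p.γ) ≤ R ^ 2 / (2 * p.γ) := by
    gcongr
    exact hR.x_le _ hx _ h.x_init
  have h_constraint (m : Fin M) :
      Q.constraintPotential p.γ c (lam m) σ m (μ m) (z m) 0 ≤ 2 * R ^ 2 / (2 * p.γ) := by
    have h_μ := hR.μ_le m _ (hμ m) _ (h.μ_init m)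
    have h_z := hR.z_le m _ (hz m) _ (h.z_init m)
    simp only [constraintPotential, stepSq, Nat.zero_sub, sub_self, inner_zero_left, norm_zero,
      ne_eq, OfNat.ofNat_ne_zero, not_false_eq_true, zero_pow, add_zero, mul_zero, sub_zero]
    rw [two_mul (R ^ 2)]
    gcongr
  have h_sum := Finset.sum_le_card_nsmul Finset.univ _ _ fun m _ => h_constraint m
  rw [Finset.card_univ, Fintype.card_fin, nsmul_eq_mul] at h_sum
  have h_split : (1 + 2 * M) * R ^ 2 / (2 * p.γ)
      = R ^ 2 / (2 * p.γ) + M * (2 * R ^ 2 / (2 * p.γ)) := by ring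
  rw [potential, h_split]
  exact add_le_add h_x h_sum

theorem IsRun.neg_potential_le (h : Q.IsRun P a p xc μc lam) (hW : P.PenVariationLE a A₁ L₁)
    (hR : P.DiameterLE a R) (hlam : ∀ m, lam m ∈ Set.Icc 0 Λ)
    (hσ : Q.IsSubgradientSeq P p lam σ) (x : Vec N) (μ : (m : Fin M) → Vec (I m))
    {z : (m : Fin M) → Vec (J m)} (hz : ∀ m, z m ∈ P.Zt m) :
    -(M * (Λ * A₁ * R + Λ * L₁ * R ^ 2))
      ≤ Q.potential p.γ (Λ * L₁) lam σ x μ z p.T := by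
  have hγ := p.γ_pos
  have h_constraint (m : Fin M) : -(Λ * A₁ * R + Λ * L₁ * R ^ 2)
      ≤ Q.constraintPotential p.γ (Λ * L₁) (lam m) σ m (μ m) (z m) p.T := by
    have h_inner := h.mul_abs_inner_le hW hlam hσ le_rfl m
      (hR.z_le m _ (h.z_mem le_rfl m) _ (hz m))
    have h_abs := mul_le_mul_of_nonneg_left
      (le_abs_self (inner ℝ (σ p.T m - σ (p.T - 1) m) (Q.z p.T m - z m))) (hlam m).1
    have h_sq : 0 ≤ (‖μ m - Q.μ p.T m‖ ^ 2 + ‖z m - Q.z p.T m‖ ^ 2) / (2 * p.γ) := by positivity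
    rw [constraintPotential]
    linarith
  have h_sum := Finset.card_nsmul_le_sum Finset.univ _ _ fun m _ => h_constraint m
  have h_sq : 0 ≤ ‖x - Q.x p.T‖ ^ 2 / (2 * p.γ) := by positivity
  rw [Finset.card_univ, Fintype.card_fin, nsmul_eq_mul] at h_sum
  rw [potential]
  linarith

theorem IsRun.isStrongSaddle {ν : ℝ} (h : Q.IsRun P a p xc μc lam) (hP : P.Regular)
    (hS : P.BoundedSubgradients) (hV : P.VariationLE A L) (hW : P.PenVariationLE a A₁ L₁)
    (hR : P.DiameterLE a R) (hlam : ∀ m, lam m ∈ Set.Icc 0 Λ) (hp : p.SmallSteps M Λ L L₁)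
    (hν : (1 + 2 * M) * R ^ 2 / (2 * p.γ) + M * (Λ * A₁ * R + Λ * L₁ * R ^ 2)
      + p.T * (p.γ * (2 * M * (Λ * A₁) ^ 2 + 2 * ((1 + M * Λ) * A) ^ 2)) ≤ p.T * ν) :
    P.IsStrongSaddle a p.α ν xc μc lam (Q.xout p.T) (Q.μout p.T) (Q.zout p.T) := by
  refine h.isStrongSaddle_of_sum_saddleGap_le hP (fun m => (hlam m).1) fun x hx μ hμ z hz => ?_
  obtain ⟨σ, hσ⟩ := h.exists_isSubgradientSeq hS
  have h_sum := Finset.sum_le_sum fun t (ht : t ∈ Finset.range p.T) =>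
    h.saddleGap_le hP hS hV hW hlam hp hσ (Finset.mem_range.1 ht) hx hμ hz
  rw [Finset.sum_add_distrib, Finset.sum_range_sub', Finset.sum_const, Finset.card_range,
    nsmul_eq_mul] at h_sum
  linarith [h.potential_zero_le (lam := lam) (σ := σ) hR (Λ * L₁) hx hμ hz,
    h.neg_potential_le hW hR hlam hσ x μ hz]

end InnerTrace

theorem exists_pos_mul_le {b u : ℝ} (hb : 0 ≤ b) (hu : 0 < u) : ∃ c > 0, c * b ≤ u := by
  refine ⟨u / (1 + b), by positivity, ?_⟩
  rw [div_mul_eq_mul_div, div_le_iff₀ (by positivity)]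
  linarith

/-- The total inner error after `c n s` steps of length `c₀ / s`: the initial potential grows
like `s`, the final one is bounded, and each step costs `c₀ B / s`. -/
theorem inner_error_le {E D B c₀ c n s : ℝ} (hc₀ : 0 < c₀) (hn : 0 < n) (hs : 1 ≤ s)
    (hD : 0 ≤ D) (hc : 2 * (E / (2 * c₀) + D) ≤ c) (hc_nonneg : 0 ≤ c)
    (hB : n * (c₀ * B) ≤ s / 2) :
    E / (2 * (c₀ / s)) + D + (c + 1) * (n * s) * (c₀ / s * B) ≤ (c + 1) * (n * s) * (1 / n) := by
  calc E / (2 * (c₀ / s)) + D + (c + 1) * (n * s) * (c₀ / s * B)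
      = E / (2 * c₀) * s + D + (c + 1) * (n * (c₀ * B)) := by field_simp
    _ ≤ E / (2 * c₀) * s + D * s + (c + 1) * (s / 2) := by
      gcongr
      exact le_mul_of_one_le_right hD hs
    _ ≤ (c + 1) * s := by nlinarith
    _ = (c + 1) * (n * s) * (1 / n) := by field_simp

/-- If the subgradients may jump, i.e. `A ≠ 0`, the steps have to shrink with the accuracy `1 / n`:
hence `n ≤ s`. -/
theorem Problem.VariationLE.exists_inner_rate (hV : P.VariationLE A L) (hP : P.Regular)
    (hS : P.BoundedSubgradients) (a : Fin M → ℝ) {Λ : ℝ} (hΛ : 0 ≤ Λ) :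
    ∃ c : ℕ, 1 ≤ c ∧ ∃ c₀ : ℝ, 0 < c₀ ∧ ∀ n s : ℕ, 1 ≤ n → 1 ≤ s → (n ≤ s ∨ A = 0) →
      ∀ p : Params, p.T = c * (n * s) → p.γ = c₀ / s → p.δ = c₀ / s →
      ∀ (Q : InnerTrace M N J I) (xc : Vec N) (μc : (m : Fin M) → Vec (I m)) (lam : Fin M → ℝ),
      (∀ m, lam m ∈ Set.Icc 0 Λ) → Q.IsRun P a p xc μc lam →
      P.IsStrongSaddle a p.α (1 / n) xc μc lam (Q.xout p.T) (Q.μout p.T) (Q.zout p.T) := by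
  obtain ⟨R, hR⟩ := hP.exists_diameterLE a
  obtain ⟨A₁, L₁, hW, hA⟩ := hV.exists_penVariationLE hS a
  have hA₁ := hW.A_nonneg
  have hL₁ := hW.L_nonneg
  have hL := hV.L_nonneg
  have hR_nonneg := hR.nonneg
  set B := 2 * M * (Λ * A₁) ^ 2 + 2 * ((1 + M * Λ) * A) ^ 2 with hB_def
  have hB : 0 ≤ B := by positivity
  have h_dual : 0 ≤ Λ * L₁ := by positivity
  have h_primal : 0 ≤ M * (Λ * L₁) + (1 + M * Λ) * L := by positivity
  obtain ⟨c₀, hc₀, hc₀_le⟩ := exists_pos_mul_le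
    (b := Λ * L₁ + (M * (Λ * L₁) + (1 + M * Λ) * L) + B) (u := 1 / 8) (by positivity) (by norm_num)
  have h_small {b : ℝ} (hb : b ≤ Λ * L₁ + (M * (Λ * L₁) + (1 + M * Λ) * L) + B) :
      c₀ * b ≤ 1 / 8 :=
    (mul_le_mul_of_nonneg_left hb hc₀.le).trans hc₀_le
  obtain ⟨c, hc⟩ := exists_nat_ge
    (2 * ((1 + 2 * M) * R ^ 2 / (2 * c₀) + M * (Λ * A₁ * R + Λ * L₁ * R ^ 2)))
  refine ⟨c + 1, by omega, c₀, hc₀, fun n s hn hs hns p hT hγ hδ Q xc μc lam hlam hrun => ?_⟩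
  have hs' : (1 : ℝ) ≤ s := by exact_mod_cast hs
  have hγ_le : p.γ ≤ c₀ := hγ ▸ div_le_self hc₀.le hs'
  refine hrun.isStrongSaddle hP hS hV hW hR hlam ⟨hγ.trans hδ.symm, ?_, ?_⟩ ?_
  · exact (mul_le_mul_of_nonneg_right hγ_le h_dual).trans (h_small (by linarith))
  · exact (mul_le_mul_of_nonneg_right hγ_le h_primal).trans (h_small (by linarith))
  have h_cost : n * (c₀ * B) ≤ s / 2 := by
    rcases hns with hns | rfl
    · have hns' : (n : ℝ) ≤ s := by exact_mod_cast hns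
      nlinarith [mul_nonneg hc₀.le hB, h_small (b := B) (by linarith)]
    · rw [hB_def, hA rfl]
      ring_nf
      positivity
  rw [← hB_def, hT, hγ]
  push_cast
  exact inner_error_le hc₀ (Nat.cast_pos.2 hn) hs' (by positivity) hc c.cast_nonneg h_cost

end InnerConvergence

section PenalizedWorstCase

variable {M N : ℕ} {J I : Fin M → ℕ} {P : Problem M N J I}

/-- The penalized worst case `sup {g̃ₘ(x, μₘ, z) | z ∈ Z̃ₘ}` of the `m`-th constraint. It is a
supremum in `ℝ`, meaningful where the penalized constraint function is bounded above on `Z̃ₘ`. -/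
noncomputable def Problem.penSup (P : Problem M N J I) (m : Fin M) (x : Vec N) (μ : Vec (I m)) :
    ℝ := ⨆ z : P.Zt m, P.gpen m x μ z

theorem abs_toReal_sub_le {n : ℕ} {f : Vec n → EReal} {S : Set (Vec n)} {D : ℝ}
    (hfin : ∀ x ∈ S, IsFinite (f x)) (hne : ∀ x ∈ S, (subdiff f x).Nonempty)
    (hD : ∀ x ∈ S, ∀ ξ ∈ subdiff f x, ‖ξ‖ ≤ D) {x x' : Vec n} (hx : x ∈ S) (hx' : x' ∈ S) :
    |(f x).toReal - (f x').toReal| ≤ D * ‖x - x'‖ := by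
  have h_le {y y' : Vec n} (hy : y ∈ S) (hy' : y' ∈ S) :
      (f y).toReal - (f y').toReal ≤ D * ‖y - y'‖ := by
    obtain ⟨ξ, hξ⟩ := hne y hy
    have h_sub := toReal_add_inner_le hξ (hfin y hy) (hfin y' hy')
    have h_inner : inner ℝ ξ (y - y') ≤ D * ‖y - y'‖ := (real_inner_le_norm _ _).trans
      (mul_le_mul_of_nonneg_right (hD y hy ξ hξ) (norm_nonneg _))
    rw [← neg_sub, inner_neg_right] at h_sub
    linarith
  rw [abs_sub_le_iff]
  exact ⟨h_le hx hx', norm_sub_rev x x' ▸ h_le hx' hx⟩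

/-- The penalized worst cases are Lipschitz continuous on `X × [0, aₘ]^{Iₘ}`, uniformly in `m`. `L`
is the square of the Lipschitz constant. -/
structure Problem.PenSupVariationLE (P : Problem M N J I) (a : Fin M → ℝ) (L : ℝ) : Prop where
  nonneg : 0 ≤ L
  sq_le : ∀ m, ∀ x ∈ P.X, ∀ x' ∈ P.X, ∀ μ ∈ box (I m) (a m), ∀ μ' ∈ box (I m) (a m),
    (P.penSup m x μ - P.penSup m x' μ') ^ 2 ≤ L * (‖x - x'‖ ^ 2 + ‖μ - μ'‖ ^ 2)

namespace Problem.Regular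

variable {m : Fin M} {x : Vec N} {μ : Vec (I m)}

theorem bddAbove_gpen (hP : P.Regular) (hS : P.BoundedSubgradients) (hx : x ∈ P.X)
    (hμ : ∀ i, 0 ≤ μ i) : BddAbove (Set.range fun z : P.Zt m => P.gpen m x μ z) := by
  obtain ⟨z, hz⟩ := hP.Zt_nonempty m
  obtain ⟨σ, hσ⟩ := hS.penSubdiff_nonempty hx μ hz
  obtain ⟨R, _, hR_le⟩ := exists_nonneg_norm_sub_le (hP.Zt_compact m)
  refine ⟨P.gpen m x μ z + ‖σ‖ * R, Set.forall_mem_range.2 fun w => ?_⟩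
  refine (hP.gpen_le hx hμ hz w.2 hσ).trans (add_le_add le_rfl ((real_inner_le_norm _ _).trans ?_))
  exact mul_le_mul_of_nonneg_left (hR_le z hz w w.2) (norm_nonneg _)

theorem gpen_le_penSup (hP : P.Regular) (hS : P.BoundedSubgradients) (hx : x ∈ P.X)
    (hμ : ∀ i, 0 ≤ μ i) {z : Vec (J m)} (hz : z ∈ P.Zt m) :
    P.gpen m x μ z ≤ P.penSup m x μ :=
  le_ciSup (hP.bddAbove_gpen hS hx hμ) (⟨z, hz⟩ : P.Zt m)

theorem penSup_le (hP : P.Regular) {c : ℝ} (h : ∀ z ∈ P.Zt m, P.gpen m x μ z ≤ c) :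
    P.penSup m x μ ≤ c :=
  have := (hP.Zt_nonempty m).to_subtype
  ciSup_le fun z => h z z.2

theorem exists_penSup_le_gpen_add (hP : P.Regular) (x : Vec N) (μ : Vec (I m)) {θ : ℝ}
    (hθ : 0 < θ) : ∃ z ∈ P.Zt m, P.penSup m x μ ≤ P.gpen m x μ z + θ := by
  have := (hP.Zt_nonempty m).to_subtype
  obtain ⟨z, hz⟩ := exists_lt_of_lt_ciSup (sub_lt_self (P.penSup m x μ) hθ)
  exact ⟨z, z.2, by linarith⟩

theorem convexOn_penSup (hP : P.Regular) (hS : P.BoundedSubgradients) (m : Fin M) (c : ℝ) :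
    ConvexOn ℝ (P.X ×ˢ box (I m) c) fun w => P.penSup m w.1 w.2 := by
  refine ⟨hP.X_convex.prod convex_box, fun w hw w' hw' s t hs ht hst => ?_⟩
  refine hP.penSup_le fun z hz => ?_
  refine ((hP.convexOn_gpen hz).2 (x := w) (y := w') ⟨hw.1, trivial⟩ ⟨hw'.1, trivial⟩
    hs ht hst).trans (add_le_add ?_ ?_)
  · exact mul_le_mul_of_nonneg_left
      (hP.gpen_le_penSup hS hw.1 (fun i => (hw.2 i).1) hz) hs
  · exact mul_le_mul_of_nonneg_left
      (hP.gpen_le_penSup hS hw'.1 (fun i => (hw'.2 i).1) hz) ht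

theorem exists_abs_h_le (hP : P.Regular) (hS : P.BoundedSubgradients) (m : Fin M) :
    ∃ H, 0 ≤ H ∧ ∀ i, ∀ z ∈ P.Zt m, |(P.h m i z).toReal| ≤ H := by
  obtain ⟨z₀, hz₀⟩ := hP.Zt_nonempty m
  obtain ⟨F, hF, hF_le⟩ := hS.h_bounded m
  obtain ⟨R, hR, hR_le⟩ := exists_nonneg_norm_sub_le (hP.Zt_compact m)
  obtain ⟨H₀, hH₀, hH₀_le⟩ := exists_nonneg_forall_le fun i => |(P.h m i z₀).toReal|
  refine ⟨H₀ + F * R, by positivity, fun i z hz => ?_⟩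
  calc |(P.h m i z).toReal|
      ≤ |(P.h m i z₀).toReal| + |(P.h m i z).toReal - (P.h m i z₀).toReal| := by
        rw [← sub_le_iff_le_add']
        exact abs_sub_abs_le_abs_sub _ _
    _ ≤ H₀ + F * ‖z - z₀‖ := add_le_add (hH₀_le i)
        (abs_toReal_sub_le (hP.h_finite m i) (hS.h_nonempty m i) (hF_le i) hz hz₀)
    _ ≤ H₀ + F * R := by
        gcongr
        exact hR_le z hz z₀ hz₀

theorem exists_abs_gpen_sub_le (hP : P.Regular) (hS : P.BoundedSubgradients) (m : Fin M) :
    ∃ l, 0 ≤ l ∧ ∀ x ∈ P.X, ∀ x' ∈ P.X, ∀ μ μ' : Vec (I m), ∀ z ∈ P.Zt m,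
      |P.gpen m x μ z - P.gpen m x' μ' z| ≤ l * (‖x - x'‖ + ‖μ - μ'‖) := by
  obtain ⟨D, hD, hD_le⟩ := hS.gx_bounded m
  obtain ⟨H, hH, hH_le⟩ := hP.exists_abs_h_le hS m
  refine ⟨D + I m * H, by positivity, fun x hx x' hx' μ μ' z hz => ?_⟩
  have h_g : |(P.g m x z).toReal - (P.g m x' z).toReal| ≤ D * ‖x - x'‖ :=
    abs_toReal_sub_le (f := fun y => P.g m y z) (fun y hy => hP.g_finite m y hy z hz)
      (fun y hy => hS.gx_nonempty m y hy z hz) (fun y hy => hD_le y hy z hz) hx hx'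
  have h_h : |∑ i, (μ - μ') i * (P.h m i z).toReal| ≤ I m * (‖μ - μ'‖ * H) := by
    refine (Finset.abs_sum_le_sum_abs _ _).trans
      ((Finset.sum_le_card_nsmul _ _ (‖μ - μ'‖ * H) fun i _ => ?_).trans_eq (by simp))
    rw [abs_mul]
    exact mul_le_mul (PiLp.norm_apply_le (μ - μ') i) (hH_le i z hz) (abs_nonneg _) (norm_nonneg _)
  have h_split : P.gpen m x μ z - P.gpen m x' μ' z = ((P.g m x z).toReal - (P.g m x' z).toReal)
      - ∑ i, (μ - μ') i * (P.h m i z).toReal := by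
    simp only [Problem.gpen, PiLp.sub_apply, sub_mul, Finset.sum_sub_distrib]
    ring
  have h_rest : 0 ≤ D * ‖μ - μ'‖ + I m * H * ‖x - x'‖ := by positivity
  rw [h_split]
  linarith [abs_sub ((P.g m x z).toReal - (P.g m x' z).toReal)
    (∑ i, (μ - μ') i * (P.h m i z).toReal)]

theorem exists_abs_penSup_sub_le (hP : P.Regular) (hS : P.BoundedSubgradients) :
    ∃ l, 0 ≤ l ∧ ∀ m, ∀ x ∈ P.X, ∀ x' ∈ P.X, ∀ μ μ' : Vec (I m), (∀ i, 0 ≤ μ i) →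
      (∀ i, 0 ≤ μ' i) → |P.penSup m x μ - P.penSup m x' μ'| ≤ l * (‖x - x'‖ + ‖μ - μ'‖) := by
  choose l _ h_gpen using hP.exists_abs_gpen_sub_le hS
  obtain ⟨l', hl', hl_le⟩ := exists_nonneg_forall_le l
  have h_le {m : Fin M} {x x' : Vec N} (hx : x ∈ P.X) (hx' : x' ∈ P.X) (μ : Vec (I m))
      {μ' : Vec (I m)} (hμ' : ∀ i, 0 ≤ μ' i) :
      P.penSup m x μ - P.penSup m x' μ' ≤ l' * (‖x - x'‖ + ‖μ - μ'‖) := by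
    rw [sub_le_iff_le_add]
    refine hP.penSup_le fun z hz => ?_
    have h_z := (le_abs_self _).trans (h_gpen m x hx x' hx' μ μ' z hz)
    have h_l := mul_le_mul_of_nonneg_right (hl_le m) (by positivity : 0 ≤ ‖x - x'‖ + ‖μ - μ'‖)
    linarith [hP.gpen_le_penSup hS hx' hμ' hz]
  refine ⟨l', hl', fun m x hx x' hx' μ μ' hμ hμ' => abs_sub_le_iff.2 ⟨h_le hx hx' μ hμ', ?_⟩⟩
  rw [norm_sub_rev x, norm_sub_rev μ]
  exact h_le hx' hx μ' hμ

theorem exists_penSupVariationLE (hP : P.Regular) (hS : P.BoundedSubgradients) (a : Fin M → ℝ) :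
    ∃ L, P.PenSupVariationLE a L := by
  obtain ⟨l, _, h_lip⟩ := hP.exists_abs_penSup_sub_le hS
  refine ⟨2 * l ^ 2, by positivity, fun m x hx x' hx' μ hμ μ' hμ' => ?_⟩
  calc (P.penSup m x μ - P.penSup m x' μ') ^ 2
      ≤ (l * (‖x - x'‖ + ‖μ - μ'‖)) ^ 2 :=
        sq_le_sq.2 ((h_lip m x hx x' hx' μ μ' (fun i => (hμ i).1) fun i => (hμ' i).1).trans
          (le_abs_self _))
    _ ≤ l ^ 2 * (2 * (‖x - x'‖ ^ 2 + ‖μ - μ'‖ ^ 2)) := by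
        rw [mul_pow]
        gcongr
        exact add_sq_le
    _ = 2 * l ^ 2 * (‖x - x'‖ ^ 2 + ‖μ - μ'‖ ^ 2) := by ring

theorem exists_abs_penSup_le (hP : P.Regular) (hS : P.BoundedSubgradients) {a : Fin M → ℝ}
    (ha : ∀ m, 0 ≤ a m) :
    ∃ B, 0 ≤ B ∧ ∀ m, ∀ x ∈ P.X, ∀ μ ∈ box (I m) (a m), |P.penSup m x μ| ≤ B := by
  obtain ⟨l, hl, h_lip⟩ := hP.exists_abs_penSup_sub_le hS
  obtain ⟨R, hR⟩ := hP.exists_diameterLE a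
  obtain ⟨x₀, hx₀⟩ := hP.X_nonempty
  obtain ⟨B₀, hB₀, hB₀_le⟩ := exists_nonneg_forall_le fun m => |P.penSup m x₀ 0|
  have hR_nonneg := hR.nonneg
  refine ⟨B₀ + l * (R + R), by positivity, fun m x hx μ hμ => ?_⟩
  have h_zero := zero_mem_box (n := I m) (ha m)
  calc |P.penSup m x μ|
      ≤ |P.penSup m x₀ 0| + |P.penSup m x μ - P.penSup m x₀ 0| := by
        rw [← sub_le_iff_le_add']
        exact abs_sub_abs_le_abs_sub _ _
    _ ≤ B₀ + l * (‖x - x₀‖ + ‖μ - 0‖) := add_le_add (hB₀_le m)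
        (h_lip m x hx x₀ hx₀ μ 0 (fun i => (hμ i).1) fun i => (h_zero i).1)
    _ ≤ B₀ + l * (R + R) := by
        gcongr
        · exact hR.x_le x hx x₀ hx₀
        · exact hR.μ_le m μ hμ 0 h_zero

theorem worst_le_penSup (hP : P.Regular) (hS : P.BoundedSubgradients) (hx : x ∈ P.X)
    (hμ : ∀ i, 0 ≤ μ i) : P.worst m x ≤ ((P.penSup m x μ : ℝ) : EReal) := by
  refine iSup₂_le fun z hz => ?_
  have h_h : ∀ i, P.h m i z ≤ 0 := by simpa using hz.2
  rw [← (hP.g_finite m x hx z hz.1).toReal_le_iff]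
  refine le_trans ?_ (hP.gpen_le_penSup hS hx hμ hz.1)
  rw [Problem.gpen, le_sub_self_iff]
  exact Finset.sum_nonpos fun i _ =>
    mul_nonpos_of_nonneg_of_nonpos (hμ i) (EReal.toReal_nonpos (h_h i))

end Problem.Regular

end PenalizedWorstCase

section RunExistence

theorem exists_two_step_seq {α : Type*} {S : Set α} {r : α → α → α → Prop} {s₀ : α}
    (hs₀ : s₀ ∈ S) (hr : ∀ u ∈ S, ∀ v ∈ S, ∃ w ∈ S, r u v w) :
    ∃ s : ℕ → α, s 0 = s₀ ∧ ∀ t, s t ∈ S ∧ r (s (t - 1)) (s t) (s (t + 1)) := by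
  choose! next h_mem h_next using hr
  let pair (t : ℕ) : α × α := Nat.rec (s₀, s₀) (fun _ q => (q.2, next q.1 q.2)) t
  have h_fst (t : ℕ) : (pair t).1 = (pair (t - 1)).2 := by cases t <;> rfl
  have h_pair (t : ℕ) : (pair t).1 ∈ S ∧ (pair t).2 ∈ S := by
    induction t with
    | zero => exact ⟨hs₀, hs₀⟩
    | succ t ih => exact ⟨ih.2, h_mem _ ih.1 _ ih.2⟩
  refine ⟨fun t => (pair t).2, rfl, fun t => ⟨(h_pair t).2, ?_⟩⟩
  change r (pair (t - 1)).2 (pair t).2 (pair (t + 1)).2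
  rw [← h_fst]
  exact h_next _ (h_pair t).1 _ (h_pair t).2

variable {M N : ℕ} {J I : Fin M → ℕ} {P : Problem M N J I} {a : Fin M → ℝ}

/-- The iterates `(x, μ, z)` of the inner algorithm. -/
abbrev InnerIterate (N : ℕ) (J I : Fin M → ℕ) : Type :=
  Vec N × ((m : Fin M) → Vec (I m)) × ((m : Fin M) → Vec (J m))

theorem Problem.Regular.exists_projection_seq (hP : P.Regular) (ha : ∀ m, 0 ≤ a m)
    (zTarget : InnerIterate N J I → InnerIterate N J I → (m : Fin M) → Vec (J m))
    (xTarget : InnerIterate N J I → ((m : Fin M) → Vec (J m)) → Vec N)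
    (μTarget : InnerIterate N J I → ((m : Fin M) → Vec (J m)) → (m : Fin M) → Vec (I m)) :
    ∃ s : ℕ → InnerIterate N J I, (s 0).2.1 = 0 ∧ ∀ t,
      ((s t).1 ∈ P.X ∧ ∀ m, (s t).2.2 m ∈ P.Zt m) ∧
      (∀ m, IsProj (P.Zt m) (zTarget (s (t - 1)) (s t) m) ((s (t + 1)).2.2 m)) ∧
      IsProj P.X (xTarget (s t) (s (t + 1)).2.2) (s (t + 1)).1 ∧
      ∀ m, IsProj (box (I m) (a m)) (μTarget (s t) (s (t + 1)).2.2 m) ((s (t + 1)).2.1 m) := by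
  obtain ⟨x₀, hx₀⟩ := hP.X_nonempty
  choose z₀ hz₀ using hP.Zt_nonempty
  choose projX h_projX using exists_isProj hP.X_compact hP.X_nonempty
  choose projZ h_projZ using fun m => exists_isProj (hP.Zt_compact m) (hP.Zt_nonempty m)
  choose projBox h_projBox using fun m =>
    exists_isProj (isCompact_box (n := I m) (c := a m)) ⟨0, zero_mem_box (ha m)⟩
  obtain ⟨s, h_init, h_step⟩ := exists_two_step_seq
    (S := {s : InnerIterate N J I | s.1 ∈ P.X ∧ ∀ m, s.2.2 m ∈ P.Zt m})
    (r := fun u v w => (∀ m, IsProj (P.Zt m) (zTarget u v m) (w.2.2 m)) ∧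
      IsProj P.X (xTarget v w.2.2) w.1 ∧
      ∀ m, IsProj (box (I m) (a m)) (μTarget v w.2.2 m) (w.2.1 m))
    (s₀ := (x₀, 0, z₀)) ⟨hx₀, hz₀⟩ fun u _ v _ =>
      let z m := projZ m (zTarget u v m)
      ⟨(projX (xTarget v z), fun m => projBox m (μTarget v z m), z),
        ⟨(h_projX _).1, fun m => (h_projZ m _).1⟩,
        fun m => h_projZ m _, h_projX _, fun m => h_projBox m _⟩
  exact ⟨s, by rw [h_init], h_step⟩

theorem Problem.Regular.exists_inner_run (hP : P.Regular) (hS : P.BoundedSubgradients)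
    (ha : ∀ m, 0 ≤ a m) (p : Params) (xc : Vec N) (μc : (m : Fin M) → Vec (I m))
    (lam : Fin M → ℝ) : ∃ Q : InnerTrace M N J I, Q.IsRun P a p xc μc lam := by
  choose! ζ hζ using hS.gz_nonempty
  choose! η hη using hS.h_nonempty
  choose! ξ0 hξ0 using hS.f0_nonempty
  choose! ξ hξ using hS.gx_nonempty
  obtain ⟨s, h_init, h_step⟩ := hP.exists_projection_seq ha
    (fun u v m => v.2.2 m - (p.δ * lam m) • ((2 : ℝ) • ζ m v.1 (v.2.2 m) - ζ m u.1 (u.2.2 m)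
      + ∑ i, ((2 * v.2.1 m i) • η m i (v.2.2 m) - u.2.1 m i • η m i (u.2.2 m))))
    (fun v z => (p.α * p.γ / (p.α + p.γ)) • ((1 / p.α) • xc + (1 / p.γ) • v.1
      - (ξ0 v.1 + ∑ m, lam m • ξ m v.1 (z m))))
    fun v z m => (p.α * p.γ / (p.α + p.γ)) •
      ((1 / p.α) • μc m + (1 / p.γ) • v.2.1 m + lam m • P.hvec m (z m))
  have h_x (t : ℕ) : (s t).1 ∈ P.X := (h_step t).1.1
  have h_z (t : ℕ) (m : Fin M) : (s t).2.2 m ∈ P.Zt m := (h_step t).1.2 m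
  exact ⟨⟨fun t => (s t).1, fun t => (s t).2.1, fun t => (s t).2.2,
      fun t m => ζ m (s t).1 ((s t).2.2 m), fun t m i => η m i ((s t).2.2 m),
      fun t => ξ0 (s t).1, fun t m => ξ m (s t).1 ((s (t + 1)).2.2 m)⟩,
    { x_init := h_x 0
      μ_init := fun m => by
        simp only [h_init]
        exact zero_mem_box (ha m)
      z_init := h_z 0
      ζ_mem := fun t _ m => hζ m _ (h_x t) _ (h_z t m)
      η_mem := fun t _ m i => hη m i _ (h_z t m)
      z_step := fun t _ => (h_step t).2.1
      ξ0_mem := fun t _ => hξ0 _ (h_x t)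
      ξ_mem := fun t _ m => hξ m _ (h_x t) _ (h_z (t + 1) m)
      x_step := fun t _ => (h_step t).2.2.1
      μ_step := fun t _ => (h_step t).2.2.2 }⟩

theorem Problem.Regular.exists_run (hP : P.Regular) (hS : P.BoundedSubgradients)
    (ha : ∀ m, 0 ≤ a m) (p : Params) {x0 : Vec N} (hx0 : x0 ∈ P.X)
    {μ0 : (m : Fin M) → Vec (I m)} (hμ0 : ∀ m, μ0 m ∈ box (I m) (a m)) :
    ∃ R : Trace M N J I, R.IsRun P a p x0 μ0 := by
  choose zmax hz_mem hz_max using fun (m : Fin M) x (μ : Vec (I m)) =>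
    hP.exists_penSup_le_gpen_add x μ p.θ_pos
  obtain ⟨s, h_init, h_step⟩ := exists_two_step_seq
    (S := {s : Vec N × ((m : Fin M) → Vec (I m)) × (Fin M → ℝ) |
      s.1 ∈ P.X ∧ ∀ m, s.2.1 m ∈ box (I m) (a m)})
    (r := fun u v w =>
      (∀ m, w.2.2 m = max (v.2.2 m + p.β * (2 * P.gpen m v.1 (v.2.1 m) (zmax m v.1 (v.2.1 m))
        - P.gpen m u.1 (u.2.1 m) (zmax m u.1 (u.2.1 m)))) 0) ∧
      ∃ Q : InnerTrace M N J I, Q.IsRun P a p v.1 v.2.1 w.2.2 ∧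
        w.1 = Q.xout p.T ∧ w.2.1 = Q.μout p.T)
    (s₀ := (x0, μ0, 0)) ⟨hx0, hμ0⟩ fun u _ v _ => by
      obtain ⟨Q, hQ⟩ := hP.exists_inner_run hS ha p v.1 v.2.1 _
      exact ⟨(Q.xout p.T, Q.μout p.T, _), ⟨hQ.xout_mem hP, hQ.μout_mem⟩, fun _ => rfl,
        Q, hQ, rfl, rfl⟩
  choose h_lam Q h_run h_xout h_μout using fun t => (h_step t).2
  exact ⟨⟨fun k => (s k).1, fun k => (s k).2.1, fun k => (s k).2.2,
      fun k m => zmax m (s k).1 ((s k).2.1 m), Q⟩,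
    { x_init := by simp only [h_init]
      μ_init := by simp only [h_init]
      lam_init := by simp only [h_init]
      z_mem := fun k _ m => hz_mem m _ _
      z_approx := fun k _ m w hw => (hP.gpen_le_penSup hS (h_step k).1.1
        (fun i => ((h_step k).1.2 m i).1) hw).trans (hz_max m _ _)
      lam_step := fun k _ => h_lam k
      inner_run := fun k _ => h_run k
      x_step := fun k _ => h_xout k
      μ_step := fun k _ => h_μout k }⟩

end RunExistence

section Duality

theorem le_div_iSup_of_le_sum_mul {ι : Type*} [Fintype ι] {l h : ι → ℝ} {G : ℝ}
    (hl : ∀ i, 0 ≤ l i) (hh : ⨆ i, h i < 0) (hG : G ≤ ∑ i, l i * h i) (i : ι) :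
    l i ≤ G / ⨆ i, h i := by
  classical
  rw [le_div_iff_of_neg hh]
  have h_nonpos (j : ι) : h j ≤ 0 := (le_ciSup (Set.finite_range h).bddAbove j).trans hh.le
  calc G ≤ ∑ j, l j * h j := hG
    _ = l i * h i - ∑ j ∈ Finset.univ.erase i, l j * -h j := by
        simp only [mul_neg, Finset.sum_neg_distrib, sub_neg_eq_add]
        exact (Finset.add_sum_erase _ _ (Finset.mem_univ i)).symm
    _ ≤ l i * h i := sub_le_self _ <| Finset.sum_nonneg fun j _ =>
        mul_nonneg (hl j) (neg_nonneg.2 (h_nonpos j))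
    _ ≤ l i * ⨆ j, h j :=
        mul_le_mul_of_nonneg_left (le_ciSup (Set.finite_range h).bddAbove i) (hl i)

variable {M N : ℕ} {J I : Fin M → ℕ} {P : Problem M N J I}

theorem Problem.IsSlaterFamily.toReal_neg {zbar : (m : Fin M) → Vec (J m)}
    (hz : P.IsSlaterFamily zbar) (hP : P.Regular) (m : Fin M) (i : Fin (I m)) :
    (P.h m i (zbar m)).toReal < 0 :=
  EReal.toReal_neg ((hz m).2 i) (hP.h_ne_bot m i _)

theorem Problem.IsSlaterFamily.iSup_toReal_neg {zbar : (m : Fin M) → Vec (J m)}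
    (hz : P.IsSlaterFamily zbar) (hP : P.Regular) (m : Fin M) [Nonempty (Fin (I m))] :
    ⨆ i, (P.h m i (zbar m)).toReal < 0 := by
  obtain ⟨i, hi⟩ := exists_eq_ciSup_of_finite (f := fun i => (P.h m i (zbar m)).toReal)
  exact hi ▸ hz.toReal_neg hP m i

namespace Problem.Regular

variable {zbar : (m : Fin M) → Vec (J m)} {G : Fin M → ℝ}

theorem multBound_nonneg (hP : P.Regular) (hz : P.IsSlaterFamily zbar)
    (hG : P.IsLowerBound zbar G) (m : Fin M) : 0 ≤ P.multBound zbar G m :=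
  div_nonneg_of_nonpos (hG m).1.le <|
    Real.iSup_nonpos fun i => (hz.toReal_neg hP m i).le

theorem exists_dual_multiplier (hP : P.Regular) (hz : P.IsSlaterFamily zbar) {m : Fin M}
    {x : Vec N} (hx : x ∈ P.X) (hfeas : P.worst m x ≤ 0) :
    ∃ l : Fin (I m) → ℝ, (∀ i, 0 ≤ l i) ∧
      ∀ z ∈ P.Zt m, (P.g m x z).toReal ≤ ∑ i, l i * (P.h m i z).toReal := by
  have h_le : ∀ z ∈ P.Zt m, (∀ i, (P.h m i z).toReal ≤ 0) → 0 ≤ (-P.g m x z).toReal := by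
    intro z hz h_nonpos
    have h_mem : z ∈ P.Z m := ⟨hz, Set.mem_iInter.2 fun i => by
      simpa using (hP.h_finite m i z hz).toReal_le_iff.1 (h_nonpos i)⟩
    have h_g : P.g m x z ≤ 0 :=
      (le_iSup₂ (f := fun z (_ : z ∈ P.Z m) => P.g m x z) z h_mem).trans hfeas
    exact EReal.toReal_nonneg (EReal.neg_nonneg.2 h_g)
  obtain ⟨l, hl, h_dual⟩ := exists_lagrange_multiplier
    ((hP.g_concave m x hx).convexOn (hP.Zt_convex m) fun z hz => (hP.g_finite m x hx z hz).neg)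
    (fun i => (hP.h_convex m i).convexOn (hP.Zt_convex m) fun z hz => hP.h_finite m i z hz)
    (hz m).1 (hz.toReal_neg hP m) h_le
  refine ⟨l, hl, fun z hz => ?_⟩
  have h_z := h_dual z hz
  rw [EReal.toReal_neg_eq] at h_z
  linarith

theorem exists_mem_box_penSup_nonpos (hP : P.Regular) (hz : P.IsSlaterFamily zbar)
    (hG : P.IsLowerBound zbar G) {m : Fin M} {x : Vec N} (hx : x ∈ P.X)
    (hfeas : P.worst m x ≤ 0) :
    ∃ μ ∈ box (I m) (P.multBound zbar G m), P.penSup m x μ ≤ 0 := by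
  obtain ⟨l, hl, h_dual⟩ := hP.exists_dual_multiplier hz hx hfeas
  have h_lower : G m ≤ ∑ i, l i * (P.h m i (zbar m)).toReal := by
    refine le_trans ?_ (h_dual _ (hz m).1)
    rw [← EReal.coe_le_coe_iff, (hP.g_finite m x hx _ (hz m).1).coe_toReal]
    exact (hG m).2 x hx
  refine ⟨WithLp.toLp 2 l, fun i => ⟨hl i, ?_⟩, hP.penSup_le fun z hz => ?_⟩
  · have : Nonempty (Fin (I m)) := ⟨i⟩
    exact le_div_iSup_of_le_sum_mul hl (hz.iSup_toReal_neg hP m) h_lower i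
  · exact sub_nonpos.2 (h_dual z hz)

theorem exists_penSup_zero_neg (hP : P.Regular) : ∃ x ∈ P.X, ∀ m, P.penSup m x 0 < 0 := by
  obtain ⟨x, hx, h_neg⟩ := hP.slater_x
  refine ⟨x, hx, fun m => ?_⟩
  obtain ⟨r, hr_lt, hr_neg⟩ := EReal.lt_iff_exists_real_btwn.1 (h_neg m)
  refine (hP.penSup_le (c := r) fun z hz => ?_).trans_lt (EReal.coe_neg'.1 hr_neg)
  have h_g : P.g m x z ≤ (r : EReal) :=
    (le_iSup₂ (f := fun z (_ : z ∈ P.Zt m) => P.g m x z) z hz).trans hr_lt.le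
  simpa [Problem.gpen] using (hP.g_finite m x hx z hz).toReal_le_iff.2 h_g

end Problem.Regular

/-- The Lagrangian `f₀(x) + ∑ₘ lₘ sup {g̃ₘ(x, μₘ, z) | z ∈ Z̃ₘ}` of the robust problem in which the
worst cases over `Zₘ` are replaced by penalized worst cases over `Z̃ₘ`. -/
noncomputable def Problem.lagrangian (P : Problem M N J I) (l : Fin M → ℝ) (x : Vec N)
    (μ : (m : Fin M) → Vec (I m)) : ℝ :=
  (P.f0 x).toReal + ∑ m, l m * P.penSup m x (μ m)

/-- `(xs, μs; l)` is a saddle point of the Lagrangian over `x ∈ X` and `μₘ ∈ [0, aₘ]^{Iₘ}`, and its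
primal part `xs` solves the robust problem. -/
structure Problem.IsLagrangeSaddle (P : Problem M N J I) (a : Fin M → ℝ) (xs : Vec N)
    (μs : (m : Fin M) → Vec (I m)) (l : Fin M → ℝ) : Prop where
  optimal : P.IsOptimal xs
  μ_mem : ∀ m, μs m ∈ box (I m) (a m)
  penSup_nonpos : ∀ m, P.penSup m xs (μs m) ≤ 0
  l_nonneg : ∀ m, 0 ≤ l m
  le_lagrangian : ∀ x ∈ P.X, ∀ μ : (m : Fin M) → Vec (I m), (∀ m, μ m ∈ box (I m) (a m)) →
    (P.f0 xs).toReal ≤ P.lagrangian l x μ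

namespace Problem.Regular

theorem convexOn_f0_fst (hP : P.Regular) (a : Fin M → ℝ) :
    ConvexOn ℝ (P.X ×ˢ Set.univ.pi fun m => box (I m) (a m)) fun w => (P.f0 w.1).toReal :=
  ((hP.f0_convex.convexOn hP.X_convex hP.f0_finite).comp_linearMap
    (LinearMap.fst ℝ (Vec N) ((m : Fin M) → Vec (I m)))).subset
      (fun _ hw => hw.1) (hP.X_convex.prod (convex_pi fun _ _ => convex_box))

theorem convexOn_penSup_snd_apply (hP : P.Regular) (hS : P.BoundedSubgradients) (a : Fin M → ℝ)
    (m : Fin M) :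
    ConvexOn ℝ (P.X ×ˢ Set.univ.pi fun m => box (I m) (a m)) fun w =>
      P.penSup m w.1 (w.2 m) :=
  ((hP.convexOn_penSup hS m (a m)).comp_linearMap
    ((LinearMap.fst ℝ (Vec N) ((m : Fin M) → Vec (I m))).prod
      ((LinearMap.proj m).comp (LinearMap.snd ℝ (Vec N) ((m : Fin M) → Vec (I m)))))).subset
      (fun _ hw => ⟨hw.1, hw.2 m trivial⟩) (hP.X_convex.prod (convex_pi fun _ _ => convex_box))

theorem convexOn_lagrangian (hP : P.Regular) (hS : P.BoundedSubgradients) (a : Fin M → ℝ)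
    {l : Fin M → ℝ} (hl : ∀ m, 0 ≤ l m) :
    ConvexOn ℝ (P.X ×ˢ Set.univ.pi fun m => box (I m) (a m)) fun w => P.lagrangian l w.1 w.2 :=
  (hP.convexOn_f0_fst a).add <| convexOn_finset_sum _ (hP.convexOn_f0_fst a).1 fun m _ =>
    (hP.convexOn_penSup_snd_apply hS a m).smul (hl m)

end Problem.Regular

theorem Problem.IsOptimal.toReal_le {xs : Vec N} (hxs : P.IsOptimal xs) (hP : P.Regular)
    (hS : P.BoundedSubgradients) {x : Vec N} (hx : x ∈ P.X) {μ : (m : Fin M) → Vec (I m)}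
    (hμ : ∀ m i, 0 ≤ μ m i) (h_nonpos : ∀ m, P.penSup m x (μ m) ≤ 0) :
    (P.f0 xs).toReal ≤ (P.f0 x).toReal := by
  have h_feas : P.IsFeasible x := ⟨hx, fun m =>
    (hP.worst_le_penSup hS hx (hμ m)).trans (EReal.coe_nonpos.2 (h_nonpos m))⟩
  rw [(hP.f0_finite _ hxs.1.1).toReal_le_iff, (hP.f0_finite _ hx).coe_toReal]
  exact hxs.2 x h_feas

theorem Problem.Regular.exists_isLagrangeSaddle (hP : P.Regular) (hS : P.BoundedSubgradients)
    {zbar : (m : Fin M) → Vec (J m)} (hz : P.IsSlaterFamily zbar) {G : Fin M → ℝ}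
    (hG : P.IsLowerBound zbar G) :
    ∃ xs μs l, P.IsLagrangeSaddle (P.multBound zbar G) xs μs l := by
  obtain ⟨xs, hxs⟩ := hP.exists_optimal
  choose μs hμs h_pen using fun m => hP.exists_mem_box_penSup_nonpos hz hG hxs.1.1 (hxs.1.2 m)
  obtain ⟨xbar, hxbar, h_neg⟩ := hP.exists_penSup_zero_neg
  set a := P.multBound zbar G
  obtain ⟨l, hl, h_dual⟩ := exists_lagrange_multiplier (hP.convexOn_f0_fst a)
    (hP.convexOn_penSup_snd_apply hS a) (s₀ := (xbar, 0))
    ⟨hxbar, fun m _ => zero_mem_box (hP.multBound_nonneg hz hG m)⟩ h_neg fun w hw h_nonpos =>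
      hxs.toReal_le hP hS hw.1 (fun m i => (hw.2 m trivial i).1) h_nonpos
  exact ⟨xs, μs, l, hxs, hμs, h_pen, hl, fun x hx μ hμ => h_dual (x, μ) ⟨hx, fun m _ => hμ m⟩⟩

end Duality

section DualAscent

theorem dual_step_le {β y s y' l : ℝ} (hβ : 0 < β) (hl : 0 ≤ l) (hy : y' = max (y + β * s) 0) :
    (l - y') * s ≤ ((l - y) ^ 2 - (l - y') ^ 2 - (y' - y) ^ 2) / (2 * β) := by
  have h_proj : (y + β * s - y') * (l - y') ≤ 0 := by
    rcases max_cases (y + β * s) 0 with ⟨h_max, -⟩ | ⟨h_max, h_neg⟩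
    · simp [hy, h_max]
    · simpa [hy, h_max] using mul_nonpos_of_nonpos_of_nonneg h_neg.le hl
  rw [le_div_iff₀ (by positivity)]
  nlinarith only [h_proj]

/-- `y` is a scalar multiplier that performs `n` projected ascent steps of size `β` on the
extrapolated values `2 φ k - φ (k - 1)`, where `φ` approximates `c` from below up to `θ`. As in the
algorithm, the index `k - 1` is `0` for `k = 0`. -/
structure IsDualAscent (β θ : ℝ) (n : ℕ) (c φ y : ℕ → ℝ) : Prop where
  init : y 0 = 0
  step : ∀ k < n, y (k + 1) = max (y k + β * (2 * φ k - φ (k - 1))) 0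
  approx : ∀ k ≤ n, φ k ∈ Set.Icc (c k - θ) (c k)

/-- Lyapunov function of the extrapolated ascent, for the comparison multiplier `l`, the current
multiplier `y` and the last change `d` of the ascent direction. -/
noncomputable def dualPotential (β l y d : ℝ) : ℝ := (l - y) ^ 2 / (2 * β) - (l - y) * d

theorem sq_div_le_dualPotential_add {β : ℝ} (hβ : 0 < β) (l y d : ℝ) :
    (l - y) ^ 2 / (4 * β) ≤ dualPotential β l y d + β * d ^ 2 := by
  have h_square : dualPotential β l y d + β * d ^ 2 - (l - y) ^ 2 / (4 * β)
      = (l - y - 2 * β * d) ^ 2 / (4 * β) := by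
    unfold dualPotential
    field_simp
    ring
  have : 0 ≤ (l - y - 2 * β * d) ^ 2 / (4 * β) := by positivity
  linarith

namespace IsDualAscent

variable {β θ l : ℝ} {n k : ℕ} {c φ y : ℕ → ℝ}

theorem step_le (h : IsDualAscent β θ n c φ y) (hβ : 0 < β) (hl : 0 ≤ l) (hk : k < n) :
    (l - y (k + 1)) * c (k + 1) ≤ dualPotential β l (y k) (φ k - φ (k - 1))
      - dualPotential β l (y (k + 1)) (φ (k + 1) - φ k)
      + β / 2 * (φ k - φ (k - 1)) ^ 2 + θ * l := by
  have hy_nonneg : 0 ≤ y (k + 1) := h.step k hk ▸ le_max_right _ _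
  have h_step := dual_step_le hβ hl (h.step k hk)
  have h_approx : (l - y (k + 1)) * (c (k + 1) - φ (k + 1)) ≤ θ * l := by
    obtain ⟨h_lower, h_upper⟩ := h.approx (k + 1) hk
    calc (l - y (k + 1)) * (c (k + 1) - φ (k + 1)) ≤ l * (c (k + 1) - φ (k + 1)) :=
          mul_le_mul_of_nonneg_right (sub_le_self l hy_nonneg) (sub_nonneg.2 h_upper)
      _ ≤ l * θ := mul_le_mul_of_nonneg_left (by linarith) hl
      _ = θ * l := mul_comm _ _
  have h_young : (y (k + 1) - y k) * (φ k - φ (k - 1))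
      ≤ (y (k + 1) - y k) ^ 2 / (2 * β) + β / 2 * (φ k - φ (k - 1)) ^ 2 := by
    have h := mul_le_sq_div_add_sq (γ := β / 4) (by positivity) (φ k - φ (k - 1)) (y (k + 1) - y k)
    rw [show 8 * (β / 4) = 2 * β by ring, show 2 * (β / 4) = β / 2 by ring] at h
    linarith
  unfold dualPotential
  rw [sub_div, sub_div] at h_step
  linarith

theorem sub_sq_le (h : IsDualAscent β θ n c φ y) (hk : k < n) :
    (φ (k + 1) - φ k) ^ 2 ≤ 2 * (c (k + 1) - c k) ^ 2 + 2 * θ ^ 2 := by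
  obtain ⟨h_lower, h_upper⟩ := h.approx k hk.le
  obtain ⟨h_lower', h_upper'⟩ := h.approx (k + 1) hk
  have h_error : (φ (k + 1) - φ k - (c (k + 1) - c k)) ^ 2 ≤ θ ^ 2 :=
    sq_le_sq' (by linarith) (by linarith)
  have h_add := add_sq_le (a := c (k + 1) - c k) (b := φ (k + 1) - φ k - (c (k + 1) - c k))
  rw [add_sub_cancel] at h_add
  linarith

theorem sum_le (h : IsDualAscent β θ n c φ y) (hβ : 0 < β) (hl : 0 ≤ l) :
    ∑ k ∈ Finset.range n, (l - y (k + 1)) * c (k + 1) + (l - y n) ^ 2 / (4 * β)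
      ≤ l ^ 2 / (2 * β) + n * (θ * l + 2 * β * θ ^ 2)
        + 2 * β * ∑ k ∈ Finset.range n, (c (k + 1) - c k) ^ 2 := by
  let d (k : ℕ) : ℝ := φ k - φ (k - 1)
  let Ψ (k : ℕ) : ℝ := dualPotential β l (y k) (d k)
  have hd : ∑ k ∈ Finset.range n, d k ^ 2 + d n ^ 2
      ≤ ∑ k ∈ Finset.range n, (2 * (c (k + 1) - c k) ^ 2 + 2 * θ ^ 2) := by
    rw [← Finset.sum_range_succ, Finset.sum_range_succ']
    simpa [d] using Finset.sum_le_sum fun k hk => h.sub_sq_le (Finset.mem_range.1 hk)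
  have h_sum : ∑ k ∈ Finset.range n, (l - y (k + 1)) * c (k + 1)
      ≤ ∑ k ∈ Finset.range n, (Ψ k - Ψ (k + 1) + β / 2 * d k ^ 2 + θ * l) :=
    Finset.sum_le_sum fun k hk => h.step_le hβ hl (Finset.mem_range.1 hk)
  have hΨ_zero : Ψ 0 = l ^ 2 / (2 * β) := by simp [Ψ, d, dualPotential, h.init]
  have hΨ_end := sq_div_le_dualPotential_add hβ l (y n) (d n)
  have hd_nonneg : 0 ≤ ∑ k ∈ Finset.range n, d k ^ 2 := by positivity
  simp only [Finset.sum_add_distrib, Finset.sum_range_sub', ← Finset.mul_sum, Finset.sum_const,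
    Finset.card_range, nsmul_eq_mul] at h_sum hd
  nlinarith only [h_sum, hd_nonneg, hΨ_zero, hΨ_end, mul_le_mul_of_nonneg_left hd hβ.le,
    mul_nonneg hβ.le hd_nonneg]

end IsDualAscent

end DualAscent

section OuterAlgorithm

variable {M N : ℕ} {J I : Fin M → ℕ} {P : Problem M N J I} {a : Fin M → ℝ}

theorem Problem.Regular.sum_mul_penSup_le (hP : P.Regular) {lam : Fin M → ℝ}
    (hlam : ∀ m, 0 ≤ lam m) {x : Vec N} {μ : (m : Fin M) → Vec (I m)} {c : ℝ}
    (h : ∀ z : (m : Fin M) → Vec (J m), (∀ m, z m ∈ P.Zt m) →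
      ∑ m, lam m * P.gpen m x (μ m) (z m) ≤ c) :
    ∑ m, lam m * P.penSup m x (μ m) ≤ c := by
  refine le_of_forall_pos_le_add fun τ hτ => ?_
  have h_sum_nonneg : 0 ≤ ∑ m, lam m := Finset.sum_nonneg fun m _ => hlam m
  have h_pos : 0 < 1 + ∑ m, lam m := by linarith
  choose z hz h_z using fun m =>
    hP.exists_penSup_le_gpen_add (m := m) x (μ m) (div_pos hτ h_pos)
  calc ∑ m, lam m * P.penSup m x (μ m)
      ≤ ∑ m, lam m * (P.gpen m x (μ m) (z m) + τ / (1 + ∑ m, lam m)) :=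
        Finset.sum_le_sum fun m _ => mul_le_mul_of_nonneg_left (h_z m) (hlam m)
    _ = ∑ m, lam m * P.gpen m x (μ m) (z m) + (∑ m, lam m) * (τ / (1 + ∑ m, lam m)) := by
        simp only [mul_add, Finset.sum_add_distrib, Finset.sum_mul]
    _ ≤ c + τ := by
        refine add_le_add (h z hz) ?_
        rw [mul_div_assoc', div_le_iff₀ h_pos]
        linarith

theorem Problem.IsStrongSaddle.lagrangian_sub_le {α ν : ℝ} {xc xs x : Vec N}
    {μc μs μ : (m : Fin M) → Vec (I m)} {zs : (m : Fin M) → Vec (J m)} {lam : Fin M → ℝ}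
    (h : P.IsStrongSaddle a α ν xc μc lam xs μs zs) (hP : P.Regular)
    (hS : P.BoundedSubgradients) (hlam : ∀ m, 0 ≤ lam m) (hx : x ∈ P.X)
    (hμ : ∀ m, μ m ∈ box (I m) (a m)) :
    P.lagrangian lam xs μs - P.lagrangian lam x μ
      ≤ ((‖x - xc‖ ^ 2 + ∑ m, ‖μ m - μc m‖ ^ 2) - (‖x - xs‖ ^ 2 + ∑ m, ‖μ m - μs m‖ ^ 2)
        - (‖xs - xc‖ ^ 2 + ∑ m, ‖μs m - μc m‖ ^ 2)) / (2 * α) + ν := by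
  obtain ⟨-, -, hzs, h_saddle⟩ := h
  have h_gpen : ∑ m, lam m * P.gpen m x (μ m) (zs m) ≤ ∑ m, lam m * P.penSup m x (μ m) :=
    Finset.sum_le_sum fun m _ => mul_le_mul_of_nonneg_left
      (hP.gpen_le_penSup hS hx (fun i => (hμ m i).1) (hzs m)) (hlam m)
  rw [sub_le_iff_le_add, Problem.lagrangian, ← le_sub_iff_add_le']
  refine hP.sum_mul_penSup_le hlam fun z hz => ?_
  have h_z := h_saddle x hx μ hμ z hz
  simp only [Problem.innerObj] at h_z
  simp only [Problem.lagrangian, div_eq_mul_inv, mul_inv, one_mul] at h_z ⊢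
  linarith

namespace Trace

variable {R : Trace M N J I} {p : Params} {x0 : Vec N} {μ0 : (m : Fin M) → Vec (I m)} {n k : ℕ}

/-- The first `n` calls of the inner algorithm return strong `ν`-approximate saddle points. -/
def IsSaddleUpTo (R : Trace M N J I) (P : Problem M N J I) (a : Fin M → ℝ) (p : Params)
    (n : ℕ) : Prop :=
  ∀ k < n, P.IsStrongSaddle a p.α p.ν (R.x k) (R.μ k) (R.lam (k + 1))
    ((R.inner k).xout p.T) ((R.inner k).μout p.T) ((R.inner k).zout p.T)

/-- Squared distance from `(x, μ)` to the `k`-th primal iterate. -/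
noncomputable def sqDist (R : Trace M N J I) (x : Vec N) (μ : (m : Fin M) → Vec (I m)) (k : ℕ) :
    ℝ := ‖x - R.x k‖ ^ 2 + ∑ m, ‖μ m - R.μ k m‖ ^ 2

namespace IsRun

theorem x_mem (h : R.IsRun P a p x0 μ0) (hP : P.Regular) (hx0 : x0 ∈ P.X) (hk : k ≤ p.K) :
    R.x k ∈ P.X := by
  cases k with
  | zero => exact h.x_init ▸ hx0
  | succ k => exact h.x_step k hk ▸ (h.inner_run k hk).xout_mem hP

theorem μ_mem (h : R.IsRun P a p x0 μ0) (hμ0 : ∀ m, μ0 m ∈ box (I m) (a m)) (hk : k ≤ p.K)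
    (m : Fin M) : R.μ k m ∈ box (I m) (a m) := by
  cases k with
  | zero => exact h.μ_init ▸ hμ0 m
  | succ k => exact h.μ_step k hk ▸ (h.inner_run k hk).μout_mem m

theorem lam_nonneg (h : R.IsRun P a p x0 μ0) (hk : k ≤ p.K) (m : Fin M) : 0 ≤ R.lam k m := by
  cases k with
  | zero => simp [h.lam_init]
  | succ k => exact h.lam_step k hk m ▸ le_max_right _ _

theorem gpen_mem_Icc (h : R.IsRun P a p x0 μ0) (hP : P.Regular) (hS : P.BoundedSubgradients)
    (hx0 : x0 ∈ P.X) (hμ0 : ∀ m, μ0 m ∈ box (I m) (a m)) (hk : k < p.K) (m : Fin M) :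
    P.gpen m (R.x k) (R.μ k m) (R.z k m) ∈
      Set.Icc (P.penSup m (R.x k) (R.μ k m) - p.θ) (P.penSup m (R.x k) (R.μ k m)) :=
  ⟨sub_le_iff_le_add.2 (hP.penSup_le (h.z_approx k hk m)), hP.gpen_le_penSup hS
    (h.x_mem hP hx0 hk.le) (fun i => (h.μ_mem hμ0 hk.le m i).1) (h.z_mem k hk m)⟩

theorem exists_isDualAscent (h : R.IsRun P a p x0 μ0) (hP : P.Regular)
    (hS : P.BoundedSubgradients) (hx0 : x0 ∈ P.X) (hμ0 : ∀ m, μ0 m ∈ box (I m) (a m))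
    (hn : n ≤ p.K) (m : Fin M) :
    ∃ φ, IsDualAscent p.β p.θ n (fun k => P.penSup m (R.x k) (R.μ k m)) φ fun k => R.lam k m := by
  have h_exists (k : ℕ) : ∃ v ∈ Set.Icc (P.penSup m (R.x k) (R.μ k m) - p.θ)
      (P.penSup m (R.x k) (R.μ k m)), k < p.K → v = P.gpen m (R.x k) (R.μ k m) (R.z k m) := by
    by_cases hk : k < p.K
    · exact ⟨_, h.gpen_mem_Icc hP hS hx0 hμ0 hk m, fun _ => rfl⟩
    · exact ⟨_, Set.right_mem_Icc.2 (sub_le_self _ p.θ_pos.le), fun hk' => absurd hk' hk⟩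
  choose φ hφ hφ_eq using h_exists
  refine ⟨φ, by simp [h.lam_init], fun k hk => ?_, fun k _ => hφ k⟩
  rw [hφ_eq k (by omega), hφ_eq (k - 1) (by omega)]
  exact h.lam_step k (by omega) m

theorem primal_sum_le (h : R.IsRun P a p x0 μ0) (hP : P.Regular) (hS : P.BoundedSubgradients)
    (hn : n ≤ p.K) (hR : R.IsSaddleUpTo P a p n) {x : Vec N} (hx : x ∈ P.X)
    {μ : (m : Fin M) → Vec (I m)} (hμ : ∀ m, μ m ∈ box (I m) (a m)) :
    ∑ k ∈ Finset.range n, (P.lagrangian (R.lam (k + 1)) (R.x (k + 1)) (R.μ (k + 1))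
        - P.lagrangian (R.lam (k + 1)) x μ)
      + (∑ k ∈ Finset.range n, R.sqDist (R.x (k + 1)) (R.μ (k + 1)) k) / (2 * p.α)
      ≤ R.sqDist x μ 0 / (2 * p.α) + n * p.ν := by
  have hα := p.α_pos
  have h_step : ∀ k ∈ Finset.range n,
      P.lagrangian (R.lam (k + 1)) (R.x (k + 1)) (R.μ (k + 1))
          - P.lagrangian (R.lam (k + 1)) x μ
        ≤ (R.sqDist x μ k - R.sqDist x μ (k + 1) - R.sqDist (R.x (k + 1)) (R.μ (k + 1)) k)
          / (2 * p.α) + p.ν := by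
    intro k hk
    have hk' : k < n := Finset.mem_range.1 hk
    have h_saddle := hR k hk'
    rw [← h.x_step k (by omega), ← h.μ_step k (by omega)] at h_saddle
    exact h_saddle.lagrangian_sub_le hP hS (h.lam_nonneg (by omega)) hx hμ
  have h_sum := Finset.sum_le_sum h_step
  rw [Finset.sum_add_distrib, ← Finset.sum_div,
    Finset.sum_sub_distrib (fun k => R.sqDist x μ k - R.sqDist x μ (k + 1)),
    Finset.sum_range_sub', Finset.sum_const, Finset.card_range, nsmul_eq_mul, sub_div,
    sub_div] at h_sum
  have h_end : 0 ≤ R.sqDist x μ n / (2 * p.α) := by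
    unfold sqDist
    positivity
  linarith

theorem dual_sum_le (h : R.IsRun P a p x0 μ0) (hP : P.Regular) (hS : P.BoundedSubgradients)
    (hx0 : x0 ∈ P.X) (hμ0 : ∀ m, μ0 m ∈ box (I m) (a m)) {L : ℝ} (hL : P.PenSupVariationLE a L)
    (hn : n ≤ p.K) {l : Fin M → ℝ} (hl : ∀ m, 0 ≤ l m) :
    ∑ k ∈ Finset.range n, ∑ m, (l m - R.lam (k + 1) m)
        * P.penSup m (R.x (k + 1)) (R.μ (k + 1) m)
      + ∑ m, (l m - R.lam n m) ^ 2 / (4 * p.β)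
      ≤ ∑ m, l m ^ 2 / (2 * p.β) + n * (p.θ * ∑ m, l m + 2 * (M * (p.β * p.θ ^ 2)))
        + 2 * p.β * (M * L) * ∑ k ∈ Finset.range n, R.sqDist (R.x (k + 1)) (R.μ (k + 1)) k := by
  have hβ := p.β_pos
  have h_variation (m : Fin M) : ∑ k ∈ Finset.range n,
      (P.penSup m (R.x (k + 1)) (R.μ (k + 1) m) - P.penSup m (R.x k) (R.μ k m)) ^ 2
        ≤ L * ∑ k ∈ Finset.range n, R.sqDist (R.x (k + 1)) (R.μ (k + 1)) k := by
    rw [Finset.mul_sum]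
    refine Finset.sum_le_sum fun k hk => ?_
    have hk' : k + 1 ≤ p.K := (Finset.mem_range.1 hk).trans_le hn
    refine (hL.sq_le m _ (h.x_mem hP hx0 hk') _ (h.x_mem hP hx0 (by omega)) _
      (h.μ_mem hμ0 hk' m) _ (h.μ_mem hμ0 (by omega) m)).trans ?_
    exact mul_le_mul_of_nonneg_left (add_le_add le_rfl <|
      Finset.single_le_sum (f := fun m => ‖R.μ (k + 1) m - R.μ k m‖ ^ 2)
        (fun _ _ => by positivity) (Finset.mem_univ m)) hL.nonneg
  have h_constraint (m : Fin M) :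
      ∑ k ∈ Finset.range n, (l m - R.lam (k + 1) m) * P.penSup m (R.x (k + 1)) (R.μ (k + 1) m)
        + (l m - R.lam n m) ^ 2 / (4 * p.β)
      ≤ l m ^ 2 / (2 * p.β) + n * (p.θ * l m + 2 * p.β * p.θ ^ 2)
        + 2 * p.β * (L * ∑ k ∈ Finset.range n, R.sqDist (R.x (k + 1)) (R.μ (k + 1)) k) := by
    obtain ⟨φ, hφ⟩ := h.exists_isDualAscent hP hS hx0 hμ0 hn m
    exact (hφ.sum_le hβ (hl m)).trans (add_le_add le_rfl
      (mul_le_mul_of_nonneg_left (h_variation m) (by positivity)))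
  have h_sum := Finset.sum_le_sum fun m (_ : m ∈ Finset.univ) => h_constraint m
  simp only [Finset.sum_add_distrib, ← Finset.mul_sum, Finset.sum_const, Finset.card_univ,
    Fintype.card_fin, nsmul_eq_mul] at h_sum
  rw [Finset.sum_comm]
  linarith

end IsRun

end Trace

end OuterAlgorithm

section OuterBound

variable {M N : ℕ} {J I : Fin M → ℕ} {P : Problem M N J I} {a : Fin M → ℝ}

/-- The tuning of the outer algorithm; `L` is the variation constant of `penSup`. The condition on
`β` lets the proximal terms of the primal step absorb the variation of the constraint values. -/
structure Params.IsOuterTuned (p : Params) (M : ℕ) (L : ℝ) : Prop where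
  α_eq : p.α = 1
  θ_eq : p.θ = 1 / p.K
  ν_eq : p.ν = 1 / p.K
  β_le : 4 * p.β * (M * L) ≤ 1

/-- Bound on the accumulated Lagrangian gap against the multipliers `l`, for feasible sets of
diameter at most `ρ`. -/
noncomputable def gapBound (ρ β : ℝ) (l : Fin M → ℝ) : ℝ :=
  (1 + M) * ρ ^ 2 / 2 + ∑ m, l m ^ 2 / (2 * β) + (1 + ∑ m, l m + 2 * (M * β))

theorem gapBound_mono {ρ β : ℝ} (hβ : 0 < β) {l l' : Fin M → ℝ} (hl : ∀ m, 0 ≤ l m)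
    (h : ∀ m, l m ≤ l' m) : gapBound ρ β l ≤ gapBound ρ β l' := by
  unfold gapBound
  gcongr with m _ m _
  · exact hl m
  · exact h m
  · exact h m

theorem one_le_gapBound (ρ : ℝ) {β : ℝ} (hβ : 0 < β) {l : Fin M → ℝ} (hl : ∀ m, 0 ≤ l m) :
    1 ≤ gapBound ρ β l := by
  have h_sum : 0 ≤ ∑ m, l m := Finset.sum_nonneg fun m _ => hl m
  have h_quad : 0 ≤ (1 + M) * ρ ^ 2 / 2 + ∑ m, l m ^ 2 / (2 * β) + 2 * (M * β) := by positivity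
  unfold gapBound
  linarith

theorem Problem.lagrangian_sub (l l' : Fin M → ℝ) (x : Vec N) (μ : (m : Fin M) → Vec (I m)) :
    P.lagrangian l x μ - P.lagrangian l' x μ = ∑ m, (l m - l' m) * P.penSup m x (μ m) := by
  simp only [Problem.lagrangian, sub_mul, Finset.sum_sub_distrib]
  ring

theorem Problem.IsLagrangeSaddle.lagrangian_le {xs : Vec N} {μs : (m : Fin M) → Vec (I m)}
    {l l' : Fin M → ℝ} (hs : P.IsLagrangeSaddle a xs μs l) (hl' : ∀ m, 0 ≤ l' m) :
    P.lagrangian l' xs μs ≤ (P.f0 xs).toReal :=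
  add_le_of_nonpos_right <| Finset.sum_nonpos fun m _ =>
    mul_nonpos_of_nonneg_of_nonpos (hl' m) (hs.penSup_nonpos m)

namespace Trace

variable {R : Trace M N J I} {p : Params} {x0 : Vec N} {μ0 : (m : Fin M) → Vec (I m)} {n : ℕ}
  {L ρ : ℝ}

namespace IsRun

theorem sqDist_zero_le (h : R.IsRun P a p x0 μ0) (hρ : P.DiameterLE a ρ) (hx0 : x0 ∈ P.X)
    (hμ0 : ∀ m, μ0 m ∈ box (I m) (a m)) {x : Vec N} (hx : x ∈ P.X)
    {μ : (m : Fin M) → Vec (I m)} (hμ : ∀ m, μ m ∈ box (I m) (a m)) :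
    R.sqDist x μ 0 ≤ (1 + M) * ρ ^ 2 := by
  have h_μ : ∑ m, ‖μ m - μ0 m‖ ^ 2 ≤ M * ρ ^ 2 := by
    simpa using Finset.sum_le_card_nsmul Finset.univ _ (ρ ^ 2) fun m _ =>
      pow_le_pow_left₀ (norm_nonneg _) (hρ.μ_le m _ (hμ m) _ (hμ0 m)) 2
  have h_x := pow_le_pow_left₀ (norm_nonneg _) (hρ.x_le _ hx _ hx0) 2
  rw [sqDist, h.x_init, h.μ_init]
  linarith

theorem sum_gap_le (h : R.IsRun P a p x0 μ0) (hP : P.Regular) (hS : P.BoundedSubgradients)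
    (hx0 : x0 ∈ P.X) (hμ0 : ∀ m, μ0 m ∈ box (I m) (a m)) (hL : P.PenSupVariationLE a L)
    (hp : p.IsOuterTuned M L) (hn : n ≤ p.K) (hR : R.IsSaddleUpTo P a p n) {x : Vec N}
    (hx : x ∈ P.X) {μ : (m : Fin M) → Vec (I m)} (hμ : ∀ m, μ m ∈ box (I m) (a m))
    {l : Fin M → ℝ} (hl : ∀ m, 0 ≤ l m) :
    ∑ k ∈ Finset.range n, (P.lagrangian l (R.x (k + 1)) (R.μ (k + 1))
        - P.lagrangian (R.lam (k + 1)) x μ) + ∑ m, (l m - R.lam n m) ^ 2 / (4 * p.β)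
      ≤ R.sqDist x μ 0 / 2 + ∑ m, l m ^ 2 / (2 * p.β)
        + n * (p.ν + p.θ * ∑ m, l m + 2 * (M * (p.β * p.θ ^ 2))) := by
  have h_primal := h.primal_sum_le hP hS hn hR hx hμ
  have h_dual := h.dual_sum_le hP hS hx0 hμ0 hL hn hl
  have h_moved : 0 ≤ ∑ k ∈ Finset.range n, R.sqDist (R.x (k + 1)) (R.μ (k + 1)) k := by
    unfold sqDist
    positivity
  have h_absorb := mul_le_mul_of_nonneg_right hp.β_le h_moved
  simp only [hp.α_eq, mul_one] at h_primal
  simp only [← P.lagrangian_sub, Finset.sum_sub_distrib] at h_primal h_dual ⊢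
  linarith

theorem sum_lagrangian_sub_le (h : R.IsRun P a p x0 μ0) (hP : P.Regular)
    (hS : P.BoundedSubgradients) (hx0 : x0 ∈ P.X) (hμ0 : ∀ m, μ0 m ∈ box (I m) (a m))
    (hρ : P.DiameterLE a ρ) (hL : P.PenSupVariationLE a L) (hp : p.IsOuterTuned M L)
    {xs : Vec N} {μs : (m : Fin M) → Vec (I m)} {l : Fin M → ℝ}
    (hs : P.IsLagrangeSaddle a xs μs l) (hn : n ≤ p.K) (hR : R.IsSaddleUpTo P a p n)
    {l' : Fin M → ℝ} (hl' : ∀ m, 0 ≤ l' m) :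
    ∑ k ∈ Finset.range n, (P.lagrangian l' (R.x (k + 1)) (R.μ (k + 1)) - (P.f0 xs).toReal)
      + ∑ m, (l' m - R.lam n m) ^ 2 / (4 * p.β) ≤ gapBound ρ p.β l' := by
  have h_gap := h.sum_gap_le hP hS hx0 hμ0 hL hp hn hR hs.optimal.1.1 hs.μ_mem hl'
  have h_init := h.sqDist_zero_le hρ hx0 hμ0 hs.optimal.1.1 hs.μ_mem
  have h_ref : ∑ k ∈ Finset.range n, (P.lagrangian l' (R.x (k + 1)) (R.μ (k + 1))
        - (P.f0 xs).toReal)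
      ≤ ∑ k ∈ Finset.range n, (P.lagrangian l' (R.x (k + 1)) (R.μ (k + 1))
        - P.lagrangian (R.lam (k + 1)) xs μs) :=
    Finset.sum_le_sum fun k hk => sub_le_sub_left (hs.lagrangian_le fun m =>
      h.lam_nonneg ((Finset.mem_range.1 hk).trans_le hn) m) _
  have h_noise : n * (p.ν + p.θ * ∑ m, l' m + 2 * (M * (p.β * p.θ ^ 2)))
      ≤ 1 + ∑ m, l' m + 2 * (M * p.β) := by
    have h_sum : 0 ≤ ∑ m, l' m := Finset.sum_nonneg fun m _ => hl' m
    have hβ := p.β_pos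
    have hθ := p.θ_pos
    have hθ_le : p.θ ≤ 1 := by
      rw [hp.θ_eq]
      exact div_le_one_of_le₀ (by exact_mod_cast p.one_le_K) (by positivity)
    have h_nθ : n * p.θ ≤ 1 := by
      rw [hp.θ_eq, mul_one_div]
      exact div_le_one_of_le₀ (by exact_mod_cast hn) (by positivity)
    calc n * (p.ν + p.θ * ∑ m, l' m + 2 * (M * (p.β * p.θ ^ 2)))
        = n * p.θ * (1 + ∑ m, l' m + 2 * (M * (p.β * p.θ))) := by rw [hp.ν_eq, ← hp.θ_eq]; ring
      _ ≤ 1 * (1 + ∑ m, l' m + 2 * (M * (p.β * 1))) := by gcongr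
      _ = 1 + ∑ m, l' m + 2 * (M * p.β) := by ring
  unfold gapBound
  linarith

theorem lam_le (h : R.IsRun P a p x0 μ0) (hP : P.Regular)
    (hS : P.BoundedSubgradients) (hx0 : x0 ∈ P.X) (hμ0 : ∀ m, μ0 m ∈ box (I m) (a m))
    (hρ : P.DiameterLE a ρ) (hL : P.PenSupVariationLE a L) (hp : p.IsOuterTuned M L)
    {xs : Vec N} {μs : (m : Fin M) → Vec (I m)} {l : Fin M → ℝ}
    (hs : P.IsLagrangeSaddle a xs μs l) (hn : n ≤ p.K) (hR : R.IsSaddleUpTo P a p n)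
    (m : Fin M) : R.lam n m ≤ l m + (4 * p.β * gapBound ρ p.β l + 1) := by
  have hβ := p.β_pos
  have h_gap := h.sum_lagrangian_sub_le hP hS hx0 hμ0 hρ hL hp hs hn hR hs.l_nonneg
  have h_gap_nonneg : 0 ≤ ∑ k ∈ Finset.range n,
      (P.lagrangian l (R.x (k + 1)) (R.μ (k + 1)) - (P.f0 xs).toReal) := by
    refine Finset.sum_nonneg fun k hk => sub_nonneg.2 ?_
    have hk' : k + 1 ≤ p.K := (Finset.mem_range.1 hk).trans_le hn
    exact hs.le_lagrangian _ (h.x_mem hP hx0 hk') _ fun m => h.μ_mem hμ0 hk' m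
  have h_term : (l m - R.lam n m) ^ 2 / (4 * p.β) ≤ gapBound ρ p.β l :=
    (Finset.single_le_sum (f := fun m => (l m - R.lam n m) ^ 2 / (4 * p.β))
      (fun _ _ => by positivity) (Finset.mem_univ m)).trans (by linarith)
  rw [div_le_iff₀' (by positivity)] at h_term
  nlinarith only [h_term, sq_nonneg (l m - R.lam n m + 1)]

theorem lam_succ_le (h : R.IsRun P a p x0 μ0) (hP : P.Regular) (hS : P.BoundedSubgradients)
    (hx0 : x0 ∈ P.X) (hμ0 : ∀ m, μ0 m ∈ box (I m) (a m)) {B : ℝ}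
    (hB : ∀ m, ∀ x ∈ P.X, ∀ μ ∈ box (I m) (a m), |P.penSup m x μ| ≤ B)
    (hn : n < p.K) (m : Fin M) : R.lam (n + 1) m ≤ R.lam n m + 3 * p.β * (B + p.θ) := by
  have h_abs (k : ℕ) (hk : k < p.K) : |P.gpen m (R.x k) (R.μ k m) (R.z k m)| ≤ B + p.θ := by
    obtain ⟨h_lower, h_upper⟩ := h.gpen_mem_Icc hP hS hx0 hμ0 hk m
    have h_penSup := abs_le.1 (hB m _ (h.x_mem hP hx0 hk.le) _ (h.μ_mem hμ0 hk.le m))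
    exact abs_le.2 ⟨by linarith, by linarith [p.θ_pos]⟩
  have h_cur := abs_le.1 (h_abs n hn)
  have h_prev := abs_le.1 (h_abs (n - 1) (by omega))
  have h_nonneg : 0 ≤ R.lam n m + 3 * p.β * (B + p.θ) := by
    have hβ := p.β_pos
    have hB_nonneg := (abs_nonneg _).trans (h_abs n hn)
    have h_lam := h.lam_nonneg hn.le m
    positivity
  rw [h.lam_step n hn m]
  refine max_le ?_ h_nonneg
  nlinarith only [mul_le_mul_of_nonneg_left (add_le_add (mul_le_mul_of_nonneg_left h_cur.2
    zero_le_two) (neg_le.1 h_prev.1)) p.β_pos.le]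

theorem lagrangian_output_le (h : R.IsRun P a p x0 μ0) (hP : P.Regular)
    (hS : P.BoundedSubgradients) (hx0 : x0 ∈ P.X) (hμ0 : ∀ m, μ0 m ∈ box (I m) (a m))
    {l : Fin M → ℝ} (hl : ∀ m, 0 ≤ l m) :
    P.lagrangian l (R.output p.K) (fun m => (1 / (p.K : ℝ)) • ∑ k ∈ Finset.Icc 1 p.K, R.μ k m)
      ≤ 1 / p.K * ∑ k ∈ Finset.range p.K, P.lagrangian l (R.x (k + 1)) (R.μ (k + 1)) := by
  have h_jensen := map_average_le_of_convexOn (hP.convexOn_lagrangian hS a hl) p.one_le_K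
    (u := fun k => (R.x k, R.μ k)) fun k hk =>
      ⟨h.x_mem hP hx0 (Finset.mem_Icc.1 hk).2, fun m _ => h.μ_mem hμ0 (Finset.mem_Icc.1 hk).2 m⟩
  rw [← sum_Icc_one_eq_sum_range fun k => P.lagrangian l (R.x k) (R.μ k)]
  convert h_jensen using 2
  · simp [Trace.output, Prod.fst_sum]
  · ext m
    simp [Prod.snd_sum]

end IsRun

end Trace

theorem Problem.IsLagrangeSaddle.isApproxOptimal {xs x : Vec N} {μs μ : (m : Fin M) → Vec (I m)}
    {l : Fin M → ℝ} (hs : P.IsLagrangeSaddle a xs μs l) (hP : P.Regular)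
    (hS : P.BoundedSubgradients) (hx : x ∈ P.X) (hμ : ∀ m, μ m ∈ box (I m) (a m)) {ε : ℝ}
    (hε : 0 ≤ ε) (h : ∀ l' : Fin M → ℝ, (∀ m, l' m ∈ Set.Icc 0 (l m + 1)) →
      P.lagrangian l' x μ ≤ (P.f0 xs).toReal + ε) : P.IsApproxOptimal ε x := by
  refine ⟨hx, fun xs' hxs' => ?_, fun m => max_le ?_ (by exact_mod_cast hε)⟩
  · have h_value := h 0 fun m => ⟨le_rfl, add_nonneg (hs.l_nonneg m) zero_le_one⟩
    simp only [Problem.lagrangian, Pi.zero_apply, zero_mul, Finset.sum_const_zero, add_zero]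
      at h_value
    refine le_trans ?_ (add_le_add_left (hs.optimal.2 xs' hxs'.1) (ε : EReal))
    rw [← (hP.f0_finite _ hx).coe_toReal, ← (hP.f0_finite _ hs.optimal.1.1).coe_toReal]
    exact_mod_cast h_value
  · have h_raised := h (l + Pi.single m 1) fun j => by
      have := hs.l_nonneg j
      rcases eq_or_ne j m with rfl | hj
      · simp; linarith
      · simp [hj]; linarith
    have h_saddle := hs.le_lagrangian x hx μ hμ
    have h_diff := P.lagrangian_sub (l + Pi.single m 1) l x μ
    simp only [Pi.add_apply, add_sub_cancel_left, Pi.single_apply, ite_mul, one_mul, zero_mul,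
      Finset.sum_ite_eq', Finset.mem_univ, if_true] at h_diff
    refine (hP.worst_le_penSup hS hx fun i => (hμ m i).1).trans ?_
    exact_mod_cast (by linarith : P.penSup m x (μ m) ≤ ε)

end OuterBound

section Complexity

variable {M N : ℕ} {J I : Fin M → ℕ} {P : Problem M N J I} {a : Fin M → ℝ}

/-- With the parameters `p`, every inner run whose multipliers are at most `Λ` returns a strong
`p.ν`-approximate saddle point. -/
def Params.SolvesInner (p : Params) (P : Problem M N J I) (a : Fin M → ℝ) (Λ : ℝ) : Prop :=
  ∀ (Q : InnerTrace M N J I) (xc : Vec N) (μc : (m : Fin M) → Vec (I m)) (lam : Fin M → ℝ),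
    (∀ m, lam m ∈ Set.Icc 0 Λ) → Q.IsRun P a p xc μc lam →
      P.IsStrongSaddle a p.α p.ν xc μc lam (Q.xout p.T) (Q.μout p.T) (Q.zout p.T)

namespace Trace.IsRun

variable {R : Trace M N J I} {p : Params} {x0 : Vec N} {μ0 : (m : Fin M) → Vec (I m)}

theorem isSaddleUpTo (h : R.IsRun P a p x0 μ0) {Λ : ℝ} (hp : p.SolvesInner P a Λ)
    (hlam : ∀ n < p.K, R.IsSaddleUpTo P a p n → ∀ m, R.lam (n + 1) m ≤ Λ) :
    R.IsSaddleUpTo P a p p.K := by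
  intro k
  induction k using Nat.strong_induction_on with
  | _ k ih =>
    exact fun hk => hp _ _ _ _
      (fun m => ⟨h.lam_nonneg hk m, hlam k hk (fun j hj => ih j hj (hj.trans hk)) m⟩)
      (h.inner_run k hk)

theorem isApproxOptimal_output (h : R.IsRun P a p x0 μ0) (hP : P.Regular)
    (hS : P.BoundedSubgradients) (hx0 : x0 ∈ P.X) (hμ0 : ∀ m, μ0 m ∈ box (I m) (a m)) {L ρ ε : ℝ}
    (hρ : P.DiameterLE a ρ) (hL : P.PenSupVariationLE a L) (hp : p.IsOuterTuned M L)
    {xs : Vec N} {μs : (m : Fin M) → Vec (I m)} {l : Fin M → ℝ}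
    (hs : P.IsLagrangeSaddle a xs μs l) (hR : R.IsSaddleUpTo P a p p.K)
    (hK : gapBound ρ p.β (l + 1) ≤ ε * p.K) : P.IsApproxOptimal ε (R.output p.K) := by
  have hβ := p.β_pos
  have hK_pos : (0 : ℝ) < p.K := by exact_mod_cast p.one_le_K
  have h_bound_pos : 0 < gapBound ρ p.β (l + 1) :=
    one_pos.trans_le (one_le_gapBound ρ hβ fun m => add_nonneg (hs.l_nonneg m) zero_le_one)
  refine hs.isApproxOptimal hP hS (average_mem_of_convex hP.X_convex p.one_le_K fun k hk =>
    h.x_mem hP hx0 (Finset.mem_Icc.1 hk).2) (fun m => average_mem_of_convex convex_box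
    p.one_le_K fun k hk => h.μ_mem hμ0 (Finset.mem_Icc.1 hk).2 m)
    (pos_of_mul_pos_left (h_bound_pos.trans_le hK) hK_pos.le).le fun l' hl' => ?_
  have h_gap := h.sum_lagrangian_sub_le hP hS hx0 hμ0 hρ hL hp hs le_rfl hR fun m => (hl' m).1
  have h_mono : gapBound ρ p.β l' ≤ gapBound ρ p.β (l + 1) :=
    gapBound_mono hβ (fun m => (hl' m).1) fun m => (hl' m).2
  have h_sq_nonneg : 0 ≤ ∑ m, (l' m - R.lam p.K m) ^ 2 / (4 * p.β) := by positivity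
  refine (h.lagrangian_output_le hP hS hx0 hμ0 fun m => (hl' m).1).trans ?_
  rw [Finset.sum_sub_distrib, Finset.sum_const, Finset.card_range, nsmul_eq_mul] at h_gap
  rw [one_div_mul_eq_div, div_le_iff₀ hK_pos]
  linarith

end Trace.IsRun

theorem Problem.IsLagrangeSaddle.exists_outer_rate {xs : Vec N} {μs : (m : Fin M) → Vec (I m)}
    {l : Fin M → ℝ} (hs : P.IsLagrangeSaddle a xs μs l) (hP : P.Regular)
    (hS : P.BoundedSubgradients) (ha : ∀ m, 0 ≤ a m) :
    ∃ E β Λ : ℝ, 1 ≤ E ∧ 0 < β ∧ 0 ≤ Λ ∧ ∀ p : Params, p.α = 1 → p.β = β → p.θ = 1 / p.K →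
      p.ν = 1 / p.K → p.SolvesInner P a Λ → ∀ ε : ℝ, E ≤ ε * p.K →
      ∀ (R : Trace M N J I) (x0 : Vec N) (μ0 : (m : Fin M) → Vec (I m)), x0 ∈ P.X →
      (∀ m, μ0 m ∈ box (I m) (a m)) → R.IsRun P a p x0 μ0 →
      R.IsSaddleUpTo P a p p.K ∧ P.IsApproxOptimal ε (R.output p.K) := by
  obtain ⟨ρ, hρ⟩ := hP.exists_diameterLE a
  obtain ⟨L, hL⟩ := hP.exists_penSupVariationLE hS a
  obtain ⟨B, hB_nonneg, hB⟩ := hP.exists_abs_penSup_le hS ha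
  have hL_nonneg := hL.nonneg
  have hl := hs.l_nonneg
  have hl_sum : 0 ≤ ∑ m, l m := Finset.sum_nonneg fun m _ => hl m
  obtain ⟨β, hβ, hβ_le⟩ : ∃ β : ℝ, 0 < β ∧ 4 * β * (M * L) ≤ 1 := by
    refine ⟨1 / (4 * (M * L) + 1), by positivity, ?_⟩
    rw [mul_one_div, div_mul_eq_mul_div, div_le_one (by positivity)]
    linarith
  have h_gap : 1 ≤ gapBound ρ β l := one_le_gapBound ρ hβ hl
  refine ⟨gapBound ρ β (l + 1), β,
    ∑ m, l m + (4 * β * gapBound ρ β l + 1) + 3 * β * (B + 1),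
    one_le_gapBound ρ hβ fun m => add_nonneg (hl m) zero_le_one, hβ, by positivity, ?_⟩
  rintro p hα rfl hθ hν hp_inner ε hK R x0 μ0 hx0 hμ0 h
  have hp : p.IsOuterTuned M L := ⟨hα, hθ, hν, hβ_le⟩
  have hθ_le : p.θ ≤ 1 := by
    rw [hθ]
    exact div_le_one_of_le₀ (by exact_mod_cast p.one_le_K) (by positivity)
  have hR : R.IsSaddleUpTo P a p p.K := h.isSaddleUpTo hp_inner fun n hn hn_saddle m => by
    have h_single : l m ≤ ∑ m, l m := Finset.single_le_sum (fun m _ => hl m) (Finset.mem_univ m)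
    have h_lam := h.lam_le hP hS hx0 hμ0 hρ hL hp hs hn.le hn_saddle m
    have h_succ := h.lam_succ_le hP hS hx0 hμ0 hB hn m
    have hθ_mul : 3 * p.β * (B + p.θ) ≤ 3 * p.β * (B + 1) := by gcongr
    linarith
  exact ⟨hR, h.isApproxOptimal_output hP hS hx0 hμ0 hρ hL hp hs hR hK⟩

theorem exists_natCast_mem_Icc_mul_max {E ε : ℝ} (hE : 1 ≤ E) (hε : 0 < ε) :
    ∃ K : ℕ, 1 ≤ K ∧ E ≤ ε * K ∧ (K : ℝ) ≤ (E + 1) * max 1 (1 / ε) := by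
  have h_one_le : 1 ≤ max 1 (1 / ε) := le_max_left _ _
  have h_le : E * max 1 (1 / ε) ≤ ⌈E * max 1 (1 / ε)⌉₊ := Nat.le_ceil _
  refine ⟨⌈E * max 1 (1 / ε)⌉₊, Nat.one_le_ceil_iff.2 (by positivity), ?_, ?_⟩
  · rw [← div_le_iff₀' hε]
    exact le_trans (by rw [div_eq_mul_one_div]; gcongr; exact le_max_right _ _) h_le
  · linarith [Nat.ceil_lt_add_one (a := E * max 1 (1 / ε)) (by positivity)]

theorem Params.calls_le (p : Params) (M : ℕ) (I : Fin M → ℕ) {c r : ℕ} (hr : 2 ≤ r)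
    (hT : p.T = c * (p.K * p.K ^ (r - 2))) :
    p.calls M I ≤ (M + c * Params.innerIterCalls M I) * p.K ^ r := by
  obtain ⟨r, rfl⟩ := Nat.exists_eq_add_of_le' hr
  have h_self : p.K ≤ p.K ^ (r + 2) := Nat.le_self_pow (by omega) _
  simp only [Params.calls, Finset.sum_const, Finset.card_range, smul_eq_mul, hT,
    Nat.add_sub_cancel]
  calc p.K * (M + c * (p.K * p.K ^ r) * Params.innerIterCalls M I)
      = M * p.K + c * Params.innerIterCalls M I * p.K ^ (r + 2) := by ring
    _ ≤ M * p.K ^ (r + 2) + c * Params.innerIterCalls M I * p.K ^ (r + 2) := by gcongr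
    _ = (M + c * Params.innerIterCalls M I) * p.K ^ (r + 2) := by ring

theorem Problem.VariationLE.hasOracleComplexity {A L : ℝ} (hV : P.VariationLE A L)
    (hP : P.Regular) (hS : P.BoundedSubgradients) {zbar : (m : Fin M) → Vec (J m)}
    (hzbar : P.IsSlaterFamily zbar) {G : Fin M → ℝ} (hG : P.IsLowerBound zbar G) {r : ℕ}
    (hr : 2 ≤ r) (hrA : 3 ≤ r ∨ A = 0) : HasOracleComplexity P (P.multBound zbar G) r := by
  have ha := fun m => hP.multBound_nonneg hzbar hG m
  obtain ⟨xs, μs, l, hs⟩ := hP.exists_isLagrangeSaddle hS hzbar hG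
  obtain ⟨E, β, Λ, hE, hβ, hΛ, h_outer⟩ := hs.exists_outer_rate hP hS ha
  obtain ⟨c, hc, c₀, hc₀, h_inner⟩ := hV.exists_inner_rate hP hS (P.multBound zbar G) hΛ
  let W : ℕ := M + c * Params.innerIterCalls M I
  refine ⟨W * (E + 1) ^ r + 1, by positivity, fun ε hε => ?_⟩
  obtain ⟨K, hK_one, hEK, hK_le⟩ := exists_natCast_mem_Icc_mul_max hE hε
  have hs_one : 1 ≤ K ^ (r - 2) := Nat.one_le_pow _ _ hK_one
  have hK_pos : (0 : ℝ) < K := by exact_mod_cast hK_one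
  have hs_pos : (0 : ℝ) < (K ^ (r - 2) : ℕ) := by exact_mod_cast hs_one
  let p : Params := ⟨K, c * (K * K ^ (r - 2)), 1, β, 1 / K, 1 / K, c₀ / (K ^ (r - 2) : ℕ),
    c₀ / (K ^ (r - 2) : ℕ), hK_one, Nat.mul_pos hc (Nat.mul_pos hK_one hs_one), one_pos, hβ,
    one_div_pos.2 hK_pos, one_div_pos.2 hK_pos, div_pos hc₀ hs_pos, div_pos hc₀ hs_pos⟩
  have hp_inner : p.SolvesInner P (P.multBound zbar G) Λ := fun Q xc μc lam hlam hQ =>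
    h_inner K (K ^ (r - 2)) hK_one hs_one
      (hrA.imp_left fun h => Nat.le_self_pow (by omega) K) p rfl rfl rfl Q xc μc lam hlam hQ
  refine ⟨p, ?_, fun x0 hx0 μ0 hμ0 => ⟨hP.exists_run hS ha p hx0 hμ0, fun R hR =>
    h_outer p rfl rfl rfl rfl hp_inner ε hEK R x0 μ0 hx0 hμ0 hR⟩⟩
  have h_pow : max 1 (1 / ε) ^ r = max 1 ((1 / ε) ^ r) := by
    rw [pow_left_monotoneOn.map_max (Set.mem_Ici.2 zero_le_one) (one_div_pos.2 hε).le, one_pow]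
  have h_calls : (p.calls M I : ℝ) ≤ W * K ^ r := by
    exact_mod_cast (p.calls_le M I hr rfl : p.calls M I ≤ W * K ^ r)
  calc (p.calls M I : ℝ) ≤ W * K ^ r := h_calls
    _ ≤ W * ((E + 1) * max 1 (1 / ε)) ^ r := by gcongr
    _ = W * (E + 1) ^ r * max 1 ((1 / ε) ^ r) := by rw [mul_pow, h_pow, mul_assoc]
    _ ≤ (W * (E + 1) ^ r + 1) * max 1 ((1 / ε) ^ r) := by
      gcongr
      linarith

end Complexity

end RobustOpt

theorem mainTheorem6 {M N : ℕ} {J I : Fin M → ℕ} (P : RobustOpt.Problem M N J I)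
    (hP : P.Regular)
    (zbar : (m : Fin M) → RobustOpt.Vec (J m)) (hzbar : P.IsSlaterFamily zbar)
    (G : Fin M → ℝ) (hG : P.IsLowerBound zbar G) :
    (P.BoundedSubgradients → RobustOpt.HasOracleComplexity P (P.multBound zbar G) 3) ∧
    (P.LipschitzGradients → RobustOpt.HasOracleComplexity P (P.multBound zbar G) 2) := by
  constructor
  · intro hS
    obtain ⟨A, hV⟩ := hS.exists_variationLE
    exact hV.hasOracleComplexity hP hS hzbar hG (Nat.le_succ 2) (Or.inl le_rfl)
  · intro h
    obtain ⟨L, hV⟩ := h.exists_variationLE hP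
    exact hV.hasOracleComplexity hP (h.boundedSubgradients hP) hzbar hG le_rfl (Or.inr rfl)
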